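/- Weak–strong uniqueness for the Hall-MHD system. On $\mathbb{R}^3$ consider the system $$\partial_t u+\operatorname{div}(u\otimes u-B\otimes B)+\nabla p_m=\Delta u,\quad \operatorname{div}u=0,$$ $$\partial_t B-\operatorname{curl}(u\wedge B)+\operatorname{curl}\operatorname{div}(B\otimes B)=\Delta B,\quad \operatorname{div}B=0.$$ Let $\mathcal H=\{\phi\in L^2(\mathbb{R}^3;\mathbb{R}^3): \operatorname{div}\phi=0\}$ and $\mathcal V=\{\phi\in H^1(\mathbb{R}^3;\mathbb{R}^3): \operatorname{div}\phi=0\}$, with divergences in the sense of distributions. Let $u_0,B_0\in\mathcal H$ be $C^\infty$, and let $T>0$. Assume the following. (i) $(u_2,B_2)$ is a global weak solution with initial data $(u_0,B_0)$. That is, $u_2,B_2\in L^\infty(0,S;\mathcal H)\cap L^2(0,S;\mathcal V)$ for every $S>0$. For every $\Phi\in C_c^\infty([0,\infty)\times\mathbb{R}^3;\mathbb{R}^3)$ with $\operatorname{div}\Phi(t,\cdot)=0$ for all $t$, $$\int_0^\infty\!\!\int_{\mathbb{R}^3}\big(u_2\cdot\partial_t\Phi+(u_2\otimes u_2-B_2\otimes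 B_2):\nabla\Phi+u_2\cdot\Delta\Phi\big)\,dx\,dt+\int_{\mathbb{R}^3}u_0\cdot\Phi(0,\cdot)\,dx=0.$$ For every $\Phi\in C_c^\infty([0,\infty)\times\mathbb{R}^3;\mathbb{R}^3)$, $$\int_0^\infty\!\!\int_{\mathbb{R}^3}\big(B_2\cdot\partial_t\Phi+(u_2\wedge B_2)\cdot\operatorname{curl}\Phi+(B_2\otimes B_2):\nabla\operatorname{curl}\Phi+B_2\cdot\Delta\Phi\big)\,dx\,dt+\int_{\mathbb{R}^3}B_0\cdot\Phi(0,\cdot)\,dx=0.$$ Moreover, the energy inequality holds: for almost every $S>0$, $$\tfrac12\int_{\mathbb{R}^3}(|u_2|^2+|B_2|^2)(S,x)\,dx+\int_0^S\!\!\int_{\mathbb{R}^3}(|\operatorname{curl}u_2|^2+|\operatorname{curl}B_2|^2)\,dx\,dt\le\tfrac12\int_{\mathbb{R}^3}(|u_0|^2+|B_0|^2)\,dx.$$ (ii) $(u_1,B_1)$ is a smooth solution on $(0,T)$ with the same initial data. That is, $u_1,B_1\in C^\infty((0,T)\times\mathbb{R}^3)\cap C([0,T)\times\mathbb{R}^3)$;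 the system holds pointwise on $(0,T)\times\mathbb{R}^3$ for some $p_m\in C^\infty((0,T)\times\mathbb{R}^3)$; $u_1(0,\cdot)=u_0$ and $B_1(0,\cdot)=B_0$; and, for every $S\in(0,T)$, $u_1,B_1\in L^\infty(0,S;\mathcal H)\cap L^2(0,S;\mathcal V)$, and $u_1,B_1$ and their spatial derivatives of order at most two are bounded on $(0,S)\times\mathbb{R}^3$. Then $(u_2,B_2)=(u_1,B_1)$ almost everywhere on $(0,T)\times\mathbb{R}^3$. -/

import Mathlib

open MeasureTheory Set
open scoped ContDiff InnerProductSpace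

noncomputable section

namespace HallMHD

/-- The physical space `ℝ³` with its Euclidean norm. -/
abbrev E3 : Type := EuclideanSpace ℝ (Fin 3)

/-- The `j`-th vector of the canonical basis. -/
def e (j : Fin 3) : E3 := EuclideanSpace.single j 1

/-- The vector product `a ∧ b`. -/
def cross (a b : E3) : E3 := WithLp.toLp 2 (crossProduct a.ofLp b.ofLp)

/-- The curl attached to a Jacobian matrix `L`, where `(L (e j)) i = ∂ⱼ vᵢ`. -/
def curlOf (L : E3 →L[ℝ] E3) : E3 :=
  !₂[(L (e 1)) 2 - (L (e 2)) 1, (L (e 2)) 0 - (L (e 0)) 2, (L (e 0)) 1 - (L (e 1)) 0]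

/-- The classical curl. -/
def curl (v : E3 → E3) (x : E3) : E3 := curlOf (fderiv ℝ v x)

/-- The classical divergence. -/
def divergence (v : E3 → E3) (x : E3) : ℝ := ∑ j, (fderiv ℝ v x (e j)) j

/-- The vector field `div (a ⊗ b)`, with components `∑ⱼ ∂ⱼ (aᵢ bⱼ)`. -/
def divTensor (a b : E3 → E3) (x : E3) : E3 :=
  ∑ j, fderiv ℝ (fun y => (b y) j • a y) x (e j)

/-- `div v = 0` in the sense of distributions on `ℝ³`. -/
def WeakDivFree (v : E3 → E3) : Prop :=
  ∀ ψ : E3 → ℝ, ContDiff ℝ ∞ ψ → HasCompactSupport ψ → ∫ x, fderiv ℝ ψ x (v x) = 0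

/-- The space `𝓗` of divergence free fields in `L²(ℝ³; ℝ³)`. -/
def MemH (v : E3 → E3) : Prop := MemLp v 2 volume ∧ WeakDivFree v

/-- `G` is the Jacobian matrix of `v` in the sense of distributions on `ℝ³`. -/
def HasWeakGradient (v : E3 → E3) (G : E3 → E3 →L[ℝ] E3) : Prop :=
  LocallyIntegrable v volume ∧ LocallyIntegrable G volume ∧
    ∀ φ : E3 → ℝ, ContDiff ℝ ∞ φ → HasCompactSupport φ → ∀ j : Fin 3,
      ∫ x, (fderiv ℝ φ x (e j)) • v x = - ∫ x, φ x • G x (e j)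

/-- `v ∈ L^∞(0,T; 𝓗) ∩ L²(0,T; 𝓥)`, where `𝓥` is the space of divergence free fields in `H¹`,
and `G` is the weak spatial gradient of `v` on `(0,T) × ℝ³`. -/
structure InEnergyClass (T : ℝ) (v : ℝ → E3 → E3) (G : ℝ → E3 → E3 →L[ℝ] E3) : Prop where
  measurable : AEStronglyMeasurable (Function.uncurry v)
    (volume.restrict (Ioo 0 T ×ˢ (univ : Set E3)))
  bounded : ∃ C : NNReal, ∀ᵐ t ∂(volume.restrict (Ioo 0 T)), eLpNorm (v t) 2 volume ≤ C
  mem_H : ∀ᵐ t ∂(volume.restrict (Ioo 0 T)), MemH (v t)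
  weakGradient : ∀ᵐ t ∂(volume.restrict (Ioo 0 T)), HasWeakGradient (v t) (G t)
  gradient_memLp : MemLp (Function.uncurry G) 2 (volume.restrict (Ioo 0 T ×ˢ (univ : Set E3)))

/-- Test fields: restrictions to `t ≥ 0` of these are the smooth fields with compact support in
`[0,∞) × ℝ³`; they need not vanish at `t = 0`. -/
def IsTestField (Φ : ℝ → E3 → E3) : Prop :=
  ContDiff ℝ ∞ (Function.uncurry Φ) ∧ HasCompactSupport (Function.uncurry Φ)

/-- `∂ₜ u + div (u ⊗ u - B ⊗ B) + ∇ p = Δ u` on `(0,∞) × ℝ³` with `u(0) = u₀`, in the sense of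
distributions; the pressure is eliminated by divergence free test fields. -/
def WeakMomentum (u B : ℝ → E3 → E3) (u₀ : E3 → E3) : Prop :=
  ∀ Φ : ℝ → E3 → E3, IsTestField Φ → (∀ t x, divergence (Φ t) x = 0) →
    (∫ t in Ioi (0 : ℝ), ∫ x,
      (⟪u t x, deriv (fun s => Φ s x) t⟫_ℝ
        + ⟪u t x, fderiv ℝ (Φ t) x (u t x)⟫_ℝ
        - ⟪B t x, fderiv ℝ (Φ t) x (B t x)⟫_ℝ
        + ⟪u t x, Laplacian.laplacian (Φ t) x⟫_ℝ))
      + ∫ x, ⟪u₀ x, Φ 0 x⟫_ℝ = 0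

/-- `∂ₜ B - curl (u ∧ B) + curl div (B ⊗ B) = Δ B` on `(0,∞) × ℝ³` with `B(0) = B₀`, in the sense
of distributions. -/
def WeakInduction (u B : ℝ → E3 → E3) (B₀ : E3 → E3) : Prop :=
  ∀ Φ : ℝ → E3 → E3, IsTestField Φ →
    (∫ t in Ioi (0 : ℝ), ∫ x,
      (⟪B t x, deriv (fun s => Φ s x) t⟫_ℝ
        + ⟪cross (u t x) (B t x), curl (Φ t) x⟫_ℝ
        + ⟪B t x, fderiv ℝ (curl (Φ t)) x (B t x)⟫_ℝ
        + ⟪B t x, Laplacian.laplacian (Φ t) x⟫_ℝ))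
      + ∫ x, ⟪B₀ x, Φ 0 x⟫_ℝ = 0

/-- The energy of a pair of fields at a given time. -/
def energy (u B : E3 → E3) : ℝ := (1 / 2) * ∫ x, (‖u x‖ ^ 2 + ‖B x‖ ^ 2)

/-- The dissipation at a given time, in terms of the weak gradients of the two fields. -/
def dissipation (Gu GB : E3 → E3 →L[ℝ] E3) : ℝ :=
  ∫ x, (‖curlOf (Gu x)‖ ^ 2 + ‖curlOf (GB x)‖ ^ 2)

/-- Global weak solutions of the Hall-MHD system with finite energy, satisfying the energy
inequality. -/
def IsGlobalWeakSolution (u B : ℝ → E3 → E3) (u₀ B₀ : E3 → E3) : Prop :=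
  ∃ Gu GB : ℝ → E3 → E3 →L[ℝ] E3,
    (∀ T : ℝ, 0 < T → InEnergyClass T u Gu ∧ InEnergyClass T B GB) ∧
    WeakMomentum u B u₀ ∧
    WeakInduction u B B₀ ∧
    ∀ᵐ T ∂(volume.restrict (Ioi (0 : ℝ))),
      energy (u T) (B T) + ∫ t in Ioc 0 T, dissipation (Gu t) (GB t) ≤ energy u₀ B₀

/-- Regularity of a smooth field on `(0,T) × ℝ³` with initial value `v₀`: it is `C^∞` on
`(0,T) × ℝ³`, continuous up to `t = 0`, and on each `(0,S)` with `S < T` it belongs to the energy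
class and is bounded together with its spatial derivatives of order at most two. -/
structure IsSmoothField (T : ℝ) (v : ℝ → E3 → E3) (v₀ : E3 → E3) : Prop where
  contDiffOn : ContDiffOn ℝ ∞ (Function.uncurry v) (Ioo 0 T ×ˢ univ)
  continuousOn : ContinuousOn (Function.uncurry v) (Ico 0 T ×ˢ univ)
  initial : ∀ x, v 0 x = v₀ x
  energyClass : ∀ S : ℝ, 0 < S → S < T → InEnergyClass S v (fun t => fderiv ℝ (v t))
  bounded : ∀ S : ℝ, 0 < S → S < T → ∀ k : ℕ, k ≤ 2 →
    ∃ C : ℝ, ∀ t ∈ Ioo 0 S, ∀ x, ‖iteratedFDeriv ℝ k (v t) x‖ ≤ C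

/-- Smooth solutions on `(0,T) × ℝ³` of the Hall-MHD system in conservative form. -/
structure IsSmoothSolution (T : ℝ) (u B : ℝ → E3 → E3) (u₀ B₀ : E3 → E3) : Prop where
  smooth_u : IsSmoothField T u u₀
  smooth_B : IsSmoothField T B B₀
  momentum : ∃ p : ℝ → E3 → ℝ, ContDiffOn ℝ ∞ (Function.uncurry p) (Ioo 0 T ×ˢ univ) ∧
    ∀ t ∈ Ioo 0 T, ∀ x,
      deriv (fun s => u s x) t + (divTensor (u t) (u t) x - divTensor (B t) (B t) x)
        + gradient (p t) x = Laplacian.laplacian (u t) x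
  div_u : ∀ t ∈ Ioo 0 T, ∀ x, divergence (u t) x = 0
  induction_eq : ∀ t ∈ Ioo 0 T, ∀ x,
    deriv (fun s => B s x) t - curl (fun y => cross (u t y) (B t y)) x
      + curl (divTensor (B t) (B t)) x = Laplacian.laplacian (B t) x
  div_B : ∀ t ∈ Ioo 0 T, ∀ x, divergence (B t) x = 0

end HallMHD

end

noncomputable section

namespace HallMHD

open Filter Topology

/-! ### Weak convergence of bounded sequences in L² -/

section WeakConvergence

variable {α : Type*} [MeasurableSpace α] {μ : Measure α}
variable {E : Type*} [NormedAddCommGroup E] [InnerProductSpace ℝ E]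

/-! The proof is the relative energy method. Put E(t) = ∫ |u₂ - u₁|² + |B₂ - B₁|² and expand the
squares. The terms |u₂|² + |B₂|² are controlled by the energy inequality of the weak solution, the
terms |u₁|² + |B₁|² satisfy an energy identity (`IsSmoothEvolution.energy_identity`), and the cross
terms u₂·u₁ and B₂·B₁ satisfy a product rule (`IsWeakEvolution.cross_identity`). The initial
energies cancel, and the dissipative terms combine into minus the L² norms of curl (u₂ - u₁) and
curl (B₂ - B₁), which are discarded. What remains of the nonlinearity is, up to integrals of v·∇π
with v solenoidal, a quadratic form in the differences whose coefficients are ∇u₁, curl B₁ and ∇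
curl B₁ (`relative_energy_algebra`, `relative_flux_le`). The Hall term thus puts all its derivatives
on B₁, and bounded second derivatives of B₁ suffice. Hence E(t) ≤ 2K ∫₀ᵗ E, and Gronwall's lemma
gives E = 0.

Two points need care. The first is the product rule: the weak solution is only measurable in time,
and nothing is assumed on the integrability of ∂ₜu₁ and ∂ₜB₁. The times are therefore doubled. At
fixed s the equation of v(t) is tested with w(s), and at fixed t the equation of w(s) is tested with
v(t). Weighting both with a kernel k(s - t) supported in s > t cancels the k' terms, and as the
kernel concentrates the diagonal s = t is reached (`diagonal_identity`). The limit exists because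
the smooth factor is continuous in time.

The second is the choice of test fields, which must have compact support and be solenoidal. A
solenoidal u on ℝ³ is the curl of a ∧ x, where a(x) = ∫₀¹ s u(sx) ds. Cutting off this potential
rather than u produces solenoidal truncations with bounds independent of the scale
(`divergence_truncation`, `exists_solenoidalApprox`). For the rough field v(t), mollification comes
first (`exists_smooth_approx`). -/

theorem integrable_inner_of_memLp {V W : α → E} (hV : MemLp V 2 μ) (hW : MemLp W 2 μ) :
    Integrable (fun x => ⟪V x, W x⟫_ℝ) μ := by
  refine Integrable.mono' (hV.norm.integrable_mul hW.norm)
    (hV.aestronglyMeasurable.inner hW.aestronglyMeasurable) ?_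
  filter_upwards with x
  simpa using abs_real_inner_le_norm (V x) (W x)

theorem integral_norm_sq_le_of_eLpNorm_le {F : Type*} [NormedAddCommGroup F] {V : α → F}
    (hV : MemLp V 2 μ) {C : NNReal} (h : eLpNorm V 2 μ ≤ C) :
    ∫ x, ‖V x‖ ^ 2 ∂μ ≤ (C : ℝ) ^ 2 := by
  have h1 := hV.eLpNorm_eq_integral_rpow_norm (by norm_num) (by norm_num)
  rw [h1] at h
  have h0 : (0 : ℝ) ≤ ∫ x, ‖V x‖ ^ 2 ∂μ := integral_nonneg fun x => by positivity
  have h2 : ENNReal.ofReal ((∫ x, ‖V x‖ ^ 2 ∂μ) ^ (2⁻¹ : ℝ)) ≤ C := by simpa using h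
  have h3 : (∫ x, ‖V x‖ ^ 2 ∂μ) ^ (2⁻¹ : ℝ) ≤ C := by
    rw [← ENNReal.ofReal_coe_nnreal] at h2
    exact (ENNReal.ofReal_le_ofReal_iff C.2).1 h2
  have h4 : ((∫ x, ‖V x‖ ^ 2 ∂μ) ^ (2⁻¹ : ℝ)) ^ 2 = ∫ x, ‖V x‖ ^ 2 ∂μ := by
    rw [← Real.rpow_natCast, ← Real.rpow_mul h0]; norm_num
  rw [← h4]
  gcongr

/-- The integral form of the Cauchy-Schwarz inequality, with the arithmetic mean on the right. -/
theorem abs_integral_inner_le {V W : α → E} (hV : MemLp V 2 μ) (hW : MemLp W 2 μ) :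
    |∫ x, ⟪V x, W x⟫_ℝ ∂μ| ≤ ∫ x, ‖V x‖ ^ 2 ∂μ + ∫ x, ‖W x‖ ^ 2 ∂μ := by
  have iV := (memLp_two_iff_integrable_sq_norm hV.aestronglyMeasurable).1 hV
  have iW := (memLp_two_iff_integrable_sq_norm hW.aestronglyMeasurable).1 hW
  rw [← integral_add iV iW]
  refine (abs_integral_le_integral_abs).trans (integral_mono_ae
    (integrable_inner_of_memLp hV hW).abs (iV.add iW) ?_)
  filter_upwards with x
  have := abs_real_inner_le_norm (V x) (W x)
  nlinarith [sq_nonneg (‖V x‖ - ‖W x‖), norm_nonneg (V x), norm_nonneg (W x)]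

theorem norm_sub_sq_le_two_mul {F : Type*} [SeminormedAddCommGroup F] (a b : F) :
    ‖a - b‖ ^ 2 ≤ 2 * ‖a‖ ^ 2 + 2 * ‖b‖ ^ 2 := by
  have := norm_sub_le a b
  nlinarith [sq_nonneg (‖a‖ - ‖b‖), norm_nonneg (a - b), norm_nonneg a, norm_nonneg b]

/-- Bounded sequences in `L²` that converge almost everywhere converge weakly. -/
theorem tendsto_integral_inner_of_bounded {ι : Type*} {l : Filter ι} [l.IsCountablyGenerated]
    {f : ι → α → E} {F V : α → E} {C : ℝ} (hV : MemLp V 2 μ) (hF : MemLp F 2 μ)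
    (hf : ∀ᶠ n in l, MemLp (f n) 2 μ) (hC : ∀ᶠ n in l, ∫ x, ‖f n x‖ ^ 2 ∂μ ≤ C)
    (hlim : ∀ᵐ x ∂μ, Tendsto (fun n => f n x) l (𝓝 (F x))) :
    Tendsto (fun n => ∫ x, ⟪V x, f n x⟫_ℝ ∂μ) l (𝓝 (∫ x, ⟪V x, F x⟫_ℝ ∂μ)) := by
  have iV := (memLp_two_iff_integrable_sq_norm hV.aestronglyMeasurable).1 hV
  have iF := (memLp_two_iff_integrable_sq_norm hF.aestronglyMeasurable).1 hF
  set D : ℝ := 2 * C + 2 * ∫ x, ‖F x‖ ^ 2 ∂μ with hD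
  -- Where |f n - F| ≤ M|V| the integrand is dominated by M|V|². Elsewhere |V| ≤ M⁻¹|f n - F|, so
  -- the pairing costs at most M⁻¹∫|f n - F|² ≤ D/M. This replaces Egorov's theorem and needs no
  -- finiteness of the measure.
  have key : ∀ M : ℝ, 0 < M → Tendsto
      (fun n => ∫ x, min ‖f n x - F x‖ (M * ‖V x‖) * ‖V x‖ ∂μ) l (𝓝 0) := by
    intro M hM
    have : (0 : ℝ) = ∫ x, (0 : ℝ) ∂μ := by simp
    rw [this]
    refine tendsto_integral_filter_of_dominated_convergence (fun x => M * ‖V x‖ ^ 2) ?_ ?_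
      (iV.const_mul M) ?_
    · filter_upwards [hf] with n hn
      exact ((((hn.sub hF).aestronglyMeasurable.norm).inf
        (hV.aestronglyMeasurable.norm.const_mul M))).mul hV.aestronglyMeasurable.norm
    · filter_upwards with n
      filter_upwards with x
      have h1 : 0 ≤ min ‖f n x - F x‖ (M * ‖V x‖) := le_min (norm_nonneg _) (by positivity)
      rw [Real.norm_of_nonneg (by positivity), pow_two, ← mul_assoc]
      gcongr
      exact min_le_right _ _
    · filter_upwards [hlim] with x hx
      have h1 : Tendsto (fun n => ‖f n x - F x‖) l (𝓝 0) := by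
        simpa using (hx.sub_const (F x)).norm
      have h2 := (h1.min (tendsto_const_nhds (x := M * ‖V x‖))).mul_const ‖V x‖
      rwa [min_eq_left (by positivity), zero_mul] at h2
  rw [Metric.tendsto_nhds]
  intro ε hε
  -- Chosen so that |D|/M < ε/2; the other half of ε comes from `key`.
  set M : ℝ := 2 * (|D| + 1) / ε with hMdef
  have hM : 0 < M := by positivity
  have hDM : |D| / M < ε / 2 := by
    rw [hMdef, div_div_eq_mul_div, div_lt_div_iff₀ (by positivity) (by norm_num)]
    nlinarith [abs_nonneg D]
  filter_upwards [hf, hC, (key M hM).eventually (gt_mem_nhds (half_pos hε))] with n hn hCn hkn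
  have hd : MemLp (fun x => f n x - F x) 2 μ := hn.sub hF
  have in' := (memLp_two_iff_integrable_sq_norm hn.aestronglyMeasurable).1 hn
  have id := (memLp_two_iff_integrable_sq_norm hd.aestronglyMeasurable).1 hd
  have hdD : ∫ x, ‖f n x - F x‖ ^ 2 ∂μ ≤ D := by
    calc ∫ x, ‖f n x - F x‖ ^ 2 ∂μ ≤ ∫ x, (2 * ‖f n x‖ ^ 2 + 2 * ‖F x‖ ^ 2) ∂μ := by
          refine integral_mono id ((in'.const_mul 2).add (iF.const_mul 2)) fun x => ?_
          exact norm_sub_sq_le_two_mul _ _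
      _ = 2 * ∫ x, ‖f n x‖ ^ 2 ∂μ + 2 * ∫ x, ‖F x‖ ^ 2 ∂μ := by
          rw [integral_add (in'.const_mul 2) (iF.const_mul 2), integral_const_mul,
            integral_const_mul]
      _ ≤ D := by rw [hD]; linarith
  have hmin : Integrable (fun x => min ‖f n x - F x‖ (M * ‖V x‖) * ‖V x‖) μ := by
    refine Integrable.mono' (iV.const_mul M) (((hd.aestronglyMeasurable.norm).inf
        (hV.aestronglyMeasurable.norm.const_mul M)).mul hV.aestronglyMeasurable.norm) ?_
    filter_upwards with x
    have h1 : 0 ≤ min ‖f n x - F x‖ (M * ‖V x‖) := le_min (norm_nonneg _) (by positivity)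
    rw [Real.norm_of_nonneg (by positivity), pow_two, ← mul_assoc]
    gcongr
    exact min_le_right _ _
  rw [Real.dist_eq, ← integral_sub (integrable_inner_of_memLp hV hn)
    (integrable_inner_of_memLp hV hF)]
  have hb : |∫ x, (⟪V x, f n x⟫_ℝ - ⟪V x, F x⟫_ℝ) ∂μ| ≤
      ∫ x, (min ‖f n x - F x‖ (M * ‖V x‖) * ‖V x‖ + M⁻¹ * ‖f n x - F x‖ ^ 2) ∂μ := by
    refine abs_integral_le_integral_abs.trans (integral_mono
      ((integrable_inner_of_memLp hV hn).sub (integrable_inner_of_memLp hV hF)).abs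
      (hmin.add (id.const_mul _)) fun x => ?_)
    simp only
    rw [← inner_sub_right]
    have h1 := abs_real_inner_le_norm (V x) (f n x - F x)
    refine h1.trans ?_
    rcases le_total ‖f n x - F x‖ (M * ‖V x‖) with h | h
    · rw [min_eq_left h]
      have : 0 ≤ M⁻¹ * ‖f n x - F x‖ ^ 2 := by positivity
      linarith [mul_comm ‖V x‖ ‖f n x - F x‖]
    · rw [min_eq_right h]
      have h2 : ‖V x‖ ≤ M⁻¹ * ‖f n x - F x‖ := by
        rw [inv_mul_eq_div, le_div_iff₀ hM]; linarith
      have h3 : 0 ≤ M * ‖V x‖ * ‖V x‖ := by positivity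
      nlinarith [norm_nonneg (f n x - F x)]
  rw [integral_add hmin (id.const_mul _), integral_const_mul] at hb
  have h5 : M⁻¹ * ∫ x, ‖f n x - F x‖ ^ 2 ∂μ ≤ |D| / M := by
    rw [inv_mul_eq_div]
    gcongr
    exact hdD.trans (le_abs_self D)
  linarith

end WeakConvergence

/-! ### Functions on a time slab -/

/-- The measure on the time interval `(0,S)`. -/
abbrev timeMeasure (S : ℝ) : Measure ℝ := volume.restrict (Ioo 0 S)

/-- The measure on the slab `(0,S) × ℝ³`. -/
abbrev slabMeasure (S : ℝ) : Measure (ℝ × E3) := (timeMeasure S).prod volume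

theorem restrict_slab (S : ℝ) :
    (volume : Measure (ℝ × E3)).restrict (Ioo 0 S ×ˢ (univ : Set E3)) = slabMeasure S := by
  rw [slabMeasure, timeMeasure, Measure.volume_eq_prod, ← Measure.prod_restrict,
    Measure.restrict_univ]

section Slab

variable {X : Type*} [NormedAddCommGroup X]

/-- The added time variable costs nothing because the interval (0,S) has finite measure. The three
variables are the two times and the point of space. -/
theorem integrable_lift_fst {S : ℝ} {h : ℝ × E3 → X} (hh : Integrable h (slabMeasure S)) :
    Integrable (fun p : (ℝ × ℝ) × E3 => h (p.1.1, p.2))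
      (((timeMeasure S).prod (timeMeasure S)).prod volume) := by
  have h1 : Integrable (fun q : ℝ × (ℝ × E3) => h q.2)
      ((timeMeasure S).prod ((timeMeasure S).prod volume)) := hh.comp_snd _
  have h2 := (measurePreserving_prodAssoc (timeMeasure S) (timeMeasure S)
    (volume : Measure E3)).integrable_comp_of_integrable h1
  have h3 : MeasurePreserving (Prod.map Prod.swap id)
      (((timeMeasure S).prod (timeMeasure S)).prod (volume : Measure E3))
      (((timeMeasure S).prod (timeMeasure S)).prod volume) :=
    Measure.measurePreserving_swap.prod (MeasurePreserving.id _)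
  exact h3.integrable_comp_of_integrable h2

theorem integrable_lift_snd {S : ℝ} {h : ℝ × E3 → X} (hh : Integrable h (slabMeasure S)) :
    Integrable (fun p : (ℝ × ℝ) × E3 => h (p.1.2, p.2))
      (((timeMeasure S).prod (timeMeasure S)).prod volume) := by
  have h1 : Integrable (fun q : ℝ × (ℝ × E3) => h q.2)
      ((timeMeasure S).prod ((timeMeasure S).prod volume)) := hh.comp_snd _
  exact (measurePreserving_prodAssoc (timeMeasure S) (timeMeasure S)
    (volume : Measure E3)).integrable_comp_of_integrable h1

theorem aestronglyMeasurable_lift_fst {S : ℝ} {h : ℝ × E3 → X}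
    (hh : AEStronglyMeasurable h (slabMeasure S)) :
    AEStronglyMeasurable (fun p : (ℝ × ℝ) × E3 => h (p.1.1, p.2))
      (((timeMeasure S).prod (timeMeasure S)).prod volume) := by
  have := hh.comp_quasiMeasurePreserving
    (QuasiMeasurePreserving.prodMap
      (Measure.quasiMeasurePreserving_fst (μ := timeMeasure S) (ν := timeMeasure S))
      (Measure.QuasiMeasurePreserving.id (volume : Measure E3)))
  exact this

theorem aestronglyMeasurable_lift_snd {S : ℝ} {h : ℝ × E3 → X}
    (hh : AEStronglyMeasurable h (slabMeasure S)) :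
    AEStronglyMeasurable (fun p : (ℝ × ℝ) × E3 => h (p.1.2, p.2))
      (((timeMeasure S).prod (timeMeasure S)).prod volume) := by
  have := hh.comp_quasiMeasurePreserving
    (QuasiMeasurePreserving.prodMap
      (Measure.quasiMeasurePreserving_snd (μ := timeMeasure S) (ν := timeMeasure S))
      (Measure.QuasiMeasurePreserving.id (volume : Measure E3)))
  exact this

/-- A field that is bounded in `L²` uniformly in time is square integrable on a slab. -/
theorem memLp_slab_of_bounded {S : ℝ} {v : ℝ → E3 → X}
    (hm : AEStronglyMeasurable (Function.uncurry v) (slabMeasure S)) {C : NNReal}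
    (hC : ∀ᵐ t ∂(timeMeasure S), eLpNorm (v t) 2 volume ≤ C) :
    MemLp (Function.uncurry v) 2 (slabMeasure S) := by
  refine ⟨hm, ?_⟩
  rw [eLpNorm_lt_top_iff_lintegral_rpow_enorm_lt_top (by norm_num) (by norm_num)]
  rw [lintegral_prod _ (by fun_prop)]
  have : ∀ᵐ t ∂(timeMeasure S), ∫⁻ x, ‖Function.uncurry v (t, x)‖ₑ ^ (2 : ENNReal).toReal
      ≤ (C : ENNReal) ^ (2 : ℝ) := by
    filter_upwards [hC] with t ht
    rw [eLpNorm_eq_lintegral_rpow_enorm_toReal (by norm_num) (by norm_num)] at ht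
    have := ENNReal.rpow_le_rpow ht (z := 2) (by norm_num)
    rw [← ENNReal.rpow_mul] at this
    simpa using this
  refine (lintegral_mono_ae this).trans_lt ?_
  rw [lintegral_const]
  exact ENNReal.mul_lt_top (by simp) (by simp [timeMeasure])

theorem memLp_slice {S : ℝ} {v : ℝ → E3 → X}
    (hv : MemLp (Function.uncurry v) 2 (slabMeasure S)) :
    ∀ᵐ t ∂(timeMeasure S), MemLp (v t) 2 volume := by
  have h1 := (memLp_two_iff_integrable_sq_norm hv.aestronglyMeasurable).1 hv
  filter_upwards [h1.prod_right_ae, hv.aestronglyMeasurable.prodMk_left] with t ht ht'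
  exact (memLp_two_iff_integrable_sq_norm ht').2 ht

theorem integrable_integral_norm_sq {S : ℝ} {v : ℝ → E3 → X}
    (hv : MemLp (Function.uncurry v) 2 (slabMeasure S)) :
    Integrable (fun t => ∫ x, ‖v t x‖ ^ 2) (timeMeasure S) :=
  ((memLp_two_iff_integrable_sq_norm hv.aestronglyMeasurable).1 hv).integral_prod_left

end Slab

/-! ### Behaviour of time correlations near the diagonal -/

/-- Continuous weights vanishing near and beyond the time `S`. -/
structure IsWeight (S : ℝ) (θ : ℝ → ℝ) : Prop where
  continuous : Continuous θ
  vanish : ∃ S' < S, ∀ t, S' ≤ t → θ t = 0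

theorem IsWeight.bounded {S : ℝ} {θ : ℝ → ℝ} (h : IsWeight S θ) :
    ∃ C, 0 ≤ C ∧ ∀ t ∈ Ioo 0 S, |θ t| ≤ C := by
  obtain ⟨C, hC⟩ := (isCompact_Icc (a := 0) (b := S)).exists_bound_of_continuousOn
    h.continuous.continuousOn
  refine ⟨max C 0, le_max_right _ _, fun t ht => le_max_of_le_left ?_⟩
  simpa using hC t ⟨ht.1.le, ht.2.le⟩

/-- Integrable functions on `(0,S)²` whose restrictions to `{s = t + ρ}` converge weakly to the
restriction to the diagonal as `ρ → 0+`. -/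
structure DiagCont (S : ℝ) (f : ℝ → ℝ → ℝ) : Prop where
  integrable : Integrable (Function.uncurry f) ((timeMeasure S).prod (timeMeasure S))
  diag_integrable : Integrable (fun t => f t t) (timeMeasure S)
  shift_integrable : ∀ θ, IsWeight S θ → ∀ᶠ ρ in 𝓝[>] (0 : ℝ),
    Integrable (fun t => θ t * f t (t + ρ)) (timeMeasure S)
  tendsto : ∀ θ, IsWeight S θ → Tendsto (fun ρ => ∫ t, θ t * f t (t + ρ) ∂(timeMeasure S))
    (𝓝[>] 0) (𝓝 (∫ t, θ t * f t t ∂(timeMeasure S)))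

theorem IsWeight.integrable_mul {S : ℝ} {θ : ℝ → ℝ} (h : IsWeight S θ) {f : ℝ → ℝ}
    (hf : Integrable f (timeMeasure S)) : Integrable (fun t => θ t * f t) (timeMeasure S) := by
  obtain ⟨C, hC0, hC⟩ := h.bounded
  refine hf.bdd_mul (c := C) h.continuous.aestronglyMeasurable ?_
  filter_upwards [ae_restrict_mem measurableSet_Ioo] with t ht
  simpa using hC t ht

theorem DiagCont.add {S : ℝ} {f g : ℝ → ℝ → ℝ} (hf : DiagCont S f) (hg : DiagCont S g) :
    DiagCont S (fun t s => f t s + g t s) where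
  integrable := hf.integrable.add hg.integrable
  diag_integrable := hf.diag_integrable.add hg.diag_integrable
  shift_integrable θ hθ := by
    filter_upwards [hf.shift_integrable θ hθ, hg.shift_integrable θ hθ] with ρ h1 h2
    simp only [mul_add]
    exact h1.add h2
  tendsto θ hθ := by
    have := (hf.tendsto θ hθ).add (hg.tendsto θ hθ)
    rw [← integral_add (hθ.integrable_mul hf.diag_integrable)
      (hθ.integrable_mul hg.diag_integrable)] at this
    simp only [mul_add]
    refine this.congr' ?_
    filter_upwards [hf.shift_integrable θ hθ, hg.shift_integrable θ hθ] with ρ h1 h2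
    rw [integral_add h1 h2]

theorem DiagCont.neg {S : ℝ} {f : ℝ → ℝ → ℝ} (hf : DiagCont S f) :
    DiagCont S (fun t s => - f t s) where
  integrable := hf.integrable.neg
  diag_integrable := hf.diag_integrable.neg
  shift_integrable θ hθ := by
    filter_upwards [hf.shift_integrable θ hθ] with ρ h1
    simp only [mul_neg]
    exact h1.neg
  tendsto θ hθ := by
    simpa only [mul_neg, integral_neg] using (hf.tendsto θ hθ).neg

theorem DiagCont.sub {S : ℝ} {f g : ℝ → ℝ → ℝ} (hf : DiagCont S f) (hg : DiagCont S g) :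
    DiagCont S (fun t s => f t s - g t s) := by
  simpa only [sub_eq_add_neg] using hf.add hg.neg

theorem slab_continuity {X : Type*} [NormedAddCommGroup X] {S : ℝ} {W : ℝ → E3 → X}
    (hW : ContinuousOn (Function.uncurry W) (Ioo 0 S ×ˢ univ)) {t : ℝ} (ht : t ∈ Ioo 0 S)
    (x : E3) : Tendsto (fun ρ => W (t + ρ) x) (𝓝[>] 0) (𝓝 (W t x)) := by
  have h1 : ContinuousAt (Function.uncurry W) (t, x) :=
    hW.continuousAt ((isOpen_Ioo.prod isOpen_univ).mem_nhds ⟨ht, mem_univ _⟩)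
  have h2 : Tendsto (fun ρ : ℝ => (t + ρ, x)) (𝓝[>] 0) (𝓝 (t, x)) := by
    have : Tendsto (fun ρ : ℝ => (t + ρ, x)) (𝓝 0) (𝓝 (t + 0, x)) := by
      apply Continuous.tendsto; fun_prop
    rw [add_zero] at this
    exact this.mono_left nhdsWithin_le_nhds
  exact h1.tendsto.comp h2

theorem aestronglyMeasurable_slab {X : Type*} [NormedAddCommGroup X]
    {S : ℝ} {W : ℝ → E3 → X} [SecondCountableTopologyEither (ℝ × E3) X]
    (hW : ContinuousOn (Function.uncurry W) (Ioo 0 S ×ˢ univ)) :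
    AEStronglyMeasurable (Function.uncurry W) (slabMeasure S) := by
  rw [← restrict_slab]
  exact hW.aestronglyMeasurable (measurableSet_Ioo.prod MeasurableSet.univ)

/-- The translate in time of a field on the slab, extended by zero. -/
def slabShift {X : Type*} [Zero X] (S : ℝ) (W : ℝ → E3 → X) (ρ : ℝ) (z : ℝ × E3) : X :=
  (Ioo 0 S ×ˢ (univ : Set E3)).indicator (Function.uncurry W) (z + (ρ, 0))

theorem slabShift_of_mem {X : Type*} [Zero X] {S : ℝ} {W : ℝ → E3 → X} {ρ t : ℝ}
    (h : t + ρ ∈ Ioo 0 S) (x : E3) : slabShift S W ρ (t, x) = W (t + ρ) x := by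
  rw [slabShift, indicator_of_mem] <;> simp_all

/-- Extension by zero followed by translation preserves the L² norm on the whole space-time, and
restricting to the slab can only decrease it. The bound is uniform in ρ, as weak convergence
requires. -/
theorem slabShift_memLp {X : Type*} [NormedAddCommGroup X] {S : ℝ} {W : ℝ → E3 → X}
    (hW : MemLp (Function.uncurry W) 2 (slabMeasure S)) (ρ : ℝ) :
    MemLp (slabShift S W ρ) 2 (slabMeasure S) ∧
      ∫ z, ‖slabShift S W ρ z‖ ^ 2 ∂(slabMeasure S) ≤ ∫ z, ‖W z.1 z.2‖ ^ 2 ∂(slabMeasure S) := by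
  have hmeas : MeasurableSet (Ioo 0 S ×ˢ (univ : Set E3)) := measurableSet_Ioo.prod .univ
  rw [← restrict_slab] at hW ⊢
  have h1 : MemLp ((Ioo 0 S ×ˢ (univ : Set E3)).indicator (Function.uncurry W)) 2 volume :=
    (memLp_indicator_iff_restrict hmeas).2 hW
  have : (volume : Measure (ℝ × E3)).IsAddHaarMeasure := by
    rw [Measure.volume_eq_prod]; infer_instance
  have hmp := measurePreserving_add_right (volume : Measure (ℝ × E3)) ((ρ, 0) : ℝ × E3)
  have h2 : MemLp (slabShift S W ρ) 2 (volume : Measure (ℝ × E3)) := h1.comp_measurePreserving hmp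
  refine ⟨h2.restrict _, ?_⟩
  have h3 := (memLp_two_iff_integrable_sq_norm h2.aestronglyMeasurable).1 h2
  calc ∫ z in Ioo 0 S ×ˢ (univ : Set E3), ‖slabShift S W ρ z‖ ^ 2
      ≤ ∫ z, ‖slabShift S W ρ z‖ ^ 2 :=
        setIntegral_le_integral h3 (Eventually.of_forall fun z => by positivity)
    _ = ∫ z, ‖(Ioo 0 S ×ˢ (univ : Set E3)).indicator (Function.uncurry W) z‖ ^ 2 :=
        integral_add_right_eq_self
          (fun z => ‖(Ioo 0 S ×ˢ (univ : Set E3)).indicator (Function.uncurry W) z‖ ^ 2) _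
    _ = ∫ z in Ioo 0 S ×ˢ (univ : Set E3), ‖W z.1 z.2‖ ^ 2 := by
        rw [← integral_indicator hmeas]
        congr 1
        ext z
        by_cases hz : z ∈ Ioo 0 S ×ˢ (univ : Set E3)
        · rw [indicator_of_mem hz, indicator_of_mem hz]; rfl
        · rw [indicator_of_notMem hz, indicator_of_notMem hz]; simp

/-- Only W has to be continuous. Its time translates are bounded in L² and converge pointwise, hence
weakly, and V is the fixed element that they are paired with. The weight vanishes near S, so for
small ρ extending W by zero changes nothing. -/
theorem diagCont_inner {X : Type*} [NormedAddCommGroup X] [InnerProductSpace ℝ X]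
    {S : ℝ} {V W : ℝ → E3 → X}
    (hV : MemLp (Function.uncurry V) 2 (slabMeasure S))
    (hW : MemLp (Function.uncurry W) 2 (slabMeasure S))
    (hc : ContinuousOn (Function.uncurry W) (Ioo 0 S ×ˢ univ)) :
    DiagCont S (fun t s => ∫ x, ⟪V t x, W s x⟫_ℝ) := by
  have iV := (memLp_two_iff_integrable_sq_norm hV.aestronglyMeasurable).1 hV
  have iW := (memLp_two_iff_integrable_sq_norm hW.aestronglyMeasurable).1 hW
  have hθV : ∀ θ, IsWeight S θ →
      MemLp (fun z : ℝ × E3 => θ z.1 • V z.1 z.2) 2 (slabMeasure S) := by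
    intro θ hθ
    obtain ⟨C, hC0, hC⟩ := hθ.bounded
    refine (hV.norm.const_mul C).of_le
      ((hθ.continuous.comp continuous_fst).aestronglyMeasurable.smul hV.aestronglyMeasurable) ?_
    have : ∀ᵐ z ∂(slabMeasure S), z.1 ∈ Ioo 0 S :=
      Measure.quasiMeasurePreserving_fst.ae (ae_restrict_mem measurableSet_Ioo)
    filter_upwards [this] with z hz
    rw [norm_smul, norm_mul, norm_norm, Real.norm_of_nonneg hC0]
    gcongr
    · exact hC _ hz
    · exact le_rfl
  have hshift : ∀ θ, IsWeight S θ → ∀ᶠ ρ in 𝓝[>] (0 : ℝ), ∀ t ∈ Ioo 0 S,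
      θ t * ∫ x, ⟪V t x, W (t + ρ) x⟫_ℝ =
        ∫ x, ⟪θ t • V t x, slabShift S W ρ (t, x)⟫_ℝ := by
    intro θ hθ
    obtain ⟨S', hS', hv⟩ := hθ.vanish
    have : ∀ᶠ ρ in 𝓝[>] (0 : ℝ), ρ < S - S' :=
      nhdsWithin_le_nhds (gt_mem_nhds (by linarith))
    filter_upwards [this, self_mem_nhdsWithin] with ρ hρ hρ0 t ht
    rcases le_or_gt S' t with h | h
    · simp [hv t h]
    · have hmem : t + ρ ∈ Ioo 0 S := ⟨by have := ht.1; have : 0 < ρ := hρ0; linarith, by linarith⟩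
      simp_rw [slabShift_of_mem hmem, real_inner_smul_left, integral_const_mul]
  refine ⟨?_, ?_, ?_, ?_⟩
  · have h1 : Integrable (fun p : (ℝ × ℝ) × E3 => ⟪V p.1.1 p.2, W p.1.2 p.2⟫_ℝ)
        (((timeMeasure S).prod (timeMeasure S)).prod volume) := by
      refine Integrable.mono' ((integrable_lift_fst iV).add (integrable_lift_snd iW))
        ((aestronglyMeasurable_lift_fst hV.aestronglyMeasurable).inner
          (aestronglyMeasurable_lift_snd hW.aestronglyMeasurable)) ?_
      filter_upwards with p
      have := abs_real_inner_le_norm (V p.1.1 p.2) (W p.1.2 p.2)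
      simp only [Pi.add_apply, Real.norm_eq_abs, Function.uncurry]
      nlinarith [sq_nonneg (‖V p.1.1 p.2‖ - ‖W p.1.2 p.2‖), sq_nonneg (‖V p.1.1 p.2‖),
        sq_nonneg ‖W p.1.2 p.2‖]
    exact h1.integral_prod_left
  · exact (integrable_inner_of_memLp hV hW).integral_prod_left
  · intro θ hθ
    filter_upwards [hshift θ hθ] with ρ hρ
    have := (integrable_inner_of_memLp (hθV θ hθ) (slabShift_memLp hW ρ).1).integral_prod_left
    refine this.congr ?_
    filter_upwards [ae_restrict_mem measurableSet_Ioo] with t ht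
    exact (hρ t ht).symm
  · intro θ hθ
    have h1 := tendsto_integral_inner_of_bounded (l := 𝓝[>] (0 : ℝ)) (f := slabShift S W)
      (hθV θ hθ) hW (Eventually.of_forall fun ρ => (slabShift_memLp hW ρ).1)
      (Eventually.of_forall fun ρ => (slabShift_memLp hW ρ).2) ?_
    · rw [integral_prod _ (integrable_inner_of_memLp (hθV θ hθ) hW)] at h1
      simp only [Function.uncurry, real_inner_smul_left, integral_const_mul] at h1
      refine h1.congr' ?_
      filter_upwards [hshift θ hθ] with ρ hρ
      have := integral_prod _ (integrable_inner_of_memLp (hθV θ hθ) (slabShift_memLp hW ρ).1)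
      simp only [real_inner_smul_left] at this
      rw [this]
      refine integral_congr_ae ?_
      filter_upwards [ae_restrict_mem measurableSet_Ioo] with t ht
      rw [hρ t ht]
      simp only [real_inner_smul_left]
    · have : ∀ᵐ z ∂(slabMeasure S), z.1 ∈ Ioo 0 S :=
        Measure.quasiMeasurePreserving_fst.ae (ae_restrict_mem measurableSet_Ioo)
      filter_upwards [this] with z hz
      refine (slab_continuity hc hz z.2).congr' ?_
      have h2 : ∀ᶠ ρ in 𝓝[>] (0 : ℝ), ρ < S - z.1 :=
        nhdsWithin_le_nhds (gt_mem_nhds (by linarith [hz.2]))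
      filter_upwards [h2, self_mem_nhdsWithin] with ρ hρ hρ0
      have : 0 < ρ := hρ0
      exact (slabShift_of_mem ⟨by linarith [hz.1], by linarith⟩ z.2).symm

theorem ae_slab_mem (S : ℝ) : ∀ᵐ z ∂(slabMeasure S), z.1 ∈ Ioo 0 S :=
  Measure.quasiMeasurePreserving_fst.ae (ae_restrict_mem measurableSet_Ioo)

theorem abs_inner_apply_le (a b : E3) (L : E3 →L[ℝ] E3) {C : ℝ} (h : ‖L‖ ≤ C) :
    |⟪a, L b⟫_ℝ| ≤ C * (‖a‖ ^ 2 + ‖b‖ ^ 2) := by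
  have h1 := abs_real_inner_le_norm a (L b)
  have h2 := L.le_opNorm b
  have h3 : ‖L‖ * ‖b‖ ≤ C * ‖b‖ := by gcongr
  have h4 : ‖a‖ * ‖L b‖ ≤ ‖a‖ * (C * ‖b‖) := by gcongr; linarith
  have hC : 0 ≤ C := (norm_nonneg L).trans h
  nlinarith [mul_nonneg hC (sq_nonneg (‖a‖ - ‖b‖)), mul_nonneg hC (sq_nonneg ‖a‖),
    mul_nonneg hC (sq_nonneg ‖b‖)]

theorem aestronglyMeasurable_clm_apply {α X Y : Type*} [MeasurableSpace α] {μ : Measure α}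
    [NormedAddCommGroup X] [NormedSpace ℝ X] [NormedAddCommGroup Y] [NormedSpace ℝ Y]
    {L : α → X →L[ℝ] Y} {v : α → X} (hL : AEStronglyMeasurable L μ)
    (hv : AEStronglyMeasurable v μ) : AEStronglyMeasurable (fun a => L a (v a)) μ :=
  (isBoundedBilinearMap_apply (𝕜 := ℝ) (E := X) (F := Y)).continuous.comp_aestronglyMeasurable
    (hL.prodMk hv)

/-- Here V and V' are evaluated at the same time t, so their product is already in L¹; the shifted
factor is continuous and bounded, and dominated convergence applies. -/
theorem diagCont_inner_apply {S C : ℝ} {V V' : ℝ → E3 → E3} {L : ℝ → E3 → E3 →L[ℝ] E3}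
    (hV : MemLp (Function.uncurry V) 2 (slabMeasure S))
    (hV' : MemLp (Function.uncurry V') 2 (slabMeasure S))
    (hc : ContinuousOn (Function.uncurry L) (Ioo 0 S ×ˢ univ))
    (hC : ∀ t ∈ Ioo 0 S, ∀ x, ‖L t x‖ ≤ C) :
    DiagCont S (fun t s => ∫ x, ⟪V t x, L s x (V' t x)⟫_ℝ) := by
  have iV := (memLp_two_iff_integrable_sq_norm hV.aestronglyMeasurable).1 hV
  have iV' := (memLp_two_iff_integrable_sq_norm hV'.aestronglyMeasurable).1 hV'
  have hL := aestronglyMeasurable_slab hc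
  have hbound : Integrable (fun z : ℝ × E3 => C * (‖V z.1 z.2‖ ^ 2 + ‖V' z.1 z.2‖ ^ 2))
      (slabMeasure S) := (iV.add iV').const_mul C
  have hdiag : Integrable (fun z : ℝ × E3 => ⟪V z.1 z.2, L z.1 z.2 (V' z.1 z.2)⟫_ℝ)
      (slabMeasure S) := by
    refine hbound.mono' (hV.aestronglyMeasurable.inner
      (aestronglyMeasurable_clm_apply hL hV'.aestronglyMeasurable)) ?_
    filter_upwards [ae_slab_mem S] with z hz
    exact abs_inner_apply_le _ _ _ (hC _ hz _)
  have hLs : ∀ ρ : ℝ, AEStronglyMeasurable (slabShift S L ρ) (slabMeasure S) := by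
    intro ρ
    have hmeas : MeasurableSet (Ioo 0 S ×ˢ (univ : Set E3)) := measurableSet_Ioo.prod .univ
    rw [← restrict_slab] at hL ⊢
    have : (volume : Measure (ℝ × E3)).IsAddHaarMeasure := by
      rw [Measure.volume_eq_prod]; infer_instance
    have hmp := measurePreserving_add_right (volume : Measure (ℝ × E3)) ((ρ, 0) : ℝ × E3)
    exact (((aestronglyMeasurable_indicator_iff hmeas).2 hL).comp_measurePreserving hmp).restrict
  have hLC : ∀ ρ : ℝ, 0 ≤ C → ∀ z, ‖slabShift S L ρ z‖ ≤ C := by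
    intro ρ hC0 z
    rw [slabShift]
    by_cases hz : z + (ρ, 0) ∈ Ioo 0 S ×ˢ (univ : Set E3)
    · rw [indicator_of_mem hz]; exact hC _ hz.1 _
    · rw [indicator_of_notMem hz]; simpa using hC0
  have hboundθ : ∀ θ, IsWeight S θ → ∃ K : ℝ, ∀ z : ℝ × E3, z.1 ∈ Ioo 0 S → ∀ ρ : ℝ,
      ‖θ z.1 * ⟪V z.1 z.2, slabShift S L ρ z (V' z.1 z.2)⟫_ℝ‖ ≤
        K * (C * (‖V z.1 z.2‖ ^ 2 + ‖V' z.1 z.2‖ ^ 2)) := by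
    intro θ hθ
    obtain ⟨K, hK0, hK⟩ := hθ.bounded
    refine ⟨K, fun z hz ρ => ?_⟩
    rw [norm_mul]
    have hC0 : 0 ≤ C := (norm_nonneg _).trans (hC z.1 hz z.2)
    gcongr
    · exact hK _ hz
    · exact abs_inner_apply_le _ _ _ (hLC ρ hC0 z)
  have hmeasθ : ∀ θ, IsWeight S θ → ∀ ρ : ℝ, AEStronglyMeasurable
      (fun z : ℝ × E3 => θ z.1 * ⟪V z.1 z.2, slabShift S L ρ z (V' z.1 z.2)⟫_ℝ)
      (slabMeasure S) := fun θ hθ ρ =>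
    (hθ.continuous.comp continuous_fst).aestronglyMeasurable.mul
      (hV.aestronglyMeasurable.inner (aestronglyMeasurable_clm_apply (hLs ρ) hV'.aestronglyMeasurable))
  have hintθ : ∀ θ, IsWeight S θ → ∀ ρ : ℝ, Integrable
      (fun z : ℝ × E3 => θ z.1 * ⟪V z.1 z.2, slabShift S L ρ z (V' z.1 z.2)⟫_ℝ)
      (slabMeasure S) := by
    intro θ hθ ρ
    obtain ⟨K, hK⟩ := hboundθ θ hθ
    refine (hbound.const_mul K).mono' (hmeasθ θ hθ ρ) ?_
    filter_upwards [ae_slab_mem S] with z hz using hK z hz ρ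
  have hshift : ∀ θ, IsWeight S θ → ∀ᶠ ρ in 𝓝[>] (0 : ℝ), ∀ t ∈ Ioo 0 S,
      θ t * ∫ x, ⟪V t x, L (t + ρ) x (V' t x)⟫_ℝ =
        ∫ x, θ t * ⟪V t x, slabShift S L ρ (t, x) (V' t x)⟫_ℝ := by
    intro θ hθ
    obtain ⟨S', hS', hv⟩ := hθ.vanish
    have : ∀ᶠ ρ in 𝓝[>] (0 : ℝ), ρ < S - S' :=
      nhdsWithin_le_nhds (gt_mem_nhds (by linarith))
    filter_upwards [this, self_mem_nhdsWithin] with ρ hρ hρ0 t ht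
    rcases le_or_gt S' t with h | h
    · simp [hv t h]
    · have hmem : t + ρ ∈ Ioo 0 S := ⟨by have := ht.1; have : 0 < ρ := hρ0; linarith, by linarith⟩
      simp_rw [slabShift_of_mem hmem, integral_const_mul]
  refine ⟨?_, hdiag.integral_prod_left, ?_, ?_⟩
  · have h1 : Integrable (fun p : (ℝ × ℝ) × E3 => ⟪V p.1.1 p.2, L p.1.2 p.2 (V' p.1.1 p.2)⟫_ℝ)
        (((timeMeasure S).prod (timeMeasure S)).prod volume) := by
      refine Integrable.mono' (integrable_lift_fst hbound)
        ((aestronglyMeasurable_lift_fst hV.aestronglyMeasurable).inner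
          (aestronglyMeasurable_clm_apply (aestronglyMeasurable_lift_snd hL)
            (aestronglyMeasurable_lift_fst hV'.aestronglyMeasurable))) ?_
      have : ∀ᵐ p ∂(((timeMeasure S).prod (timeMeasure S)).prod (volume : Measure E3)),
          p.1.2 ∈ Ioo 0 S :=
        (Measure.quasiMeasurePreserving_snd.comp Measure.quasiMeasurePreserving_fst).ae
          (ae_restrict_mem measurableSet_Ioo)
      filter_upwards [this] with p hp
      exact abs_inner_apply_le _ _ _ (hC _ hp _)
    exact h1.integral_prod_left
  · intro θ hθ
    filter_upwards [hshift θ hθ] with ρ hρ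
    refine (hintθ θ hθ ρ).integral_prod_left.congr ?_
    filter_upwards [ae_restrict_mem measurableSet_Ioo] with t ht
    exact (hρ t ht).symm
  · intro θ hθ
    obtain ⟨K, hK⟩ := hboundθ θ hθ
    have h1 : Tendsto (fun ρ => ∫ z : ℝ × E3,
        θ z.1 * ⟪V z.1 z.2, slabShift S L ρ z (V' z.1 z.2)⟫_ℝ ∂(slabMeasure S)) (𝓝[>] 0)
        (𝓝 (∫ z : ℝ × E3, θ z.1 * ⟪V z.1 z.2, L z.1 z.2 (V' z.1 z.2)⟫_ℝ ∂(slabMeasure S))) := by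
      refine tendsto_integral_filter_of_dominated_convergence _
        (Eventually.of_forall fun ρ => hmeasθ θ hθ ρ)
        (Eventually.of_forall fun ρ => ?_) (hbound.const_mul K) ?_
      · filter_upwards [ae_slab_mem S] with z hz using hK z hz ρ
      · filter_upwards [ae_slab_mem S] with z hz
        have h3 : Tendsto (fun ρ => slabShift S L ρ z) (𝓝[>] 0) (𝓝 (L z.1 z.2)) := by
          refine (slab_continuity hc hz z.2).congr' ?_
          have h2 : ∀ᶠ ρ in 𝓝[>] (0 : ℝ), ρ < S - z.1 :=
            nhdsWithin_le_nhds (gt_mem_nhds (by linarith [hz.2]))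
          filter_upwards [h2, self_mem_nhdsWithin] with ρ hρ hρ0
          have : 0 < ρ := hρ0
          exact (slabShift_of_mem ⟨by linarith [hz.1], by linarith⟩ z.2).symm
        have h4 : Tendsto (fun ρ => slabShift S L ρ z (V' z.1 z.2)) (𝓝[>] 0)
            (𝓝 (L z.1 z.2 (V' z.1 z.2))) :=
          ((ContinuousLinearMap.apply ℝ E3 (V' z.1 z.2)).continuous.tendsto _).comp h3
        exact (tendsto_const_nhds.inner h4).const_mul _
    have h4 : Integrable (fun z : ℝ × E3 => θ z.1 * ⟪V z.1 z.2, L z.1 z.2 (V' z.1 z.2)⟫_ℝ)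
        (slabMeasure S) := by
      obtain ⟨K, hK0, hK⟩ := hθ.bounded
      refine hdiag.bdd_mul (c := K) (hθ.continuous.comp continuous_fst).aestronglyMeasurable ?_
      filter_upwards [ae_slab_mem S] with z hz using hK _ hz
    rw [integral_prod _ h4] at h1
    simp only [integral_const_mul] at h1
    refine h1.congr' ?_
    filter_upwards [hshift θ hθ] with ρ hρ
    rw [integral_prod _ (hintθ θ hθ ρ)]
    refine integral_congr_ae ?_
    filter_upwards [ae_restrict_mem measurableSet_Ioo] with t ht
    rw [hρ t ht]

/-! ### From separate evolution in two times to evolution along the diagonal -/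

/-- Smooth compactly supported functions of time whose support lies before `S`. -/
structure IsTimeTest (S : ℝ) (θ : ℝ → ℝ) : Prop where
  contDiff : ContDiff ℝ ∞ θ
  compact : HasCompactSupport θ
  support : tsupport θ ⊆ Iio S

theorem IsTimeTest.exists_vanish {S : ℝ} {θ : ℝ → ℝ} (h : IsTimeTest S θ) :
    ∃ S' < S, ∀ t, S' ≤ t → t ∉ tsupport θ := by
  rcases (tsupport θ).eq_empty_or_nonempty with he | hne
  · exact ⟨S - 1, by linarith, fun t _ => by simp [he]⟩
  · obtain ⟨m, hm, hmax⟩ := IsCompact.exists_isMaxOn h.compact hne continuous_id.continuousOn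
    have hmS : m < S := h.support hm
    refine ⟨(m + S) / 2, by linarith, fun t ht htm => ?_⟩
    have : t ≤ m := hmax htm
    linarith

theorem IsTimeTest.isWeight {S : ℝ} {θ : ℝ → ℝ} (h : IsTimeTest S θ) : IsWeight S θ := by
  obtain ⟨S', hS', hv⟩ := h.exists_vanish
  exact ⟨h.contDiff.continuous, S', hS', fun t ht => image_eq_zero_of_notMem_tsupport (hv t ht)⟩

theorem IsTimeTest.isWeight_deriv {S : ℝ} {θ : ℝ → ℝ} (h : IsTimeTest S θ) :
    IsWeight S (deriv θ) := by
  obtain ⟨S', hS', hv⟩ := h.exists_vanish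
  exact ⟨h.contDiff.continuous_deriv (by simp), S', hS', fun t ht =>
    image_eq_zero_of_notMem_tsupport fun h' => hv t ht (tsupport_deriv_subset h')⟩

theorem IsTimeTest.mul_left {S : ℝ} {θ k : ℝ → ℝ} (h : IsTimeTest S θ) (hk : ContDiff ℝ ∞ k) :
    IsTimeTest S (fun t => θ t * k t) :=
  ⟨h.contDiff.mul hk, h.compact.mul_right, (tsupport_mul_subset_left).trans h.support⟩

theorem integrable_kernel_mul {S : ℝ} {f : ℝ → ℝ → ℝ}
    (hf : Integrable (Function.uncurry f) ((timeMeasure S).prod (timeMeasure S)))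
    {ϑ k : ℝ → ℝ} (hϑ : Continuous ϑ) (hk : Continuous k) :
    Integrable (fun p : ℝ × ℝ => ϑ p.1 * k (p.2 - p.1) * f p.1 p.2)
      ((timeMeasure S).prod (timeMeasure S)) := by
  have hc : Continuous (fun p : ℝ × ℝ => ϑ p.1 * k (p.2 - p.1)) := by fun_prop
  obtain ⟨C, hC⟩ := ((isCompact_Icc (a := 0) (b := S)).prod
    (isCompact_Icc (a := 0) (b := S))).exists_bound_of_continuousOn hc.continuousOn
  refine hf.bdd_mul (c := C) hc.aestronglyMeasurable ?_
  rw [timeMeasure, Measure.prod_restrict]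
  filter_upwards [ae_restrict_mem (measurableSet_Ioo.prod measurableSet_Ioo)] with p hp
  exact hC p ⟨Ioo_subset_Icc_self hp.1, Ioo_subset_Icc_self hp.2⟩

/-- The shear s = t + ρ turns the double integral into an average over ρ of integrals along {s = t +
ρ}. The condition S' + h ≤ S guarantees that t + ρ < S wherever the weight ϑ(t) k(ρ) is nonzero, so
the restriction of s to (0,S) is harmless. -/
theorem integral_kernel_eq {S S' h : ℝ} {f : ℝ → ℝ → ℝ}
    (hf : Integrable (Function.uncurry f) ((timeMeasure S).prod (timeMeasure S)))
    {ϑ k : ℝ → ℝ} (hϑ : Continuous ϑ) (hk : Continuous k)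
    (hv : ∀ t, S' ≤ t → ϑ t = 0) (hks : ∀ r, r ∉ Ioo 0 h → k r = 0) (hh : S' + h ≤ S) :
    Integrable (fun ρ => k ρ * ∫ t, ϑ t * f t (t + ρ) ∂(timeMeasure S)) ∧
    ∫ p, ϑ p.1 * k (p.2 - p.1) * f p.1 p.2 ∂((timeMeasure S).prod (timeMeasure S)) =
      ∫ ρ, k ρ * ∫ t, ϑ t * f t (t + ρ) ∂(timeMeasure S) := by
  have hi := integrable_kernel_mul hf hϑ hk
  have hm : MeasurableSet (Ioo 0 S ×ˢ Ioo 0 S) := measurableSet_Ioo.prod measurableSet_Ioo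
  rw [timeMeasure, Measure.prod_restrict, ← integral_indicator hm]
  rw [timeMeasure, Measure.prod_restrict, ← IntegrableOn, ← integrable_indicator_iff hm] at hi
  set F := (Ioo 0 S ×ˢ Ioo 0 S).indicator
    (fun p : ℝ × ℝ => ϑ p.1 * k (p.2 - p.1) * f p.1 p.2) with hF
  have hmp := measurePreserving_prod_add (volume : Measure ℝ) (volume : Measure ℝ)
  have hemb : MeasurableEmbedding (fun z : ℝ × ℝ => (z.1, z.1 + z.2)) :=
    (MeasurableEquiv.shearAddRight ℝ).measurableEmbedding
  have h1 : Integrable (fun z : ℝ × ℝ => F (z.1, z.1 + z.2)) (volume.prod volume) :=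
    hmp.integrable_comp_of_integrable hi
  have h2 : ∫ p, F p ∂((volume : Measure ℝ).prod volume) =
      ∫ z : ℝ × ℝ, F (z.1, z.1 + z.2) ∂((volume : Measure ℝ).prod volume) :=
    (hmp.integral_comp hemb F).symm
  have h3 : ∀ t ρ : ℝ, F (t, t + ρ) =
      (Ioo 0 S).indicator (fun t => k ρ * (ϑ t * f t (t + ρ))) t := by
    intro t ρ
    rw [hF]
    by_cases ht : t ∈ Ioo 0 S
    · rw [indicator_of_mem ht]
      by_cases hp : (t, t + ρ) ∈ Ioo 0 S ×ˢ Ioo 0 S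
      · rw [indicator_of_mem hp]
        simp only [add_sub_cancel_left]
        ring
      · rw [indicator_of_notMem hp]
        by_cases hρ : ρ ∈ Ioo 0 h
        · have : S' ≤ t := by
            by_contra hlt
            exact hp ⟨ht, by simp only [mem_Ioo] at *; constructor <;> linarith⟩
          rw [hv t this]; ring
        · rw [hks ρ hρ]; ring
    · rw [indicator_of_notMem ht, indicator_of_notMem fun hp => ht hp.1]
  have h4 : ∀ ρ : ℝ, ∫ t, F (t, t + ρ) = k ρ * ∫ t in Ioo 0 S, ϑ t * f t (t + ρ) := by
    intro ρ
    simp_rw [h3]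
    rw [integral_indicator measurableSet_Ioo, integral_const_mul]
  constructor
  · have := h1.integral_prod_right
    simpa only [h4] using this
  · rw [h2, integral_prod_symm _ h1]
    simp only [h4]

theorem abs_average_sub_le {h ε J₀ : ℝ} {k J : ℝ → ℝ} (hk0 : ∀ r, 0 ≤ k r)
    (hki : Integrable k) (hk1 : ∫ r, k r = 1)
    (hks : ∀ r, r ∉ Ioo 0 h → k r = 0) (hi : Integrable (fun r => k r * J r))
    (hJ : ∀ r ∈ Ioo 0 h, |J r - J₀| ≤ ε) : |(∫ r, k r * J r) - J₀| ≤ ε := by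
  have h1 : (∫ r, k r * J r) - J₀ = ∫ r, (k r * J r - k r * J₀) := by
    rw [integral_sub hi (hki.mul_const _), integral_mul_const, hk1, one_mul]
  rw [h1]
  calc |∫ r, (k r * J r - k r * J₀)| ≤ ∫ r, |k r * J r - k r * J₀| :=
        abs_integral_le_integral_abs
    _ ≤ ∫ r, k r * ε := by
        refine integral_mono (hi.sub (hki.mul_const _)).abs (hki.mul_const _) fun r => ?_
        simp only
        rw [← mul_sub, abs_mul, abs_of_nonneg (hk0 r)]
        by_cases hr : r ∈ Ioo 0 h
        · exact mul_le_mul_of_nonneg_left (hJ r hr) (hk0 r)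
        · simp [hks r hr]
    _ = ε := by rw [integral_mul_const, hk1, one_mul]

/-- The support lies strictly to the right of 0: in k(s - t) the second time is later than the
first, so it stays away from 0 and only the equation in t sees its initial value. -/
theorem exists_time_kernel {h : ℝ} (hh : 0 < h) : ∃ k : ℝ → ℝ, ContDiff ℝ ∞ k ∧
    HasCompactSupport k ∧ tsupport k ⊆ Ioo 0 h ∧ (∀ r, 0 ≤ k r) ∧ ∫ r, k r = 1 := by
  let φ : ContDiffBump (h / 2) := ⟨h / 8, h / 4, by positivity, by linarith⟩
  refine ⟨φ.normed volume, φ.contDiff_normed, φ.hasCompactSupport_normed, ?_,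
    φ.nonneg_normed, φ.integral_normed⟩
  rw [φ.tsupport_normed_eq, Real.closedBall_eq_Icc]
  change Icc (h / 2 - h / 4) (h / 2 + h / 4) ⊆ Ioo 0 h
  intro x hx
  simp only [mem_Icc, mem_Ioo] at *
  constructor <;> linarith

/-- The equation in t is tested with θ(t) k(s - t) and the equation in s with k(s - t), then
multiplied by θ(t). The derivative of the kernel enters with opposite signs and cancels. -/
theorem weighted_kernel_identity {S S' h : ℝ} {g a b : ℝ → ℝ → ℝ} {g₀ θ k : ℝ → ℝ}
    (hg : Integrable (Function.uncurry g) ((timeMeasure S).prod (timeMeasure S)))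
    (ha : Integrable (Function.uncurry a) ((timeMeasure S).prod (timeMeasure S)))
    (hb : Integrable (Function.uncurry b) ((timeMeasure S).prod (timeMeasure S)))
    (h1 : ∀ᵐ s ∂(timeMeasure S), ∀ θ, IsTimeTest S θ →
      ∫ t, (deriv θ t * g t s + θ t * a t s) ∂(timeMeasure S) + θ 0 * g₀ s = 0)
    (h2 : ∀ᵐ t ∂(timeMeasure S), ∀ ζ : ℝ → ℝ, ContDiff ℝ ∞ ζ → HasCompactSupport ζ →
      tsupport ζ ⊆ Ioo 0 S → ∫ s, (deriv ζ s * g t s + ζ s * b t s) ∂(timeMeasure S) = 0)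
    (hθ : IsTimeTest S θ) (hv : ∀ t, S' ≤ t → θ t = 0) (hh : S' + h ≤ S)
    (hk : ContDiff ℝ ∞ k) (hkc : HasCompactSupport k) (hks : tsupport k ⊆ Ioo 0 h) :
    ∫ p, deriv θ p.1 * k (p.2 - p.1) * g p.1 p.2 ∂((timeMeasure S).prod (timeMeasure S)) +
      ∫ p, θ p.1 * k (p.2 - p.1) * (a p.1 p.2 + b p.1 p.2)
        ∂((timeMeasure S).prod (timeMeasure S)) +
      θ 0 * ∫ s, k s * g₀ s ∂(timeMeasure S) = 0 := by
  have hkd : Continuous (deriv k) := hk.continuous_deriv (by simp)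
  have hθd : Continuous (deriv θ) := hθ.contDiff.continuous_deriv (by simp)
  have i1 := integrable_kernel_mul hg hθd hk.continuous
  have i2 := integrable_kernel_mul ha hθ.contDiff.continuous hk.continuous
  have i3 := integrable_kernel_mul hg hθ.contDiff.continuous hkd
  have i4 := integrable_kernel_mul hb hθ.contDiff.continuous hk.continuous
  have e1 : ∀ᵐ s ∂(timeMeasure S), ∫ t, (deriv θ t * k (s - t) * g t s +
      θ t * k (s - t) * a t s - θ t * deriv k (s - t) * g t s) ∂(timeMeasure S) =
        - (θ 0 * (k s * g₀ s)) := by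
    filter_upwards [h1] with s hs
    have hkst : ContDiff ℝ ∞ (fun t => k (s - t)) := hk.comp (contDiff_const.sub contDiff_id)
    have := hs _ (hθ.mul_left hkst)
    simp only [sub_zero] at this
    rw [eq_neg_iff_add_eq_zero, ← mul_assoc]
    refine Eq.trans ?_ this
    congr 1
    refine integral_congr_ae (Eventually.of_forall fun t => ?_)
    have hd : deriv (fun t => θ t * k (s - t)) t =
        deriv θ t * k (s - t) - θ t * deriv k (s - t) := by
      have hkd' : HasDerivAt (fun t => k (s - t)) (- deriv k (s - t)) t := by
        have := (hk.differentiable (by simp) (s - t)).hasDerivAt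
        have h' := this.comp t ((hasDerivAt_id t).const_sub s)
        rw [mul_neg_one] at h'
        exact h'
      have := ((hθ.contDiff.differentiable (by simp) t).hasDerivAt.mul hkd').deriv
      rw [show (fun t => θ t * k (s - t)) = θ * (fun t => k (s - t)) from rfl, this]
      ring
    simp only [hd]
    ring
  have e2 : ∀ᵐ t ∂(timeMeasure S), ∫ s, θ t * deriv k (s - t) * g t s ∂(timeMeasure S) =
      - ∫ s, θ t * k (s - t) * b t s ∂(timeMeasure S) := by
    filter_upwards [h2, ae_restrict_mem measurableSet_Ioo, i3.prod_right_ae,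
      i4.prod_right_ae] with t ht htS j3 j4
    -- Where θ does not vanish, t < S', so the support of s ↦ k(s - t) lies in (t, t + h) ⊆ (0,S)
    -- and the equation in s may be used.
    rcases le_or_gt S' t with hS't | hlt
    · simp [hv t hS't]
    · have hsup : tsupport (fun s => k (s - t)) ⊆ Ioo 0 S := by
        intro s hs
        have hmem : s - t ∈ tsupport k :=
          tsupport_comp_subset_preimage k (f := fun s => s - t) (by fun_prop) hs
        have := hks hmem
        simp only [mem_Ioo] at *
        constructor <;> linarith
      have hcs : HasCompactSupport (fun s => k (s - t)) :=
        hkc.comp_homeomorph (Homeomorph.subRight t)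
      have hkt : ContDiff ℝ ∞ (fun s => k (s - t)) := hk.comp (contDiff_id.sub contDiff_const)
      have := ht _ hkt hcs hsup
      rw [eq_neg_iff_add_eq_zero, ← integral_add j3 j4, ← mul_zero (θ t), ← this,
        ← integral_const_mul]
      refine integral_congr_ae (Eventually.of_forall fun s => ?_)
      have hd : deriv (fun s => k (s - t)) s = deriv k (s - t) := by
        simpa using deriv_comp_sub_const (f := k) t s
      simp only [hd]
      ring
  have f1 : ∫ p, (deriv θ p.1 * k (p.2 - p.1) * g p.1 p.2 + θ p.1 * k (p.2 - p.1) * a p.1 p.2 -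
      θ p.1 * deriv k (p.2 - p.1) * g p.1 p.2) ∂((timeMeasure S).prod (timeMeasure S)) =
      - (θ 0 * ∫ s, k s * g₀ s ∂(timeMeasure S)) := by
    have := integral_prod_symm _ ((i1.add i2).sub i3)
    simp only [Pi.add_apply, Pi.sub_apply] at this
    rw [this, integral_congr_ae e1, integral_neg, integral_const_mul]
  have f2 : ∫ p, θ p.1 * deriv k (p.2 - p.1) * g p.1 p.2
      ∂((timeMeasure S).prod (timeMeasure S)) =
      - ∫ p, θ p.1 * k (p.2 - p.1) * b p.1 p.2 ∂((timeMeasure S).prod (timeMeasure S)) := by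
    rw [integral_prod _ i3, integral_prod _ i4, ← integral_neg, integral_congr_ae e2]
  have f3 : ∫ p, θ p.1 * k (p.2 - p.1) * (a p.1 p.2 + b p.1 p.2)
        ∂((timeMeasure S).prod (timeMeasure S)) =
      ∫ p, θ p.1 * k (p.2 - p.1) * a p.1 p.2 ∂((timeMeasure S).prod (timeMeasure S)) +
      ∫ p, θ p.1 * k (p.2 - p.1) * b p.1 p.2 ∂((timeMeasure S).prod (timeMeasure S)) := by
    simp only [mul_add]
    exact integral_add i2 i4
  have f4 := integral_sub (i1.add i2) i3
  simp only [Pi.add_apply] at f4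
  rw [f1, integral_add i1 i2, f2] at f4
  rw [f3]
  linarith

/-- If a correlation `g(t,s)` has the partial derivatives `a` in `t` and `b` in `s` in the weak
sense, then its restriction to the diagonal has the weak derivative `a + b`. -/
theorem diagonal_identity {S c : ℝ} (hS : 0 < S) {g a b : ℝ → ℝ → ℝ} {g₀ : ℝ → ℝ}
    (hg : DiagCont S g) (ha : DiagCont S a) (hb : DiagCont S b)
    (hg₀ : Integrable g₀ (timeMeasure S))
    (h1 : ∀ᵐ s ∂(timeMeasure S), ∀ θ, IsTimeTest S θ →
      ∫ t, (deriv θ t * g t s + θ t * a t s) ∂(timeMeasure S) + θ 0 * g₀ s = 0)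
    (h2 : ∀ᵐ t ∂(timeMeasure S), ∀ ζ : ℝ → ℝ, ContDiff ℝ ∞ ζ → HasCompactSupport ζ →
      tsupport ζ ⊆ Ioo 0 S → ∫ s, (deriv ζ s * g t s + ζ s * b t s) ∂(timeMeasure S) = 0)
    (h0 : Tendsto g₀ (𝓝[>] 0) (𝓝 c)) (θ : ℝ → ℝ) (hθ : IsTimeTest S θ) :
    ∫ t, (deriv θ t * g t t + θ t * (a t t + b t t)) ∂(timeMeasure S) + θ 0 * c = 0 := by
  have hab := ha.add hb
  obtain ⟨S', hS', hv⟩ := hθ.exists_vanish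
  have hv0 : ∀ t, S' ≤ t → θ t = 0 := fun t ht => image_eq_zero_of_notMem_tsupport (hv t ht)
  have hv1 : ∀ t, S' ≤ t → deriv θ t = 0 := fun t ht =>
    image_eq_zero_of_notMem_tsupport fun h' => hv t ht (tsupport_deriv_subset h')
  have T1 := hg.tendsto _ hθ.isWeight_deriv
  have T2 := hab.tendsto _ hθ.isWeight
  set J1 := ∫ t, deriv θ t * g t t ∂(timeMeasure S) with hJ1
  set J2 := ∫ t, θ t * (a t t + b t t) ∂(timeMeasure S) with hJ2
  have hsum : ∫ t, (deriv θ t * g t t + θ t * (a t t + b t t)) ∂(timeMeasure S) = J1 + J2 :=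
    integral_add (hθ.isWeight_deriv.integrable_mul hg.diag_integrable)
      (hθ.isWeight.integrable_mul hab.diag_integrable)
  rw [hsum]
  by_contra hne
  set X := J1 + J2 + θ 0 * c with hX
  -- The three approximation errors add up to at most (2 + |θ 0|) ε, strictly less than |X| = (3 +
  -- |θ 0|) ε.
  set ε := |X| / (3 + |θ 0|) with hε
  have hden : 0 < 3 + |θ 0| := by positivity
  have hεpos : 0 < ε := by positivity
  have ev := ((Metric.tendsto_nhds.1 T1 ε hεpos).and (Metric.tendsto_nhds.1 T2 ε hεpos)).and
    (Metric.tendsto_nhds.1 h0 ε hεpos)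
  obtain ⟨δ, hδ, hδs⟩ := (mem_nhdsGT_iff_exists_Ioo_subset).1 ev
  have hδ : 0 < δ := hδ
  -- The width is at most δ for the three limits to be within ε, at most S - S' for the shear, and
  -- at most S so that the kernel lives on (0,S).
  set h := min δ (min (S - S') S) with hh
  have hhpos : 0 < h := lt_min hδ (lt_min (by linarith) hS)
  have hhδ : h ≤ δ := min_le_left _ _
  have hhS' : S' + h ≤ S := by
    have : h ≤ S - S' := (min_le_right _ _).trans (min_le_left _ _)
    linarith
  have hhS : h ≤ S := (min_le_right _ _).trans (min_le_right _ _)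
  obtain ⟨k, hk, hkc, hks, hk0, hk1⟩ := exists_time_kernel hhpos
  have hks0 : ∀ r, r ∉ Ioo 0 h → k r = 0 := fun r hr =>
    image_eq_zero_of_notMem_tsupport fun h' => hr (hks h')
  have hki : Integrable k := hk.continuous.integrable_of_hasCompactSupport hkc
  have main := weighted_kernel_identity hg.integrable ha.integrable hb.integrable h1 h2 hθ hv0
    hhS' hk hkc hks
  obtain ⟨j1, q1⟩ := integral_kernel_eq hg.integrable hθ.isWeight_deriv.continuous hk.continuous
    hv1 hks0 hhS'
  obtain ⟨j2, q2⟩ := integral_kernel_eq hab.integrable hθ.isWeight.continuous hk.continuous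
    hv0 hks0 hhS'
  have hkg : ∀ s, k s * g₀ s = k s * (Ioo 0 S).indicator g₀ s := by
    intro s
    by_cases hs : s ∈ Ioo 0 S
    · rw [indicator_of_mem hs]
    · rw [hks0 s fun hs' => hs ⟨hs'.1, hs'.2.trans_le hhS⟩]; ring
  have j3 : Integrable (fun s => k s * g₀ s) := by
    simp only [hkg]
    obtain ⟨C, hC⟩ := hkc.exists_bound_of_continuous hk.continuous
    exact ((integrable_indicator_iff measurableSet_Ioo).2 hg₀).bdd_mul (c := C)
      hk.continuous.aestronglyMeasurable (Eventually.of_forall hC)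
  have q3 : ∫ s, k s * g₀ s ∂(timeMeasure S) = ∫ s, k s * g₀ s := by
    refine setIntegral_eq_integral_of_forall_compl_eq_zero fun s hs => ?_
    rw [hks0 s fun hs' => hs ⟨hs'.1, hs'.2.trans_le hhS⟩]; ring
  have hin : ∀ r ∈ Ioo 0 h, r ∈ Ioo 0 δ := fun r hr => ⟨hr.1, hr.2.trans_le hhδ⟩
  have b1 := abs_average_sub_le hk0 hki hk1 hks0 j1 (J₀ := J1) (ε := ε)
    fun r hr => (hδs (hin r hr)).1.1.le
  have b2 := abs_average_sub_le hk0 hki hk1 hks0 j2 (J₀ := J2) (ε := ε)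
    fun r hr => (hδs (hin r hr)).1.2.le
  have b3 := abs_average_sub_le hk0 hki hk1 hks0 j3 (J₀ := c) (ε := ε)
    fun r hr => (hδs (hin r hr)).2.le
  rw [q1, q2, q3] at main
  set K1 := ∫ ρ, k ρ * ∫ t, deriv θ t * g t (t + ρ) ∂(timeMeasure S)
  set K2 := ∫ ρ, k ρ * ∫ t, θ t * (a t (t + ρ) + b t (t + ρ)) ∂(timeMeasure S)
  set K3 := ∫ s, k s * g₀ s
  have hXK : X = (J1 - K1) + (J2 - K2) + θ 0 * (c - K3) := by rw [hX]; linarith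
  have hXε : |X| = 3 * ε + |θ 0| * ε := by rw [hε]; field_simp
  have hXle : |X| ≤ ε + ε + |θ 0| * ε := by
    rw [hXK]
    refine (abs_add_le _ _).trans (add_le_add ((abs_add_le _ _).trans (add_le_add ?_ ?_)) ?_)
    · rw [abs_sub_comm]; exact b1
    · rw [abs_sub_comm]; exact b2
    · rw [abs_mul, abs_sub_comm]
      gcongr
  linarith

/-! ### Weak derivatives in time -/

/-- The primitive is taken from S, so that it vanishes near S. It is in general nonzero at 0 and
constant for t ≤ 0, where a cut-off in negative time makes the support compact without altering the
derivative on (0,S). -/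
theorem exists_timeTest_of_deriv {S : ℝ} {ζ : ℝ → ℝ} (hζ : ContDiff ℝ ∞ ζ)
    (hc : HasCompactSupport ζ) (hs : tsupport ζ ⊆ Ioo 0 S) :
    ∃ θ, IsTimeTest S θ ∧ ∀ t ∈ Ioo 0 S, deriv θ t = ζ t := by
  let F : ℝ → ℝ := fun t => ∫ r in S..t, ζ r
  have hFd : ∀ t, HasDerivAt F (ζ t) t := fun t =>
    intervalIntegral.integral_hasDerivAt_right (hζ.continuous.intervalIntegrable _ _)
      (hζ.continuous.stronglyMeasurableAtFilter _ _) hζ.continuous.continuousAt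
  have hFs : ContDiff ℝ ∞ F := by
    rw [contDiff_infty_iff_deriv]
    refine ⟨fun t => (hFd t).differentiableAt, ?_⟩
    rw [show deriv F = ζ from funext fun t => (hFd t).deriv]
    exact hζ
  -- This vanishes for t ≤ -2 and equals 1 for t ≥ -1, in particular near every point of (0,S).
  let χ : ℝ → ℝ := fun t => Real.smoothTransition (t + 2)
  have hχ : ContDiff ℝ ∞ χ := Real.smoothTransition.contDiff.comp (contDiff_id.add contDiff_const)
  obtain ⟨S', hS', hv⟩ := IsTimeTest.exists_vanish ⟨hζ, hc, hs.trans fun t ht => ht.2⟩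
  have hF0 : ∀ t, S' ≤ t → F t = 0 := by
    intro t ht
    apply intervalIntegral.integral_zero_ae
    filter_upwards with r hr
    refine image_eq_zero_of_notMem_tsupport (hv r ?_)
    rcases le_total S t with h | h
    · rw [uIoc_of_le h] at hr; linarith [hr.1]
    · rw [uIoc_of_ge h] at hr; linarith [hr.1]
  have hsupp : Function.support (fun t => χ t * F t) ⊆ Icc (-2) S' := by
    intro t ht
    rw [Function.mem_support] at ht
    constructor
    · by_contra hlt
      exact ht (by simp [χ, Real.smoothTransition.zero_of_nonpos (show t + 2 ≤ 0 by linarith)])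
    · by_contra hlt
      exact ht (by simp [hF0 t (by linarith)])
  have htsupp : tsupport (fun t => χ t * F t) ⊆ Icc (-2) S' :=
    closure_minimal hsupp isClosed_Icc
  refine ⟨fun t => χ t * F t, ⟨hχ.mul hFs,
    HasCompactSupport.of_support_subset_isCompact isCompact_Icc hsupp,
    htsupp.trans fun t ht => ht.2.trans_lt hS'⟩, fun t ht => ?_⟩
  have h1 : (fun t => χ t * F t) =ᶠ[𝓝 t] F := by
    filter_upwards [lt_mem_nhds ht.1] with r hr
    simp [χ, Real.smoothTransition.one_of_one_le (show 1 ≤ r + 2 by linarith)]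
  rw [h1.deriv_eq, (hFd t).deriv]

/-- Integration by parts with N merely integrable: Fubini on the triangle {r ≤ t}, then ∫ᵣˢ θ' =
-θ(r), as θ vanishes at S. -/
theorem integral_deriv_mul_primitive {S : ℝ} {θ N : ℝ → ℝ}
    (hθ : IsTimeTest S θ) (hN : Integrable N (timeMeasure S)) :
    ∫ t, deriv θ t * (∫ r in Ioc 0 t, N r) ∂(timeMeasure S) =
      - ∫ t, θ t * N t ∂(timeMeasure S) := by
  have hθd : Continuous (deriv θ) := hθ.contDiff.continuous_deriv (by simp)
  let F : ℝ × ℝ → ℝ := fun p => (Iic p.1).indicator (fun r => deriv θ p.1 * N r) p.2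
  have hFi : Integrable F ((timeMeasure S).prod (timeMeasure S)) := by
    have h1 : Integrable (fun p : ℝ × ℝ => deriv θ p.1 * N p.2)
        ((timeMeasure S).prod (timeMeasure S)) :=
      Integrable.mul_prod (by
        simpa using hθ.isWeight_deriv.integrable_mul (integrable_const (1 : ℝ))) hN
    have h2 : F = {p : ℝ × ℝ | p.2 ≤ p.1}.indicator (fun p => deriv θ p.1 * N p.2) := by
      ext p
      by_cases hp : p.2 ≤ p.1
      · simp [F, hp]
      · simp [F, hp]
    rw [h2]
    exact h1.indicator (measurableSet_le measurable_snd measurable_fst)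
  have e1 : ∫ t, deriv θ t * (∫ r in Ioc 0 t, N r) ∂(timeMeasure S) =
      ∫ t, ∫ r, F (t, r) ∂(timeMeasure S) ∂(timeMeasure S) := by
    refine integral_congr_ae ?_
    filter_upwards [ae_restrict_mem measurableSet_Ioo] with t ht
    change _ = ∫ r, (Iic t).indicator (fun r => deriv θ t * N r) r ∂(timeMeasure S)
    rw [integral_indicator measurableSet_Iic, timeMeasure, Measure.restrict_restrict
      measurableSet_Iic, integral_const_mul]
    congr 3
    ext r
    simp only [mem_Ioc, mem_inter_iff, mem_Iic, mem_Ioo] at *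
    constructor
    · rintro ⟨h1, h2⟩; exact ⟨h2, h1, by linarith⟩
    · rintro ⟨h1, h2, h3⟩; exact ⟨h2, h1⟩
  have e2 : ∀ r ∈ Ioo 0 S, ∫ t, F (t, r) ∂(timeMeasure S) = - (θ r * N r) := by
    intro r hr
    have h1 : (fun t => F (t, r)) = (Ici r).indicator (fun t => deriv θ t * N r) := by
      ext t
      by_cases ht : r ≤ t
      · simp [F, ht]
      · simp [F, ht]
    rw [h1, integral_indicator measurableSet_Ici, timeMeasure, Measure.restrict_restrict
      measurableSet_Ici, integral_mul_const]
    have h2 : Ici r ∩ Ioo 0 S = Ico r S := by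
      ext t
      simp only [mem_inter_iff, mem_Ici, mem_Ioo, mem_Ico] at *
      constructor
      · rintro ⟨h1, h2, h3⟩; exact ⟨h1, h3⟩
      · rintro ⟨h1, h2⟩; exact ⟨h1, by linarith, h2⟩
    have h3 : ∫ t in Ico r S, deriv θ t = - θ r := by
      rw [integral_Ico_eq_integral_Ioc, ← intervalIntegral.integral_of_le hr.2.le,
        intervalIntegral.integral_deriv_eq_sub
          (fun t _ => hθ.contDiff.differentiable (by simp) t) (hθd.intervalIntegrable _ _)]
      have : θ S = 0 :=
        image_eq_zero_of_notMem_tsupport fun h => lt_irrefl _ (show S < S from hθ.support h)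
      rw [this, zero_sub]
    rw [h2, h3]
    ring
  rw [e1, ← integral_prod _ hFi, integral_prod_symm _ hFi, ← integral_neg]
  refine integral_congr_ae ?_
  filter_upwards [ae_restrict_mem measurableSet_Ioo] with r hr
  exact e2 r hr

/-- A function with weak derivative `N` and initial value `c` is the primitive of `N`. -/
theorem ae_eq_primitive {S c : ℝ} {f N : ℝ → ℝ} (hf : Integrable f (timeMeasure S))
    (hN : Integrable N (timeMeasure S))
    (h : ∀ θ, IsTimeTest S θ →
      ∫ t, (deriv θ t * f t + θ t * N t) ∂(timeMeasure S) + θ 0 * c = 0) :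
    ∀ᵐ t ∂(timeMeasure S), f t = c + ∫ r in Ioc 0 t, N r := by
  rcases le_or_gt S 0 with hS | hS
  · simp [timeMeasure, Ioo_eq_empty (not_lt.2 hS)]
  have hNt : ∀ t ∈ Ioo 0 S, ∫ r in Ioc 0 t, N r = ∫ r in (0 : ℝ)..t, N r := fun t ht =>
    (intervalIntegral.integral_of_le ht.1.le).symm
  have hNi : IntervalIntegrable N volume 0 S := by
    rw [intervalIntegrable_iff_integrableOn_Ioo_of_le hS.le]; exact hN
  have hprim : Integrable (fun t => ∫ r in Ioc 0 t, N r) (timeMeasure S) := by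
    have hc : ContinuousOn (fun t => ∫ r in (0 : ℝ)..t, N r) (Icc 0 S) := by
      have := intervalIntegral.continuousOn_primitive_interval' hNi left_mem_uIcc
      rwa [uIcc_of_le hS.le] at this
    have h1 : IntegrableOn (fun t => ∫ r in (0 : ℝ)..t, N r) (Ioo 0 S) :=
      (hc.integrableOn_Icc).mono_set Ioo_subset_Icc_self
    exact h1.congr_fun (fun t ht => (hNt t ht).symm) measurableSet_Ioo
  -- The difference q annihilates θ' for every test function θ. These derivatives exhaust the smooth
  -- functions with compact support in (0,S), so q = 0 almost everywhere, without a free constant.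
  let q : ℝ → ℝ := fun t => f t - (c + ∫ r in Ioc 0 t, N r)
  have hq : Integrable q (timeMeasure S) := hf.sub ((integrable_const c).add hprim)
  have hq0 : ∀ θ, IsTimeTest S θ → ∫ t, deriv θ t * q t ∂(timeMeasure S) = 0 := by
    intro θ hθ
    have i1 := hθ.isWeight_deriv.integrable_mul hf
    have i2 := hθ.isWeight_deriv.integrable_mul hprim
    have i3 := hθ.isWeight_deriv.integrable_mul (integrable_const c)
    have i4 := hθ.isWeight.integrable_mul hN
    have h1 := h θ hθ
    rw [integral_add i1 i4] at h1
    have h2 := integral_deriv_mul_primitive hθ hN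
    have h3 : ∫ t, deriv θ t * c ∂(timeMeasure S) = - (θ 0 * c) := by
      rw [integral_mul_const, timeMeasure, ← integral_Ioc_eq_integral_Ioo,
        ← intervalIntegral.integral_of_le hS.le, intervalIntegral.integral_deriv_eq_sub
          (fun t _ => hθ.contDiff.differentiable (by simp) t)
          (hθ.isWeight_deriv.continuous.intervalIntegrable _ _)]
      have : θ S = 0 :=
        image_eq_zero_of_notMem_tsupport fun h => lt_irrefl _ (show S < S from hθ.support h)
      rw [this]; ring
    have h4 : ∫ t, deriv θ t * q t ∂(timeMeasure S) =
        ∫ t, deriv θ t * f t ∂(timeMeasure S) - (∫ t, deriv θ t * c ∂(timeMeasure S) +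
          ∫ t, deriv θ t * (∫ r in Ioc 0 t, N r) ∂(timeMeasure S)) := by
      have i5 : Integrable (fun t => deriv θ t * c + deriv θ t * ∫ r in Ioc 0 t, N r)
          (timeMeasure S) := i3.add i2
      rw [← integral_add i3 i2, ← integral_sub i1 i5]
      refine integral_congr_ae (Eventually.of_forall fun t => ?_)
      simp only [q]
      ring
    rw [h4, h2, h3]
    linarith
  have := isOpen_Ioo.ae_eq_zero_of_integral_contDiff_smul_eq_zero (f := q) (μ := volume)
    (U := Ioo 0 S) (IntegrableOn.locallyIntegrableOn hq) ?_
  · rw [ae_restrict_iff' measurableSet_Ioo]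
    filter_upwards [this] with t ht hm
    have := ht hm
    simp only [q] at this
    linarith
  · intro ζ hζ hc hs
    obtain ⟨θ, hθ, hd⟩ := exists_timeTest_of_deriv hζ hc hs
    rw [← hq0 θ hθ, timeMeasure]
    rw [← setIntegral_eq_integral_of_forall_compl_eq_zero (s := Ioo 0 S)]
    · refine setIntegral_congr_fun measurableSet_Ioo fun t ht => ?_
      simp [hd t ht]
    · intro t ht
      simp [image_eq_zero_of_notMem_tsupport fun h => ht (hs h)]

/-! ### Radial means -/

section RadialMean

variable {F : Type*} [NormedAddCommGroup F] [NormedSpace ℝ F]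

/-- The weighted mean of `u` on the segment from `0` to `x`, parametrized quadratically. -/
def radialMean (k : ℕ) (u : E3 → F) (x : E3) : F :=
  ∫ r in (0 : ℝ)..1, r ^ k • u (r ^ 2 • x)

/-- Differentiating u(r²x) in x produces a factor r², which raises the weight exponent by two. -/
theorem hasFDerivAt_radialMean (k : ℕ) {u : E3 → F} (hu : ContDiff ℝ 1 u) (x : E3) :
    HasFDerivAt (radialMean k u) (radialMean (k + 2) (fderiv ℝ u) x) x := by
  have hdu : Continuous (fderiv ℝ u) := hu.continuous_fderiv (by simp)
  have hcu := hu.continuous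
  have hcont : Continuous (fun p : E3 × ℝ => p.2 ^ (k + 2) • fderiv ℝ u (p.2 ^ 2 • p.1)) := by
    fun_prop
  obtain ⟨C, hC⟩ := ((isCompact_closedBall x 1).prod
    (isCompact_Icc (a := (0 : ℝ)) (b := 1))).exists_bound_of_continuousOn hcont.continuousOn
  unfold radialMean
  refine (intervalIntegral.hasFDerivAt_integral_of_dominated_of_fderiv_le (𝕜 := ℝ)
    (F := fun x r => r ^ k • u (r ^ 2 • x))
    (F' := fun x r => r ^ (k + 2) • fderiv ℝ u (r ^ 2 • x)) (bound := fun _ => C)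
    (Metric.ball_mem_nhds x one_pos) ?_ ?_ ?_ ?_ ?_ ?_)
  · exact Eventually.of_forall fun y => (by fun_prop : Continuous _).aestronglyMeasurable
  · exact (by fun_prop : Continuous _).intervalIntegrable _ _
  · have hd : Continuous (fun r : ℝ => r ^ (k + 2) • fderiv ℝ u (r ^ 2 • x)) := by fun_prop
    have : SecondCountableTopologyEither ℝ (E3 →L[ℝ] F) :=
      secondCountableTopologyEither_of_left _ _
    exact hd.aestronglyMeasurable
  · refine Eventually.of_forall fun r hr y hy => hC (y, r) ⟨?_, ?_⟩
    · exact Metric.ball_subset_closedBall hy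
    · rw [uIoc_of_le zero_le_one] at hr
      exact ⟨hr.1.le, hr.2⟩
  · simp
  · refine Eventually.of_forall fun r hr y hy => ?_
    have h1 : HasFDerivAt (fun y : E3 => r ^ 2 • y) (r ^ 2 • ContinuousLinearMap.id ℝ E3) y :=
      (hasFDerivAt_id y).const_smul (r ^ 2)
    have h2 := ((hu.differentiable (by simp) (r ^ 2 • y)).hasFDerivAt.comp y h1).const_smul (r ^ k)
    refine h2.congr_fderiv ?_
    ext v
    simp [smul_smul, pow_add]

theorem fderiv_radialMean (k : ℕ) {u : E3 → F} (hu : ContDiff ℝ 1 u) :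
    fderiv ℝ (radialMean k u) = radialMean (k + 2) (fderiv ℝ u) :=
  funext fun x => (hasFDerivAt_radialMean k hu x).fderiv

theorem continuous_radialMean (k : ℕ) {u : E3 → F} (hu : Continuous u) :
    Continuous (radialMean k u) := by
  unfold radialMean
  apply intervalIntegral.continuous_parametric_intervalIntegral_of_continuous'
  fun_prop

theorem norm_radialMean_le (k : ℕ) {u : E3 → F} {C : ℝ} (hC : ∀ x, ‖u x‖ ≤ C) (x : E3) :
    ‖radialMean k u x‖ ≤ C := by
  have := intervalIntegral.norm_integral_le_of_norm_le_const (a := (0 : ℝ)) (b := 1)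
    (f := fun r => r ^ k • u (r ^ 2 • x)) (C := C) ?_
  · simpa [radialMean] using this
  · intro r hr
    rw [uIoc_of_le zero_le_one] at hr
    rw [norm_smul, norm_pow, Real.norm_of_nonneg hr.1.le]
    calc r ^ k * ‖u (r ^ 2 • x)‖ ≤ 1 * C := by
          gcongr
          · exact pow_le_one₀ hr.1.le hr.2
          · exact hC _
      _ = C := one_mul C

/-- Jensen's inequality on the unit interval, from the nonnegativity of the variance. -/
theorem sq_integral_le_integral_sq {g : ℝ → ℝ} (hg : Continuous g) :
    (∫ r in (0 : ℝ)..1, g r) ^ 2 ≤ ∫ r in (0 : ℝ)..1, g r ^ 2 := by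
  set m := ∫ r in (0 : ℝ)..1, g r with hm
  have h1 : 0 ≤ ∫ r in (0 : ℝ)..1, (g r - m) ^ 2 :=
    intervalIntegral.integral_nonneg zero_le_one fun r _ => sq_nonneg _
  have h2 : ∫ r in (0 : ℝ)..1, (g r - m) ^ 2 =
      (∫ r in (0 : ℝ)..1, g r ^ 2) - 2 * m * (∫ r in (0 : ℝ)..1, g r) + m ^ 2 := by
    rw [← intervalIntegral.integral_const_mul,
      ← intervalIntegral.integral_sub (by apply Continuous.intervalIntegrable; fun_prop)
        (by apply Continuous.intervalIntegrable; fun_prop)]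
    have : m ^ 2 = ∫ _r in (0 : ℝ)..1, m ^ 2 := by simp
    rw [this, ← intervalIntegral.integral_add (by apply Continuous.intervalIntegrable; fun_prop)
        (by apply Continuous.intervalIntegrable; fun_prop)]
    congr 1
    ext r
    ring
  rw [h2, ← hm] at h1
  nlinarith

/-- Scaling by r² in dimension three gives ∫ |rᵏ u(r²x)|² dx = r^(2k-6) ∫ |u|², which is integrable
in r on (0,1] because k ≥ 3. This is the reason for the quadratic parametrization: with s = r² the
potential ∫ s u(sx) ds would lead to ∫ s⁻¹ ds after squaring, whereas here the exponent is a natural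
number and Jensen's inequality is enough. -/
theorem memLp_radialMean {k : ℕ} (hk : 3 ≤ k) {u : E3 → F} (hu : Continuous u)
    (h2 : MemLp u 2 volume) : MemLp (radialMean k u) 2 volume := by
  have iu := (memLp_two_iff_integrable_sq_norm h2.aestronglyMeasurable).1 h2
  rw [memLp_two_iff_integrable_sq_norm (continuous_radialMean k hu).aestronglyMeasurable]
  have hcont : Continuous (fun p : ℝ × E3 => ‖p.1 ^ k • u (p.1 ^ 2 • p.2)‖ ^ 2) := by fun_prop
  have hI : Integrable (fun p : ℝ × E3 => ‖p.1 ^ k • u (p.1 ^ 2 • p.2)‖ ^ 2)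
      ((volume.restrict (Ioc (0 : ℝ) 1)).prod volume) := by
    rw [integrable_prod_iff hcont.aestronglyMeasurable]
    have hval : ∀ r ∈ Ioc (0 : ℝ) 1, ∫ x : E3, ‖‖r ^ k • u (r ^ 2 • x)‖ ^ 2‖ =
        r ^ (2 * k - 6) * ∫ x, ‖u x‖ ^ 2 := by
      intro r hr
      have h1 : ∀ x : E3, ‖‖r ^ k • u (r ^ 2 • x)‖ ^ 2‖ = r ^ (2 * k) * ‖u (r ^ 2 • x)‖ ^ 2 := by
        intro x
        rw [Real.norm_of_nonneg (by positivity), norm_smul, norm_pow,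
          Real.norm_of_nonneg hr.1.le, mul_pow, ← pow_mul, mul_comm k 2]
      simp_rw [h1]
      rw [integral_const_mul, Measure.integral_comp_smul volume (fun x => ‖u x‖ ^ 2)]
      rw [finrank_euclideanSpace, Fintype.card_fin, ← pow_mul, abs_of_pos
        (inv_pos.2 (pow_pos hr.1 _)), smul_eq_mul, ← mul_assoc]
      congr 1
      rw [← div_eq_mul_inv, div_eq_iff (pow_pos hr.1 _).ne', ← pow_add]
      congr 1
      omega
    constructor
    · filter_upwards [ae_restrict_mem measurableSet_Ioc] with r hr
      have : Integrable (fun x : E3 => ‖u (r ^ 2 • x)‖ ^ 2) volume :=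
        iu.comp_smul (pow_pos hr.1 2).ne'
      refine (this.const_mul (r ^ (2 * k))).congr (Eventually.of_forall fun x => ?_)
      simp only
      rw [norm_smul, norm_pow, Real.norm_of_nonneg hr.1.le, mul_pow, ← pow_mul, mul_comm k 2]
    · have : IntegrableOn (fun r : ℝ => r ^ (2 * k - 6) * ∫ x, ‖u x‖ ^ 2) (Ioc 0 1) :=
        ((by fun_prop : Continuous (fun r : ℝ => r ^ (2 * k - 6) * ∫ x, ‖u x‖ ^ 2)).integrableOn_Icc
          (a := 0) (b := 1)).mono_set Ioc_subset_Icc_self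
      exact this.congr_fun (fun r hr => (hval r hr).symm) measurableSet_Ioc
  refine hI.integral_prod_right.mono'
    ((continuous_radialMean k hu).norm.pow 2).aestronglyMeasurable ?_
  filter_upwards with x
  rw [Real.norm_of_nonneg (by positivity)]
  have h3 : ‖radialMean k u x‖ ≤ ∫ r in (0 : ℝ)..1, ‖r ^ k • u (r ^ 2 • x)‖ :=
    intervalIntegral.norm_integral_le_integral_norm zero_le_one
  calc ‖radialMean k u x‖ ^ 2 ≤ (∫ r in (0 : ℝ)..1, ‖r ^ k • u (r ^ 2 • x)‖) ^ 2 := by gcongr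
    _ ≤ ∫ r in (0 : ℝ)..1, ‖r ^ k • u (r ^ 2 • x)‖ ^ 2 :=
        sq_integral_le_integral_sq (by fun_prop)
    _ = _ := by rw [intervalIntegral.integral_of_le zero_le_one]

end RadialMean

/-- The induction generalizes the target space, since the derivative is the radial mean of a field
of linear maps. -/
theorem contDiff_radialMean_nat (n : ℕ) {F : Type} [NormedAddCommGroup F] [NormedSpace ℝ F]
    (k : ℕ) {u : E3 → F} (hu : ContDiff ℝ n u) : ContDiff ℝ n (radialMean k u) := by
  induction n generalizing k F with
  | zero =>
    rw [Nat.cast_zero, contDiff_zero] at *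
    exact continuous_radialMean k hu
  | succ n ih =>
    have h1 : ContDiff ℝ 1 u := hu.of_le (by simp)
    push_cast at *
    rw [contDiff_succ_iff_fderiv]
    refine ⟨fun x => (hasFDerivAt_radialMean k h1 x).differentiableAt, by simp, ?_⟩
    rw [fderiv_radialMean k h1]
    exact ih (k + 2) (hu.fderiv_right le_rfl)

theorem contDiff_radialMean {F : Type} [NormedAddCommGroup F] [NormedSpace ℝ F]
    (k : ℕ) {u : E3 → F} (hu : ContDiff ℝ ∞ u) : ContDiff ℝ ∞ (radialMean k u) :=
  contDiff_infty.2 fun n => contDiff_radialMean_nat n k (hu.of_le (mod_cast le_top))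

/-- Each derivative falls on u and only increases the power of r ≤ 1, so uniform bounds are
inherited with the same constant. -/
theorem norm_iteratedFDeriv_radialMean_le (n : ℕ) {F : Type} [NormedAddCommGroup F]
    [NormedSpace ℝ F] (k : ℕ) {u : E3 → F} (hu : ContDiff ℝ ∞ u) {C : ℝ}
    (hC : ∀ x, ‖iteratedFDeriv ℝ n u x‖ ≤ C) (x : E3) :
    ‖iteratedFDeriv ℝ n (radialMean k u) x‖ ≤ C := by
  induction n generalizing k F with
  | zero =>
    simp only [norm_iteratedFDeriv_zero] at *
    exact norm_radialMean_le k hC x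
  | succ n ih =>
    rw [← norm_iteratedFDeriv_fderiv, fderiv_radialMean k (hu.of_le (by simp))]
    refine ih (k + 2) (hu.fderiv_right (by simp)) fun y => ?_
    rw [norm_iteratedFDeriv_fderiv]
    exact hC y

/-! ### The divergence and the curl as continuous linear maps -/

/-- The trace of a Jacobian matrix. -/
def divL : (E3 →L[ℝ] E3) →L[ℝ] ℝ :=
  ∑ j, (EuclideanSpace.proj j : E3 →L[ℝ] ℝ) ∘L (ContinuousLinearMap.apply ℝ E3 (e j))

theorem divL_apply (L : E3 →L[ℝ] E3) : divL L = ∑ j, (L (e j)) j := by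
  simp [divL]

theorem divergence_eq (v : E3 → E3) (x : E3) : divergence v x = divL (fderiv ℝ v x) := by
  rw [divL_apply]; rfl

/-- The curl of a Jacobian matrix, as a continuous linear map. -/
def curlL : (E3 →L[ℝ] E3) →L[ℝ] E3 :=
  LinearMap.toContinuousLinearMap
    { toFun := curlOf
      map_add' := fun L M => by
        ext i; fin_cases i <;> simp [curlOf] <;> ring
      map_smul' := fun c L => by
        ext i; fin_cases i <;> simp [curlOf] <;> ring }

@[simp]
theorem curlL_apply (L : E3 →L[ℝ] E3) : curlL L = curlOf L := rfl

theorem norm_curlOf_le (L : E3 →L[ℝ] E3) : ‖curlOf L‖ ≤ ‖curlL‖ * ‖L‖ := by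
  rw [← curlL_apply]; exact curlL.le_opNorm L

/-! ### Solenoidal truncation -/

/-- A smooth profile equal to `1` for `r ≤ 1` and to `0` for `r ≥ 2`. -/
def profile (r : ℝ) : ℝ := Real.smoothTransition (2 - r)

theorem contDiff_profile : ContDiff ℝ ∞ profile :=
  Real.smoothTransition.contDiff.comp (contDiff_const.sub contDiff_id)

theorem contDiff_deriv_profile : ContDiff ℝ ∞ (deriv profile) :=
  (contDiff_infty_iff_deriv.1 contDiff_profile).2

theorem profile_of_lt_one {r : ℝ} (h : r < 1) : profile r = 1 :=
  Real.smoothTransition.one_of_one_le (by linarith)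

theorem profile_of_two_lt {r : ℝ} (h : 2 < r) : profile r = 0 :=
  Real.smoothTransition.zero_of_nonpos (by linarith)

theorem deriv_profile_of_lt_one {r : ℝ} (h : r < 1) : deriv profile r = 0 := by
  have : profile =ᶠ[𝓝 r] fun _ => 1 := by
    filter_upwards [gt_mem_nhds h] with s hs using profile_of_lt_one hs
  rw [this.deriv_eq, deriv_const]

theorem deriv_profile_of_two_lt {r : ℝ} (h : 2 < r) : deriv profile r = 0 := by
  have : profile =ᶠ[𝓝 r] fun _ => 0 := by
    filter_upwards [lt_mem_nhds h] with s hs using profile_of_two_lt hs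
  rw [this.deriv_eq, deriv_const]

/-- The radial cut-off, acting by multiplication. -/
def cutoffMain (y : E3) : E3 →L[ℝ] E3 := profile (‖y‖ ^ 2) • ContinuousLinearMap.id ℝ E3

/-- The corrector which makes the cut-off preserve solenoidal fields. -/
def cutoffCorr (y : E3) : E3 →L[ℝ] E3 :=
  (2 * deriv profile (‖y‖ ^ 2)) •
    (‖y‖ ^ 2 • ContinuousLinearMap.id ℝ E3 - (innerSL ℝ y).smulRight y)

theorem contDiff_cutoffMain : ContDiff ℝ ∞ cutoffMain :=
  (contDiff_profile.comp (contDiff_norm_sq ℝ)).smul contDiff_const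

theorem contDiff_cutoffCorr : ContDiff ℝ ∞ cutoffCorr := by
  refine ContDiff.smul (contDiff_const.mul (contDiff_deriv_profile.comp (contDiff_norm_sq ℝ))) ?_
  refine ((contDiff_norm_sq ℝ).smul contDiff_const).sub ?_
  exact ContDiff.smulRight (innerSL ℝ).contDiff contDiff_id

theorem hasCompactSupport_of_norm_sq {K : E3 → E3 →L[ℝ] E3} (h : ∀ y, 2 < ‖y‖ ^ 2 → K y = 0) :
    HasCompactSupport K := by
  refine HasCompactSupport.of_support_subset_isCompact (isCompact_closedBall (0 : E3) 2) ?_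
  intro y hy
  by_contra hn
  refine hy (h y ?_)
  rw [mem_closedBall_zero_iff, not_le] at hn
  nlinarith

theorem hasCompactSupport_cutoffMain : HasCompactSupport cutoffMain :=
  hasCompactSupport_of_norm_sq fun y hy => by
    exact ContinuousLinearMap.ext fun v => by simp [cutoffMain, profile_of_two_lt hy]

theorem hasCompactSupport_cutoffCorr : HasCompactSupport cutoffCorr :=
  hasCompactSupport_of_norm_sq fun y hy => by
    exact ContinuousLinearMap.ext fun v => by simp [cutoffCorr, deriv_profile_of_two_lt hy]

/-- By the chain rule i derivatives of K(εx) cost |ε|ⁱ ≤ 1, so Leibniz' rule gives a constant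
independent of the scale. -/
theorem exists_bound_scaled_apply {K : E3 → E3 →L[ℝ] E3} (hK : ContDiff ℝ ∞ K)
    (hc : HasCompactSupport K) (k : ℕ) : ∃ C : ℝ, 0 ≤ C ∧ ∀ ε : ℝ, |ε| ≤ 1 → ∀ v : E3 → E3,
      ContDiff ℝ ∞ v → ∀ x, ‖iteratedFDeriv ℝ k (fun x => K (ε • x) (v x)) x‖ ≤
        C * ∑ i ∈ Finset.range (k + 1), ‖iteratedFDeriv ℝ i v x‖ := by
  have hb : ∀ i : ℕ, ∃ C, ∀ y, ‖iteratedFDeriv ℝ i K y‖ ≤ C := fun i =>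
    (hc.iteratedFDeriv i).exists_bound_of_continuous (hK.continuous_iteratedFDeriv (mod_cast le_top))
  choose C hC using hb
  have hC0 : ∀ i, 0 ≤ C i := fun i => (norm_nonneg _).trans (hC i 0)
  refine ⟨∑ i ∈ Finset.range (k + 1), (k.choose i : ℝ) * C i,
    Finset.sum_nonneg fun i _ => mul_nonneg (by positivity) (hC0 i), ?_⟩
  intro ε hε v hv x
  let g : E3 →L[ℝ] E3 := ε • ContinuousLinearMap.id ℝ E3
  have hg : ‖g‖ ≤ 1 := by
    calc ‖g‖ ≤ ‖ε‖ * ‖ContinuousLinearMap.id ℝ E3‖ :=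
          norm_smul_le ε (ContinuousLinearMap.id ℝ E3)
      _ ≤ 1 * 1 := by
          gcongr
          · exact hε
          · exact ContinuousLinearMap.norm_id_le
      _ = 1 := one_mul 1
  have hKs : ContDiff ℝ ∞ (fun x => K (ε • x)) := hK.comp (contDiff_const_smul ε)
  have hKd : ∀ i : ℕ, ‖iteratedFDeriv ℝ i (fun x => K (ε • x)) x‖ ≤ C i := by
    intro i
    have h1 := g.iteratedFDeriv_comp_right (f := K) hK x (i := i) (mod_cast le_top)
    have h2 : (K ∘ g) = fun x => K (ε • x) := by ext x; simp [g]
    rw [h2] at h1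
    rw [h1]
    refine (ContinuousMultilinearMap.norm_compContinuousLinearMap_le _ _).trans ?_
    calc ‖iteratedFDeriv ℝ i K (g x)‖ * ∏ _j : Fin i, ‖g‖ ≤ C i * 1 := by
          gcongr
          · exact hC0 i
          · exact hC i _
          · exact Finset.prod_le_one (fun _ _ => norm_nonneg _) fun _ _ => hg
      _ = C i := mul_one _
  have h3 := ContinuousLinearMap.norm_iteratedFDeriv_le_of_bilinear
    (ContinuousLinearMap.id ℝ (E3 →L[ℝ] E3)) hKs hv x (n := k) (mod_cast le_top)
  simp only [ContinuousLinearMap.coe_id', id_eq] at h3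
  refine h3.trans ?_
  calc ‖ContinuousLinearMap.id ℝ (E3 →L[ℝ] E3)‖ * ∑ i ∈ Finset.range (k + 1),
        (k.choose i : ℝ) * ‖iteratedFDeriv ℝ i (fun x => K (ε • x)) x‖ *
          ‖iteratedFDeriv ℝ (k - i) v x‖
      ≤ 1 * ∑ i ∈ Finset.range (k + 1), (k.choose i : ℝ) * C i *
          ∑ j ∈ Finset.range (k + 1), ‖iteratedFDeriv ℝ j v x‖ := by
        gcongr with i hi
        · exact ContinuousLinearMap.norm_id_le
        · exact mul_nonneg (by positivity) (hC0 i)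
        · exact hKd i
        · exact Finset.single_le_sum (f := fun j => ‖iteratedFDeriv ℝ j v x‖)
            (fun _ _ => norm_nonneg _) (Finset.mem_range.2 (by omega))
    _ = _ := by rw [one_mul, Finset.sum_mul]

/-- The potential used in the solenoidal truncation. -/
def radialPotential (u : E3 → E3) (x : E3) : E3 := (2 : ℝ) • radialMean 3 u x

theorem contDiff_radialPotential {u : E3 → E3} (hu : ContDiff ℝ ∞ u) :
    ContDiff ℝ ∞ (radialPotential u) :=
  (contDiff_radialMean 3 hu).const_smul (2 : ℝ)

theorem hasFDerivAt_radialPotential {u : E3 → E3} (hu : ContDiff ℝ ∞ u) (x : E3) :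
    HasFDerivAt (radialPotential u) ((2 : ℝ) • radialMean 5 (fderiv ℝ u) x) x :=
  (hasFDerivAt_radialMean 3 (hu.of_le (by simp)) x).const_smul (2 : ℝ)

/-- The divergence passes under the integral, where it becomes r⁵ times the divergence of u at r²x.
-/
theorem divergence_radialPotential {u : E3 → E3} (hu : ContDiff ℝ ∞ u)
    (hdiv : ∀ x, divergence u x = 0) (x : E3) : divergence (radialPotential u) x = 0 := by
  have hdu : Continuous (fderiv ℝ u) := hu.continuous_fderiv (by simp)
  rw [divergence_eq, (hasFDerivAt_radialPotential hu x).fderiv, map_smul, radialMean,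
    ← ContinuousLinearMap.intervalIntegral_comp_comm _
      (by apply Continuous.intervalIntegrable; fun_prop)]
  have : ∀ r : ℝ, divL (r ^ 5 • fderiv ℝ u (r ^ 2 • x)) = 0 := by
    intro r
    rw [map_smul, ← divergence_eq, hdiv, smul_zero]
  simp [this]

/-- The field `u` is recovered from its potential by Euler's homogeneity operator. -/
theorem radialPotential_euler {u : E3 → E3} (hu : ContDiff ℝ ∞ u) (x : E3) :
    (2 : ℝ) • radialPotential u x + fderiv ℝ (radialPotential u) x x = u x := by
  have hdu : Continuous (fderiv ℝ u) := hu.continuous_fderiv (by simp)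
  have hcu := hu.continuous
  -- Integrating this derivative over [0,1] gives u(x) = 4∫ r³ u(r²x) dr + 2∫ r⁵ Du(r²x)x dr; the
  -- two terms are 2a and Da·x for the potential a.
  have hd : ∀ r : ℝ, HasDerivAt (fun r : ℝ => r ^ 4 • u (r ^ 2 • x))
      ((4 : ℝ) • (r ^ 3 • u (r ^ 2 • x)) + (2 : ℝ) • (r ^ 5 • fderiv ℝ u (r ^ 2 • x)) x) r := by
    intro r
    have h1 : HasDerivAt (fun r : ℝ => r ^ 2 • x) ((2 * r) • x) r := by
      simpa using (hasDerivAt_pow 2 r).smul_const x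
    have h2 := (hu.differentiable (by simp) (r ^ 2 • x)).hasFDerivAt.comp_hasDerivAt r h1
    have h3 := (hasDerivAt_pow 4 r).smul h2
    refine h3.congr_deriv ?_
    rw [add_comm, map_smul, smul_smul, smul_smul, smul_apply, smul_smul]
    congr 2
    ring
  have h1 := intervalIntegral.integral_eq_sub_of_hasDerivAt (a := (0 : ℝ)) (b := 1)
    (fun r _ => hd r) (by apply Continuous.intervalIntegrable; fun_prop)
  rw [intervalIntegral.integral_add (by apply Continuous.intervalIntegrable; fun_prop)
    (by apply Continuous.intervalIntegrable; fun_prop), intervalIntegral.integral_smul,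
    intervalIntegral.integral_smul] at h1
  have h2 := ContinuousLinearMap.intervalIntegral_comp_comm (μ := volume) (a := 0) (b := 1)
    (ContinuousLinearMap.apply ℝ E3 x) (f := fun r : ℝ => r ^ 5 • fderiv ℝ u (r ^ 2 • x))
    (by apply Continuous.intervalIntegrable; fun_prop)
  simp only [ContinuousLinearMap.apply_apply] at h2
  rw [h2] at h1
  rw [(hasFDerivAt_radialPotential hu x).fderiv, radialPotential]
  simp only [one_pow, one_smul] at h1
  rw [← sub_zero (u x)]
  convert h1 using 2
  · rw [radialMean, smul_smul]; norm_num
  · rfl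
  · rw [zero_pow (by norm_num), zero_smul]

theorem inner_eq_coord (a b : E3) : ⟪a, b⟫_ℝ = a 0 * b 0 + a 1 * b 1 + a 2 * b 2 := by
  simp only [PiLp.inner_apply, Fin.sum_univ_three, RCLike.inner_apply, conj_trivial]
  ring

theorem norm_sq_eq_coord (a : E3) : ‖a‖ ^ 2 = a 0 * a 0 + a 1 * a 1 + a 2 * a 2 := by
  rw [← real_inner_self_eq_norm_sq, inner_eq_coord]

theorem e_apply (i j : Fin 3) : (e j : E3) i = if i = j then 1 else 0 := by simp [e]

theorem eq_sum_e (x : E3) : x = ∑ j, x j • e j := by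
  ext i; fin_cases i <;> simp [e, Fin.sum_univ_three]

theorem map_eq_sum_e {F : Type*} [NormedAddCommGroup F] [NormedSpace ℝ F] (A : E3 →L[ℝ] F)
    (x : E3) : A x = x 0 • A (e 0) + x 1 • A (e 1) + x 2 • A (e 2) := by
  conv_lhs => rw [eq_sum_e x]
  rw [map_sum, Fin.sum_univ_three]
  simp

/-- The solenoidal truncation of `u` at scale `ε⁻¹`. -/
def truncation (u : E3 → E3) (ε : ℝ) (x : E3) : E3 :=
  cutoffMain (ε • x) (u x) + cutoffCorr (ε • x) (radialPotential u x)

/-- With a the potential, div a = 0 and Euler's relation 2a + (x·∇)a = u say that curl (a ∧ x) = u.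
The truncation is the curl of P a ∧ x, with P the profile evaluated at ε²|x|²: it equals P u + ∇P ∧
(a ∧ x), and ∇P is 2ε²P' x. The proof checks the divergence directly. -/
theorem divergence_truncation {u : E3 → E3} (hu : ContDiff ℝ ∞ u)
    (hdiv : ∀ x, divergence u x = 0) (ε : ℝ) (x : E3) :
    divergence (truncation u ε) x = 0 := by
  set a := radialPotential u with ha
  have hda : HasFDerivAt a (fderiv ℝ a x) x :=
    ((contDiff_radialPotential hu).differentiable (by simp) x).hasFDerivAt
  have hdu : HasFDerivAt u (fderiv ℝ u x) x := (hu.differentiable (by simp) x).hasFDerivAt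
  have hn : HasFDerivAt (fun y : E3 => ‖y‖ ^ 2) (2 • innerSL ℝ x) x :=
    (hasStrictFDerivAt_norm_sq x).hasFDerivAt
  have hεn : HasFDerivAt (fun y : E3 => ε ^ 2 * ‖y‖ ^ 2) (ε ^ 2 • (2 • innerSL ℝ x)) x :=
    hn.const_mul (ε ^ 2)
  set m := ε ^ 2 * ‖x‖ ^ 2 with hm
  have hP : HasFDerivAt (fun y : E3 => profile (ε ^ 2 * ‖y‖ ^ 2))
      (deriv profile m • (ε ^ 2 • (2 • innerSL ℝ x))) x :=
    HasDerivAt.comp_hasFDerivAt (h₂ := profile) x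
      (contDiff_profile.differentiable (by simp) m).hasDerivAt hεn
  have hP' : HasFDerivAt (fun y : E3 => deriv profile (ε ^ 2 * ‖y‖ ^ 2))
      (deriv (deriv profile) m • (ε ^ 2 • (2 • innerSL ℝ x))) x :=
    HasDerivAt.comp_hasFDerivAt (h₂ := deriv profile) x
      (contDiff_deriv_profile.differentiable (by simp) m).hasDerivAt hεn
  have hin : HasFDerivAt (fun y : E3 => ⟪y, a y⟫_ℝ) _ x := (hasFDerivAt_id x).inner ℝ hda
  have h1 := hP.smul hdu
  have h2 := ((hP'.const_mul (2 * ε ^ 2)).smul ((hn.smul hda).sub (hin.smul (hasFDerivAt_id x))))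
  have heq : truncation u ε = fun y => profile (ε ^ 2 * ‖y‖ ^ 2) • u y +
      (2 * ε ^ 2 * deriv profile (ε ^ 2 * ‖y‖ ^ 2)) • (‖y‖ ^ 2 • a y - ⟪y, a y⟫_ℝ • y) := by
    ext1 y
    have hy : ‖ε • y‖ ^ 2 = ε ^ 2 * ‖y‖ ^ 2 := by
      rw [norm_smul, mul_pow, Real.norm_eq_abs, sq_abs]
    simp only [truncation, cutoffMain, cutoffCorr, hy, smul_apply,
      sub_apply, ContinuousLinearMap.id_apply,
      ContinuousLinearMap.smulRight_apply, innerSL_apply_apply, inner_smul_left, smul_sub,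
      smul_smul]
    simp only [conj_trivial]
    congr 2 <;> congr 1 <;> ring
  have hdiva := divergence_radialPotential hu hdiv x
  have hdivu := hdiv x
  have heul := radialPotential_euler hu x
  rw [← ha] at hdiva heul
  have h3 : HasFDerivAt (fun y => profile (ε ^ 2 * ‖y‖ ^ 2) • u y +
      (2 * ε ^ 2 * deriv profile (ε ^ 2 * ‖y‖ ^ 2)) • (‖y‖ ^ 2 • a y - ⟪y, a y⟫_ℝ • y)) _ x :=
    h1.add h2
  rw [heq, divergence, h3.fderiv]
  rw [divergence] at hdiva hdivu
  set A := fderiv ℝ a x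
  set U := fderiv ℝ u x
  rw [map_eq_sum_e A x] at heul
  have hu0 := congrArg (fun v : E3 => v 0) heul
  have hu1 := congrArg (fun v : E3 => v 1) heul
  have hu2 := congrArg (fun v : E3 => v 2) heul
  simp only [PiLp.add_apply, PiLp.smul_apply, smul_eq_mul] at hu0 hu1 hu2
  rw [Fin.sum_univ_three] at hdiva hdivu
  rw [norm_sq_eq_coord] at hm
  simp only [Fin.sum_univ_three, add_apply, smul_apply, sub_apply,
    ContinuousLinearMap.smulRight_apply, PiLp.add_apply,
    PiLp.smul_apply, PiLp.sub_apply, smul_eq_mul, innerSL_apply_apply,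
    ContinuousLinearMap.comp_apply, ContinuousLinearMap.prod_apply, fderivInnerCLM_apply,
    ContinuousLinearMap.id_apply, e_apply, id, ← hm, Pi.sub_apply,
    Pi.smul_apply', inner_eq_coord, norm_sq_eq_coord, nsmul_eq_mul, if_true,
    Fin.reduceEq, if_false, Nat.cast_ofNat]
  -- The P'' terms cancel because |x|²a - ⟨x,a⟩x is orthogonal to x. The P' terms are 2ε²P' times
  -- x·u + |x|² div a - 2x·a - x·(Da x), which vanishes by Euler's relation.
  linear_combination (profile m) * hdivu + 2 * ε ^ 2 * deriv profile m *
    (x 0 * x 0 + x 1 * x 1 + x 2 * x 2) * hdiva - 2 * ε ^ 2 * deriv profile m *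
    (x 0 * hu0 + x 1 * hu1 + x 2 * hu2)

theorem contDiff_truncation {u : E3 → E3} (hu : ContDiff ℝ ∞ u) (ε : ℝ) :
    ContDiff ℝ ∞ (truncation u ε) := by
  have h1 : ContDiff ℝ ∞ (fun x : E3 => ε • x) := contDiff_const_smul ε
  exact ((contDiff_cutoffMain.comp h1).clm_apply hu).add
    ((contDiff_cutoffCorr.comp h1).clm_apply (contDiff_radialPotential hu))

theorem hasCompactSupport_truncation (u : E3 → E3) {ε : ℝ} (hε : ε ≠ 0) :
    HasCompactSupport (truncation u ε) := by
  have h1 : HasCompactSupport (fun x : E3 => cutoffMain (ε • x)) :=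
    hasCompactSupport_cutoffMain.comp_homeomorph (Homeomorph.smulOfNeZero ε hε)
  have h2 : HasCompactSupport (fun x : E3 => cutoffCorr (ε • x)) :=
    hasCompactSupport_cutoffCorr.comp_homeomorph (Homeomorph.smulOfNeZero ε hε)
  refine (h1.union h2).of_isClosed_subset (isClosed_tsupport _) (closure_minimal ?_ ?_)
  · intro x hx
    by_contra hn
    rw [mem_union, not_or] at hn
    apply hx
    rw [truncation, image_eq_zero_of_notMem_tsupport hn.1, image_eq_zero_of_notMem_tsupport hn.2]
    simp
  · exact (isClosed_tsupport _).union (isClosed_tsupport _)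

theorem truncation_eq_of_norm_lt (u : E3 → E3) {ε : ℝ} {x : E3} (h : ‖ε • x‖ < 1) :
    truncation u ε x = u x := by
  have : ‖ε • x‖ ^ 2 < 1 := by nlinarith [norm_nonneg (ε • x)]
  simp [truncation, cutoffMain, cutoffCorr, profile_of_lt_one this, deriv_profile_of_lt_one this]

/-- The corrector ε²(|x|² a - ⟨x,a⟩x) is a compactly supported function of εx applied to a, so the
growth of x costs nothing and the constant does not depend on ε. -/
theorem exists_bound_truncation {u : E3 → E3} (hu : ContDiff ℝ ∞ u) (k : ℕ) :
    ∃ C : ℝ, 0 ≤ C ∧ ∀ ε : ℝ, |ε| ≤ 1 → ∀ x, ‖iteratedFDeriv ℝ k (truncation u ε) x‖ ≤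
      C * ∑ i ∈ Finset.range (k + 1),
        (‖iteratedFDeriv ℝ i u x‖ + ‖iteratedFDeriv ℝ i (radialPotential u) x‖) := by
  obtain ⟨C₁, h₁, b₁⟩ := exists_bound_scaled_apply contDiff_cutoffMain hasCompactSupport_cutoffMain k
  obtain ⟨C₂, h₂, b₂⟩ := exists_bound_scaled_apply contDiff_cutoffCorr hasCompactSupport_cutoffCorr k
  refine ⟨C₁ + C₂, by positivity, fun ε hε x => ?_⟩
  have hs : ContDiff ℝ ∞ (fun x : E3 => ε • x) := contDiff_const_smul ε
  have c1 : ContDiff ℝ ∞ (fun x => cutoffMain (ε • x) (u x)) :=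
    (contDiff_cutoffMain.comp hs).clm_apply hu
  have c2 : ContDiff ℝ ∞ (fun x => cutoffCorr (ε • x) (radialPotential u x)) :=
    (contDiff_cutoffCorr.comp hs).clm_apply (contDiff_radialPotential hu)
  have heq : truncation u ε = (fun x => cutoffMain (ε • x) (u x)) +
      fun x => cutoffCorr (ε • x) (radialPotential u x) := rfl
  rw [heq, iteratedFDeriv_add_apply (c1.contDiffAt.of_le (mod_cast le_top))
    (c2.contDiffAt.of_le (mod_cast le_top)), Finset.sum_add_distrib]
  refine (norm_add_le _ _).trans ?_
  have e1 := b₁ ε hε u hu x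
  have e2 := b₂ ε hε _ (contDiff_radialPotential hu) x
  set s₁ := ∑ i ∈ Finset.range (k + 1), ‖iteratedFDeriv ℝ i u x‖ with hs₁
  set s₂ := ∑ i ∈ Finset.range (k + 1), ‖iteratedFDeriv ℝ i (radialPotential u) x‖ with hs₂
  have p1 : 0 ≤ s₁ := Finset.sum_nonneg fun _ _ => norm_nonneg _
  have p2 : 0 ≤ s₂ := Finset.sum_nonneg fun _ _ => norm_nonneg _
  nlinarith [mul_nonneg h₁ p2, mul_nonneg h₂ p1]

/-- Approximation of a solenoidal field by solenoidal test fields which coincide with it on larger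
and larger balls, with uniform bounds in `H¹` and, if available, of the derivatives. -/
structure IsSolenoidalApprox (φ : E3 → E3) (ψ : ℕ → E3 → E3) : Prop where
  contDiff : ∀ n, ContDiff ℝ ∞ (ψ n)
  compact : ∀ n, HasCompactSupport (ψ n)
  div : ∀ n x, divergence (ψ n) x = 0
  eventuallyEq : ∀ x, ∀ᶠ n in atTop, ψ n =ᶠ[𝓝 x] φ
  norm_sq : ∃ C, ∀ n, ∫ x, ‖ψ n x‖ ^ 2 ≤ C
  fderiv_norm_sq : ∃ C, ∀ n, ∫ x, ‖fderiv ℝ (ψ n) x‖ ^ 2 ≤ C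
  bounded : ∀ k : ℕ, (∀ i ≤ k, ∃ C, ∀ x, ‖iteratedFDeriv ℝ i φ x‖ ≤ C) →
    ∃ C, ∀ n x, ‖iteratedFDeriv ℝ k (ψ n) x‖ ≤ C

theorem memLp_radialPotential {u : E3 → E3} (hu : ContDiff ℝ ∞ u) (h : MemLp u 2 volume) :
    MemLp (radialPotential u) 2 volume :=
  (memLp_radialMean le_rfl hu.continuous h).const_smul (2 : ℝ)

theorem memLp_fderiv_radialPotential {u : E3 → E3} (hu : ContDiff ℝ ∞ u)
    (h : MemLp (fderiv ℝ u) 2 volume) : MemLp (fderiv ℝ (radialPotential u)) 2 volume := by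
  rw [show fderiv ℝ (radialPotential u) = fun x => (2 : ℝ) • radialMean 5 (fderiv ℝ u) x from
    funext fun x => (hasFDerivAt_radialPotential hu x).fderiv]
  exact (memLp_radialMean (by norm_num) (hu.continuous_fderiv (by simp)) h).const_smul (2 : ℝ)

/-- The approximations are the truncations at scale n + 1. The L² bounds come from those of φ, of
its potential and of their gradients; the uniform bounds come from those of φ alone, since the
potential inherits them. -/
theorem exists_solenoidalApprox {φ : E3 → E3} (hφ : ContDiff ℝ ∞ φ)
    (hdiv : ∀ x, divergence φ x = 0) (h2 : MemLp φ 2 volume)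
    (hg : MemLp (fderiv ℝ φ) 2 volume) : ∃ ψ, IsSolenoidalApprox φ ψ := by
  set a := radialPotential φ with ha
  have hca : ContDiff ℝ ∞ a := contDiff_radialPotential hφ
  have ha2 : MemLp a 2 volume := memLp_radialPotential hφ h2
  have hag : MemLp (fderiv ℝ a) 2 volume := memLp_fderiv_radialPotential hφ hg
  let ε : ℕ → ℝ := fun n => ((n : ℝ) + 1)⁻¹
  have hε0 : ∀ n, 0 < ε n := fun n => by positivity
  have hε1 : ∀ n, |ε n| ≤ 1 := fun n => by
    rw [abs_of_pos (hε0 n)]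
    exact inv_le_one_of_one_le₀ (by linarith [show (0 : ℝ) ≤ n by positivity])
  have bound_of : ∀ {X : Type} [NormedAddCommGroup X] (f : ℕ → E3 → X) (g : E3 → ℝ),
      MemLp g 2 volume → (∀ n x, ‖f n x‖ ≤ g x) → (∀ n, Continuous (f n)) →
      ∃ C, ∀ n, ∫ x, ‖f n x‖ ^ 2 ≤ C := by
    intro X _ f g hg hfg hf
    have ig := (memLp_two_iff_integrable_sq hg.aestronglyMeasurable).1 hg
    refine ⟨∫ x, g x ^ 2, fun n => ?_⟩
    have hle : ∀ x, ‖f n x‖ ^ 2 ≤ g x ^ 2 := fun x => by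
      have := hfg n x
      gcongr
    refine integral_mono (ig.mono' ((hf n).norm.pow 2).aestronglyMeasurable
      (Eventually.of_forall fun x => ?_)) ig hle
    rw [Real.norm_of_nonneg (by positivity)]
    exact hle x
  refine ⟨fun n => truncation φ (ε n), ?_, ?_, ?_, ?_, ?_, ?_, ?_⟩
  · exact fun n => contDiff_truncation hφ _
  · exact fun n => hasCompactSupport_truncation φ (hε0 n).ne'
  · exact fun n x => divergence_truncation hφ hdiv _ x
  · intro x
    obtain ⟨N, hN⟩ := exists_nat_gt ‖x‖
    filter_upwards [eventually_ge_atTop N] with n hn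
    have hx : ‖x‖ < (n : ℝ) + 1 := by
      have : (N : ℝ) ≤ n := by exact_mod_cast hn
      linarith
    have : ∀ᶠ y in 𝓝 x, ‖y‖ < (n : ℝ) + 1 := continuous_norm.continuousAt.eventually
      (gt_mem_nhds hx)
    filter_upwards [this] with y hy
    apply truncation_eq_of_norm_lt
    rw [norm_smul, Real.norm_of_nonneg (hε0 n).le, inv_mul_lt_iff₀ (by positivity), mul_one]
    exact hy
  · obtain ⟨C, hC0, hC⟩ := exists_bound_truncation hφ 0
    refine bound_of _ (fun x => C * (‖φ x‖ + ‖a x‖)) ((h2.norm.add ha2.norm).const_mul C) ?_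
      fun n => (contDiff_truncation hφ _).continuous
    intro n x
    simpa using hC (ε n) (hε1 n) x
  · obtain ⟨C, hC0, hC⟩ := exists_bound_truncation hφ 1
    refine bound_of _ (fun x => C * (‖φ x‖ + ‖a x‖ + (‖fderiv ℝ φ x‖ + ‖fderiv ℝ a x‖)))
      (((h2.norm.add ha2.norm).add (hg.norm.add hag.norm)).const_mul C) ?_
      fun n => (contDiff_truncation hφ _).continuous_fderiv (by simp)
    intro n x
    have := hC (ε n) (hε1 n) x
    simpa [Finset.sum_range_succ, ← norm_iteratedFDeriv_fderiv] using this
  · intro k hk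
    obtain ⟨C, hC0, hC⟩ := exists_bound_truncation hφ k
    choose! D hD using hk
    -- The second summand bounds the potential, which is twice a radial mean.
    refine ⟨C * ∑ i ∈ Finset.range (k + 1), (D i + 2 * D i), fun n x =>
      (hC (ε n) (hε1 n) x).trans ?_⟩
    gcongr with i hi
    · exact hD i (by simpa [Nat.lt_succ_iff] using hi) x
    · have hi' : i ≤ k := by simpa [Nat.lt_succ_iff] using hi
      have h3 := norm_iteratedFDeriv_radialMean_le i 3 hφ (hD i hi') x
      have h4 : radialPotential φ = (2 : ℝ) • radialMean 3 φ := rfl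
      rw [h4, iteratedFDeriv_const_smul_apply
        ((contDiff_radialMean 3 hφ).contDiffAt.of_le (mod_cast le_top)), norm_smul]
      norm_num
      exact h3

/-! ### Vector calculus -/

theorem integrable_mul_of_hasCompactSupport {f g : E3 → ℝ} (hf : LocallyIntegrable f volume)
    (hg : Continuous g) (hc : HasCompactSupport g) : Integrable (fun x => f x * g x) volume :=
  hf.integrable_smul_right_of_hasCompactSupport hg hc

theorem locallyIntegrable_coord {v : E3 → E3} (hv : LocallyIntegrable v volume) (i : Fin 3) :
    LocallyIntegrable (fun x => v x i) volume := fun x => by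
  obtain ⟨s, hs, h⟩ := hv x
  exact ⟨s, hs, (EuclideanSpace.proj i : E3 →L[ℝ] ℝ).integrable_comp h⟩

theorem locallyIntegrable_gradient_coord {G : E3 → E3 →L[ℝ] E3}
    (hG : LocallyIntegrable G volume) (i j : Fin 3) :
    LocallyIntegrable (fun x => (G x (e j)) i) volume := fun x => by
  obtain ⟨s, hs, h⟩ := hG x
  exact ⟨s, hs, ((EuclideanSpace.proj i : E3 →L[ℝ] ℝ) ∘L
    (ContinuousLinearMap.apply ℝ E3 (e j))).integrable_comp h⟩

theorem contDiff_coord {v : E3 → E3} (hv : ContDiff ℝ ∞ v) (i : Fin 3) :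
    ContDiff ℝ ∞ (fun x => v x i) :=
  (EuclideanSpace.proj i : E3 →L[ℝ] ℝ).contDiff.comp hv

theorem fderiv_coord {v : E3 → E3} (hv : ContDiff ℝ ∞ v) (i : Fin 3) (x w : E3) :
    fderiv ℝ (fun x => v x i) x w = (fderiv ℝ v x w) i := by
  have h1 := (hv.differentiable (by simp) x).hasFDerivAt
  have h2 := (EuclideanSpace.proj i : E3 →L[ℝ] ℝ).hasFDerivAt.comp x h1
  have h3 : HasFDerivAt (fun x => v x i) _ x := h2
  rw [h3.fderiv]
  rfl

theorem hasCompactSupport_coord {v : E3 → E3} (hv : HasCompactSupport v) (i : Fin 3) :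
    HasCompactSupport (fun x => v x i) :=
  hv.comp_left (g := fun w : E3 => w i) rfl

theorem HasWeakGradient.coord {v : E3 → E3} {G : E3 → E3 →L[ℝ] E3} (h : HasWeakGradient v G)
    {ψ : E3 → ℝ} (hψ : ContDiff ℝ ∞ ψ) (hc : HasCompactSupport ψ) (i j : Fin 3) :
    Integrable (fun x => v x i * fderiv ℝ ψ x (e j)) volume ∧
    Integrable (fun x => (G x (e j)) i * ψ x) volume ∧
    ∫ x, v x i * fderiv ℝ ψ x (e j) = - ∫ x, (G x (e j)) i * ψ x := by
  obtain ⟨hv, hG, hw⟩ := h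
  have hd : Continuous (fun x => fderiv ℝ ψ x (e j)) :=
    (hψ.continuous_fderiv (by simp)).clm_apply continuous_const
  have hdc : HasCompactSupport (fun x => fderiv ℝ ψ x (e j)) :=
    (hc.fderiv ℝ).comp_left (g := fun L : E3 →L[ℝ] ℝ => L (e j)) rfl
  refine ⟨integrable_mul_of_hasCompactSupport (locallyIntegrable_coord hv i) hd hdc,
    integrable_mul_of_hasCompactSupport (locallyIntegrable_gradient_coord hG i j)
      hψ.continuous hc, ?_⟩
  have h1 := hw ψ hψ hc j
  have hGj : LocallyIntegrable (fun x => G x (e j)) volume := fun x => by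
    obtain ⟨s, hs, h⟩ := hG x
    exact ⟨s, hs, (ContinuousLinearMap.apply ℝ E3 (e j)).integrable_comp h⟩
  have i1 : Integrable (fun x => fderiv ℝ ψ x (e j) • v x) volume :=
    hv.integrable_smul_left_of_hasCompactSupport hd hdc
  have i2 : Integrable (fun x => ψ x • G x (e j)) volume :=
    hGj.integrable_smul_left_of_hasCompactSupport hψ.continuous hc
  have h2 := congrArg (EuclideanSpace.proj i : E3 →L[ℝ] ℝ) h1
  rw [map_neg, ← ContinuousLinearMap.integral_comp_comm _ i1,
    ← ContinuousLinearMap.integral_comp_comm _ i2] at h2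
  simpa [mul_comm] using h2

theorem curl_apply (v : E3 → E3) (x : E3) (i : Fin 3) :
    curl v x i = ![(fderiv ℝ v x (e 1)) 2 - (fderiv ℝ v x (e 2)) 1,
      (fderiv ℝ v x (e 2)) 0 - (fderiv ℝ v x (e 0)) 2,
      (fderiv ℝ v x (e 0)) 1 - (fderiv ℝ v x (e 1)) 0] i := by
  fin_cases i <;> simp [curl, curlOf]

theorem curlOf_apply (L : E3 →L[ℝ] E3) (i : Fin 3) :
    curlOf L i = ![(L (e 1)) 2 - (L (e 2)) 1, (L (e 2)) 0 - (L (e 0)) 2,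
      (L (e 0)) 1 - (L (e 1)) 0] i := by
  fin_cases i <;> simp [curlOf]

/-- The curl of a weak gradient is the curl in the sense of distributions. -/
theorem HasWeakGradient.integral_inner_curl {v : E3 → E3} {G : E3 → E3 →L[ℝ] E3}
    (h : HasWeakGradient v G) {Ψ : E3 → E3} (hΨ : ContDiff ℝ ∞ Ψ) (hc : HasCompactSupport Ψ) :
    ∫ x, ⟪v x, curl Ψ x⟫_ℝ = ∫ x, ⟪curlOf (G x), Ψ x⟫_ℝ := by
  have key : ∀ i j k : Fin 3, Integrable (fun x => v x i * (fderiv ℝ Ψ x (e j)) k) volume ∧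
      Integrable (fun x => (G x (e j)) i * Ψ x k) volume ∧
      ∫ x, v x i * (fderiv ℝ Ψ x (e j)) k = - ∫ x, (G x (e j)) i * Ψ x k := by
    intro i j k
    have := h.coord (contDiff_coord hΨ k) (hasCompactSupport_coord hc k) i j
    simpa only [fderiv_coord hΨ] using this
  have e1 : ∀ x, ⟪v x, curl Ψ x⟫_ℝ =
      (v x 0 * (fderiv ℝ Ψ x (e 1)) 2 - v x 0 * (fderiv ℝ Ψ x (e 2)) 1) +
      (v x 1 * (fderiv ℝ Ψ x (e 2)) 0 - v x 1 * (fderiv ℝ Ψ x (e 0)) 2) +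
      (v x 2 * (fderiv ℝ Ψ x (e 0)) 1 - v x 2 * (fderiv ℝ Ψ x (e 1)) 0) := by
    intro x
    rw [inner_eq_coord]
    simp only [curl_apply, Matrix.cons_val]
    ring
  have e2 : ∀ x, ⟪curlOf (G x), Ψ x⟫_ℝ =
      ((G x (e 1)) 2 * Ψ x 0 - (G x (e 2)) 1 * Ψ x 0) +
      ((G x (e 2)) 0 * Ψ x 1 - (G x (e 0)) 2 * Ψ x 1) +
      ((G x (e 0)) 1 * Ψ x 2 - (G x (e 1)) 0 * Ψ x 2) := by
    intro x
    rw [inner_eq_coord]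
    simp only [curlOf_apply, Matrix.cons_val]
    ring
  have split : ∀ {f g h k l m : E3 → ℝ}, Integrable f → Integrable g → Integrable h →
      Integrable k → Integrable l → Integrable m →
      ∫ x, ((f x - g x) + (h x - k x) + (l x - m x)) =
        (∫ x, f x) - (∫ x, g x) + ((∫ x, h x) - ∫ x, k x) + ((∫ x, l x) - ∫ x, m x) := by
    intro f g h k l m hf hg hh hk hl hm
    have a1 : Integrable (fun x => f x - g x) := hf.sub hg
    have a2 : Integrable (fun x => h x - k x) := hh.sub hk
    have a3 : Integrable (fun x => l x - m x) := hl.sub hm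
    have a4 : Integrable (fun x => (f x - g x) + (h x - k x)) := a1.add a2
    rw [integral_add a4 a3, integral_add a1 a2, integral_sub hf hg, integral_sub hh hk,
      integral_sub hl hm]
  simp_rw [e1, e2]
  rw [split (key 0 1 2).1 (key 0 2 1).1 (key 1 2 0).1 (key 1 0 2).1 (key 2 0 1).1 (key 2 1 0).1,
    split (key 2 1 0).2.1 (key 1 2 0).2.1 (key 0 2 1).2.1 (key 2 0 1).2.1 (key 1 0 2).2.1
      (key 0 1 2).2.1, (key 0 1 2).2.2, (key 0 2 1).2.2, (key 1 2 0).2.2, (key 1 0 2).2.2,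
    (key 2 0 1).2.2, (key 2 1 0).2.2]
  ring

theorem integrable_of_hasCompactSupport_left {f g : E3 → ℝ} (hf : Continuous f)
    (hg : Continuous g) (hc : HasCompactSupport f) : Integrable (fun x => f x * g x) volume :=
  (hf.mul hg).integrable_of_hasCompactSupport hc.mul_right

theorem integral_mul_fderiv_of_hasCompactSupport {f g : E3 → ℝ} (hf : ContDiff ℝ ∞ f)
    (hc : HasCompactSupport f) (hg : ContDiff ℝ ∞ g) (v : E3) :
    ∫ x, f x * fderiv ℝ g x v = - ∫ x, fderiv ℝ f x v * g x := by
  have hdf : Continuous (fun x => fderiv ℝ f x v) :=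
    (hf.continuous_fderiv (by simp)).clm_apply continuous_const
  have hdg : Continuous (fun x => fderiv ℝ g x v) :=
    (hg.continuous_fderiv (by simp)).clm_apply continuous_const
  have hdc : HasCompactSupport (fun x => fderiv ℝ f x v) :=
    (hc.fderiv ℝ).comp_left (g := fun L : E3 →L[ℝ] ℝ => L v) rfl
  exact integral_mul_fderiv_eq_neg_fderiv_mul_of_integrable
    (integrable_of_hasCompactSupport_left hdf hg.continuous hdc)
    (integrable_of_hasCompactSupport_left hf.continuous hdg hc)
    (integrable_of_hasCompactSupport_left hf.continuous hg.continuous hc)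
    (fun x _ => hf.differentiable (by simp) x) (fun x _ => hg.differentiable (by simp) x)

theorem hasWeakGradient_of_contDiff {v : E3 → E3} (hv : ContDiff ℝ ∞ v) :
    HasWeakGradient v (fderiv ℝ v) := by
  have hdv := hv.continuous_fderiv (by simp)
  refine ⟨hv.continuous.locallyIntegrable, hdv.locallyIntegrable, fun φ hφ hc j => ?_⟩
  have hd : Continuous (fun x => fderiv ℝ φ x (e j)) :=
    (hφ.continuous_fderiv (by simp)).clm_apply continuous_const
  have hdc : HasCompactSupport (fun x => fderiv ℝ φ x (e j)) :=
    (hc.fderiv ℝ).comp_left (g := fun L : E3 →L[ℝ] ℝ => L (e j)) rfl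
  have i1 : Integrable (fun x => fderiv ℝ φ x (e j) • v x) volume :=
    hv.continuous.locallyIntegrable.integrable_smul_left_of_hasCompactSupport hd hdc
  have i2 : Integrable (fun x => φ x • fderiv ℝ v x (e j)) volume :=
    (hdv.clm_apply continuous_const).locallyIntegrable.integrable_smul_left_of_hasCompactSupport
      hφ.continuous hc
  ext i
  have hp : ∀ w : E3, w i = (EuclideanSpace.proj i : E3 →L[ℝ] ℝ) w := fun _ => rfl
  rw [hp, hp, map_neg, ← ContinuousLinearMap.integral_comp_comm _ i1,
    ← ContinuousLinearMap.integral_comp_comm _ i2]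
  have := integral_mul_fderiv_of_hasCompactSupport hφ hc (contDiff_coord hv i) (e j)
  simp only [fderiv_coord hv] at this
  simp only [← hp, PiLp.smul_apply, smul_eq_mul]
  rw [this, neg_neg]

theorem integral_inner_curl_eq {φ Y : E3 → E3} (hφ : ContDiff ℝ ∞ φ) (hc : HasCompactSupport φ)
    (hY : ContDiff ℝ ∞ Y) : ∫ x, ⟪φ x, curl Y x⟫_ℝ = ∫ x, ⟪curl φ x, Y x⟫_ℝ := by
  have := (hasWeakGradient_of_contDiff hY).integral_inner_curl hφ hc
  simp only [real_inner_comm] at this ⊢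
  exact this.symm

theorem fderiv_apply_eq_sum (p : E3 → ℝ) (x v : E3) :
    fderiv ℝ p x v = v 0 * fderiv ℝ p x (e 0) + v 1 * fderiv ℝ p x (e 1) +
      v 2 * fderiv ℝ p x (e 2) := by
  rw [map_eq_sum_e (fderiv ℝ p x) v]; simp

/-- This removes the pressure. No growth condition on p is needed, because φ has compact support. -/
theorem integral_inner_gradient_eq_zero {φ : E3 → E3} {p : E3 → ℝ} (hφ : ContDiff ℝ ∞ φ)
    (hc : HasCompactSupport φ) (hdiv : ∀ x, divergence φ x = 0) (hp : ContDiff ℝ ∞ p) :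
    ∫ x, ⟪φ x, gradient p x⟫_ℝ = 0 := by
  have hdp : ∀ j, Continuous (fun x => fderiv ℝ p x (e j)) := fun j =>
    (hp.continuous_fderiv (by simp)).clm_apply continuous_const
  have hφj := fun j => contDiff_coord hφ j
  have hcj := fun j => hasCompactSupport_coord hc j
  have i1 : ∀ j, Integrable (fun x => φ x j * fderiv ℝ p x (e j)) volume := fun j =>
    integrable_of_hasCompactSupport_left (hφj j).continuous (hdp j) (hcj j)
  have hdφ : ∀ j, Continuous (fun x => (fderiv ℝ φ x (e j)) j) := fun j =>
    (EuclideanSpace.proj j : E3 →L[ℝ] ℝ).continuous.comp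
      ((hφ.continuous_fderiv (by simp)).clm_apply continuous_const)
  have hdc : ∀ j, HasCompactSupport (fun x => (fderiv ℝ φ x (e j)) j) := fun j =>
    (hc.fderiv ℝ).comp_left (g := fun L : E3 →L[ℝ] E3 => (L (e j)) j) rfl
  have i2 : ∀ j, Integrable (fun x => (fderiv ℝ φ x (e j)) j * p x) volume := fun j =>
    integrable_of_hasCompactSupport_left (hdφ j) hp.continuous (hdc j)
  have key : ∀ j, ∫ x, φ x j * fderiv ℝ p x (e j) = - ∫ x, (fderiv ℝ φ x (e j)) j * p x := by
    intro j
    have := integral_mul_fderiv_of_hasCompactSupport (hφj j) (hcj j) hp (e j)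
    simpa only [fderiv_coord hφ] using this
  have e1 : ∀ x, ⟪φ x, gradient p x⟫_ℝ = ∑ j, φ x j * fderiv ℝ p x (e j) := by
    intro x
    rw [real_inner_comm, inner_gradient_left, fderiv_apply_eq_sum, Fin.sum_univ_three]
  simp_rw [e1]
  rw [integral_finsetSum _ fun j _ => i1 j]
  simp_rw [key]
  rw [Finset.sum_neg_distrib, ← integral_finsetSum _ fun j _ => i2 j]
  have : ∀ x, ∑ j, (fderiv ℝ φ x (e j)) j * p x = 0 := by
    intro x
    rw [← Finset.sum_mul]
    have := hdiv x
    rw [divergence] at this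
    rw [this, zero_mul]
  simp [this]

theorem contDiff_fderiv {X : Type*} [NormedAddCommGroup X] [NormedSpace ℝ X] {v : E3 → X}
    (hv : ContDiff ℝ ∞ v) : ContDiff ℝ ∞ (fderiv ℝ v) := hv.fderiv_right (by simp)

theorem contDiff_curl {v : E3 → E3} (hv : ContDiff ℝ ∞ v) : ContDiff ℝ ∞ (curl v) :=
  curlL.contDiff.comp (contDiff_fderiv hv)

theorem fderiv_curl {v : E3 → E3} (hv : ContDiff ℝ ∞ v) (x w : E3) :
    fderiv ℝ (curl v) x w = curlOf (fderiv ℝ (fderiv ℝ v) x w) := by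
  have h1 := ((contDiff_fderiv hv).differentiable (by simp) x).hasFDerivAt
  have h2 : HasFDerivAt (curl v) _ x := curlL.hasFDerivAt.comp x h1
  rw [h2.fderiv]
  rfl

theorem contDiff_divergence {v : E3 → E3} (hv : ContDiff ℝ ∞ v) : ContDiff ℝ ∞ (divergence v) := by
  rw [show divergence v = fun x => divL (fderiv ℝ v x) from funext (divergence_eq v)]
  exact divL.contDiff.comp (contDiff_fderiv hv)

theorem fderiv_divergence {v : E3 → E3} (hv : ContDiff ℝ ∞ v) (x w : E3) :
    fderiv ℝ (divergence v) x w = divL (fderiv ℝ (fderiv ℝ v) x w) := by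
  have h1 := ((contDiff_fderiv hv).differentiable (by simp) x).hasFDerivAt
  have h2 : HasFDerivAt (fun x => divL (fderiv ℝ v x)) _ x := divL.hasFDerivAt.comp x h1
  rw [show divergence v = fun x => divL (fderiv ℝ v x) from funext (divergence_eq v), h2.fderiv]
  rfl

theorem fderiv_fderiv_symm {v : E3 → E3} (hv : ContDiff ℝ ∞ v) (x a b : E3) :
    fderiv ℝ (fderiv ℝ v) x a b = fderiv ℝ (fderiv ℝ v) x b a :=
  (hv.contDiffAt.isSymmSndFDerivAt (by
    rw [minSmoothness_of_isRCLikeNormedField]; exact ENat.LEInfty.out)) a b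

theorem laplacian_eq_sum (v : E3 → E3) (x : E3) :
    Laplacian.laplacian v x = ∑ j, fderiv ℝ (fderiv ℝ v) x (e j) (e j) := by
  rw [InnerProductSpace.laplacian_eq_iteratedFDeriv_orthonormalBasis v
    (EuclideanSpace.basisFun (Fin 3) ℝ)]
  refine Finset.sum_congr rfl fun j _ => ?_
  rw [iteratedFDeriv_two_apply]
  simp [e]

/-- The identity Δ = ∇ div - curl curl, paired with a vector w; it rests on the symmetry of second
derivatives. -/
theorem inner_laplacian_eq {v : E3 → E3} (hv : ContDiff ℝ ∞ v) (x w : E3) :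
    ⟪w, Laplacian.laplacian v x⟫_ℝ =
      fderiv ℝ (divergence v) x w - ⟪w, curl (curl v) x⟫_ℝ := by
  have hs := fun i j => fderiv_fderiv_symm hv x (e i) (e j)
  rw [laplacian_eq_sum, fderiv_apply_eq_sum, inner_eq_coord, inner_eq_coord]
  simp only [fderiv_divergence hv, divL_apply, curl_apply, fderiv_curl hv, curlOf_apply,
    Fin.sum_univ_three, PiLp.add_apply, Matrix.cons_val]
  rw [hs 1 0, hs 2 0, hs 2 1]
  ring

theorem laplacian_eq_neg_curl_curl {v : E3 → E3} (hv : ContDiff ℝ ∞ v)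
    (hdiv : ∀ x, divergence v x = 0) (x : E3) :
    Laplacian.laplacian v x = - curl (curl v) x := by
  have h0 : divergence v = fun _ => 0 := funext hdiv
  refine ext_inner_left ℝ fun w => ?_
  rw [inner_laplacian_eq hv, h0, inner_neg_right]
  simp

/-- The weak form of the Laplacian of a solenoidal field. -/
theorem integral_inner_laplacian_eq {v : E3 → E3} {G : E3 → E3 →L[ℝ] E3}
    (hG : HasWeakGradient v G) (hdiv : WeakDivFree v) {φ : E3 → E3} (hφ : ContDiff ℝ ∞ φ)
    (hc : HasCompactSupport φ) :
    ∫ x, ⟪v x, Laplacian.laplacian φ x⟫_ℝ = - ∫ x, ⟪curlOf (G x), curl φ x⟫_ℝ := by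
  have hdc : HasCompactSupport (fderiv ℝ φ) := hc.fderiv ℝ
  have hcd : HasCompactSupport (divergence φ) := by
    rw [show divergence φ = divL ∘ fderiv ℝ φ from funext (divergence_eq φ)]
    exact hdc.comp_left (map_zero _)
  have hcc : HasCompactSupport (curl φ) := hdc.comp_left (g := curlL) (map_zero _)
  have hccc : HasCompactSupport (curl (curl φ)) :=
    (hcc.fderiv ℝ).comp_left (g := curlL) (map_zero _)
  have hsc := contDiff_curl hφ
  rw [← hG.integral_inner_curl hsc hcc]
  simp_rw [inner_laplacian_eq hφ]
  have i2 : Integrable (fun x => ⟪v x, curl (curl φ) x⟫_ℝ) volume := by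
    simp_rw [inner_eq_coord]
    have := fun i => integrable_mul_of_hasCompactSupport (locallyIntegrable_coord hG.1 i)
      (contDiff_coord (contDiff_curl hsc) i).continuous (hasCompactSupport_coord hccc i)
    exact ((this 0).add (this 1)).add (this 2)
  have i1 : Integrable (fun x => fderiv ℝ (divergence φ) x (v x)) volume := by
    simp_rw [fderiv_apply_eq_sum (divergence φ) _ (v _)]
    have := fun j => integrable_mul_of_hasCompactSupport (locallyIntegrable_coord hG.1 j)
      (((contDiff_divergence hφ).continuous_fderiv (by simp)).clm_apply
        (continuous_const (y := e j)))
      ((hcd.fderiv ℝ).comp_left (g := fun L : E3 →L[ℝ] ℝ => L (e j)) rfl)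
    exact ((this 0).add (this 1)).add (this 2)
  -- The part ∇ div φ of the Laplacian is a gradient of a test function and is annihilated by the
  -- solenoidal field v.
  rw [integral_sub i1 i2, hdiv _ (contDiff_divergence hφ) hcd, zero_sub]

/-! ### Mollification -/

section Mollification

variable {X : Type*} [NormedAddCommGroup X] [NormedSpace ℝ X]

/-- The convolution of a field with a scalar kernel. -/
def mollify (ρ : E3 → ℝ) (V : E3 → X) : E3 → X :=
  convolution ρ V (ContinuousLinearMap.lsmul ℝ ℝ) volume

theorem mollify_apply (ρ : E3 → ℝ) (V : E3 → X) (x : E3) :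
    mollify ρ V x = ∫ y, ρ (x - y) • V y := convolution_lsmul_swap

theorem contDiff_mollify {ρ : E3 → ℝ} {V : E3 → X} (hρ : ContDiff ℝ ∞ ρ)
    (hc : HasCompactSupport ρ) (hV : LocallyIntegrable V volume) :
    ContDiff ℝ ∞ (mollify ρ V) :=
  hc.contDiff_convolution_left _ hρ hV

/-- Jensen's inequality for the probability density y ↦ ρ(x - y), again from the nonnegativity of a
variance. Integrating it in x yields the contraction of mollification in L². -/
theorem norm_mollify_sq_le {ρ : E3 → ℝ} {V : E3 → X} (hρ : Continuous ρ)
    (hc : HasCompactSupport ρ) (h0 : ∀ x, 0 ≤ ρ x) (h1 : ∫ x, ρ x = 1)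
    (hV : MemLp V 2 volume) (x : E3) :
    ‖mollify ρ V x‖ ^ 2 ≤ mollify ρ (fun y => ‖V y‖ ^ 2) x := by
  have iV := (memLp_two_iff_integrable_sq_norm hV.aestronglyMeasurable).1 hV
  have hlV : LocallyIntegrable V volume := hV.locallyIntegrable (by norm_num)
  let r : E3 → ℝ := fun y => ρ (x - y)
  have hr : Continuous r := by fun_prop
  have hrc : HasCompactSupport r := hc.comp_homeomorph (Homeomorph.subLeft x)
  have hr1 : ∫ y, r y = 1 := by rw [← h1]; exact integral_sub_left_eq_self ρ volume x
  have ir : Integrable r := hr.integrable_of_hasCompactSupport hrc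
  have i1 : Integrable (fun y => r y * ‖V y‖) := by
    have := (hlV.integrable_smul_left_of_hasCompactSupport hr hrc).norm
    simpa only [norm_smul, Real.norm_of_nonneg (h0 _), r] using this
  have i2 : Integrable (fun y => r y * ‖V y‖ ^ 2) :=
    iV.locallyIntegrable.integrable_smul_left_of_hasCompactSupport hr hrc
  rw [mollify_apply, mollify_apply]
  set m := ∫ y, r y * ‖V y‖ with hm
  have hle : ‖∫ y, ρ (x - y) • V y‖ ≤ m := by
    refine (norm_integral_le_integral_norm _).trans (le_of_eq ?_)
    refine integral_congr_ae (Eventually.of_forall fun y => ?_)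
    simp only
    rw [norm_smul, Real.norm_of_nonneg (h0 _)]
  have hvar : 0 ≤ ∫ y, r y * (‖V y‖ - m) ^ 2 :=
    integral_nonneg fun y => mul_nonneg (h0 _) (sq_nonneg _)
  have hexp : ∫ y, r y * (‖V y‖ - m) ^ 2 = (∫ y, r y * ‖V y‖ ^ 2) - 2 * m * m + m ^ 2 := by
    have e1 : ∀ y, r y * (‖V y‖ - m) ^ 2 =
        (r y * ‖V y‖ ^ 2 - 2 * m * (r y * ‖V y‖)) + r y * m ^ 2 := fun y => by ring
    simp_rw [e1]
    have i3 : Integrable (fun y => r y * ‖V y‖ ^ 2 - 2 * m * (r y * ‖V y‖)) :=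
      i2.sub (i1.const_mul _)
    rw [integral_add i3 (ir.mul_const _), integral_sub i2 (i1.const_mul _), integral_const_mul,
      integral_mul_const, hr1, one_mul]
  have : ∫ y, ρ (x - y) • ‖V y‖ ^ 2 = ∫ y, r y * ‖V y‖ ^ 2 := rfl
  rw [this]
  have h2 : ‖∫ y, ρ (x - y) • V y‖ ^ 2 ≤ m ^ 2 := by gcongr
  nlinarith

theorem memLp_mollify {ρ : E3 → ℝ} {V : E3 → X} (hρ : ContDiff ℝ ∞ ρ)
    (hc : HasCompactSupport ρ) (h0 : ∀ x, 0 ≤ ρ x) (h1 : ∫ x, ρ x = 1)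
    (hV : MemLp V 2 volume) : MemLp (mollify ρ V) 2 volume ∧
      ∫ x, ‖mollify ρ V x‖ ^ 2 ≤ ∫ x, ‖V x‖ ^ 2 := by
  have iV := (memLp_two_iff_integrable_sq_norm hV.aestronglyMeasurable).1 hV
  have hlV : LocallyIntegrable V volume := hV.locallyIntegrable (by norm_num)
  have hcont := (contDiff_mollify hρ hc hlV).continuous
  have ir : Integrable ρ := hρ.continuous.integrable_of_hasCompactSupport hc
  have ic : Integrable (mollify ρ fun y => ‖V y‖ ^ 2) := ir.integrable_convolution _ iV
  have i1 : Integrable (fun x => ‖mollify ρ V x‖ ^ 2) := by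
    refine ic.mono' (hcont.norm.pow 2).aestronglyMeasurable (Eventually.of_forall fun x => ?_)
    rw [Real.norm_of_nonneg (by positivity)]
    exact norm_mollify_sq_le hρ.continuous hc h0 h1 hV x
  refine ⟨(memLp_two_iff_integrable_sq_norm hcont.aestronglyMeasurable).2 i1, ?_⟩
  calc ∫ x, ‖mollify ρ V x‖ ^ 2 ≤ ∫ x, mollify ρ (fun y => ‖V y‖ ^ 2) x :=
        integral_mono i1 ic fun x => norm_mollify_sq_le hρ.continuous hc h0 h1 hV x
    _ = ∫ x, ‖V x‖ ^ 2 := by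
        have := integral_convolution (ContinuousLinearMap.lsmul ℝ ℝ) ir iV (μ := volume)
        rw [h1] at this
        simpa [mollify] using this

theorem fderiv_mollify_apply {ρ : E3 → ℝ} {V : E3 → X} (hρ : ContDiff ℝ ∞ ρ)
    (hc : HasCompactSupport ρ) (hV : LocallyIntegrable V volume) (x v : E3) :
    fderiv ℝ (mollify ρ V) x v = ∫ y, fderiv ℝ ρ (x - y) v • V y := by
  have h1 := hc.hasFDerivAt_convolution_left (μ := volume) (ContinuousLinearMap.lsmul ℝ ℝ)
    (hρ.of_le (by simp)) hV x
  have hex : ConvolutionExistsAt (fderiv ℝ ρ) V x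
      (ContinuousLinearMap.precompL E3 (ContinuousLinearMap.lsmul ℝ ℝ)) volume :=
    (hc.fderiv ℝ).convolutionExists_left _ (hρ.continuous_fderiv (by simp)) hV x
  rw [mollify, h1.fderiv, convolution_eq_swap, ContinuousLinearMap.integral_apply hex.integrable_swap]
  rfl

end Mollification

theorem fderiv_reflect {ρ : E3 → ℝ} (hρ : ContDiff ℝ ∞ ρ) (x y v : E3) :
    fderiv ℝ (fun y => ρ (x - y)) y v = - fderiv ℝ ρ (x - y) v := by
  have h1 : HasFDerivAt (fun y : E3 => x - y) (-ContinuousLinearMap.id ℝ E3) y :=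
    (hasFDerivAt_id y).const_sub x
  have h2 := (hρ.differentiable (by simp) (x - y)).hasFDerivAt.comp y h1
  have h3 : HasFDerivAt (fun y => ρ (x - y)) _ y := h2
  rw [h3.fderiv]
  simp

/-- The derivative falls on the kernel, and y ↦ ρ(x - y) is a legitimate test function for the weak
gradient. The sign from the reflection compensates the one from integration by parts. -/
theorem fderiv_mollify_eq {ρ : E3 → ℝ} {V : E3 → E3} {G : E3 → E3 →L[ℝ] E3}
    (hρ : ContDiff ℝ ∞ ρ) (hc : HasCompactSupport ρ) (hG : HasWeakGradient V G) (x : E3) :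
    fderiv ℝ (mollify ρ V) x = mollify ρ G x := by
  have hrs : ContDiff ℝ ∞ (fun y => ρ (x - y)) := hρ.comp (contDiff_const.sub contDiff_id)
  have hrc : HasCompactSupport (fun y => ρ (x - y)) := hc.comp_homeomorph (Homeomorph.subLeft x)
  have iG : Integrable (fun y => ρ (x - y) • G y) :=
    hG.2.1.integrable_smul_left_of_hasCompactSupport hrs.continuous hrc
  have key : ∀ j, fderiv ℝ (mollify ρ V) x (e j) = mollify ρ G x (e j) := by
    intro j
    rw [fderiv_mollify_apply hρ hc hG.1, mollify_apply, ContinuousLinearMap.integral_apply iG]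
    have := hG.2.2 _ hrs hrc j
    simp_rw [fderiv_reflect hρ, neg_smul, integral_neg, neg_inj] at this
    rw [this]
    rfl
  refine ContinuousLinearMap.ext fun v => ?_
  rw [map_eq_sum_e _ v, map_eq_sum_e (mollify ρ G x) v, key, key, key]

theorem divergence_mollify_eq_zero {ρ : E3 → ℝ} {V : E3 → E3} (hρ : ContDiff ℝ ∞ ρ)
    (hc : HasCompactSupport ρ) (hV : LocallyIntegrable V volume) (hdiv : WeakDivFree V) (x : E3) :
    divergence (mollify ρ V) x = 0 := by
  have hrs : ContDiff ℝ ∞ (fun y => ρ (x - y)) := hρ.comp (contDiff_const.sub contDiff_id)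
  have hrc : HasCompactSupport (fun y => ρ (x - y)) := hc.comp_homeomorph (Homeomorph.subLeft x)
  have hd : ∀ j, Continuous (fun y => fderiv ℝ ρ (x - y) (e j)) := fun j =>
    ((hρ.continuous_fderiv (by simp)).comp (continuous_const.sub continuous_id)).clm_apply
      continuous_const
  have hdc : ∀ j, HasCompactSupport (fun y => fderiv ℝ ρ (x - y) (e j)) := fun j =>
    ((hc.fderiv ℝ).comp_left (g := fun L : E3 →L[ℝ] ℝ => L (e j)) rfl).comp_homeomorph
      (Homeomorph.subLeft x)
  have i1 : ∀ j, Integrable (fun y => fderiv ℝ ρ (x - y) (e j) • V y) := fun j =>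
    hV.integrable_smul_left_of_hasCompactSupport (hd j) (hdc j)
  have i2 : ∀ j, Integrable (fun y => V y j * fderiv ℝ ρ (x - y) (e j)) := fun j =>
    integrable_mul_of_hasCompactSupport (locallyIntegrable_coord hV j) (hd j) (hdc j)
  have e1 : ∀ j, (fderiv ℝ (mollify ρ V) x (e j)) j =
      ∫ y, V y j * fderiv ℝ ρ (x - y) (e j) := by
    intro j
    rw [fderiv_mollify_apply hρ hc hV]
    change (EuclideanSpace.proj j : E3 →L[ℝ] ℝ) _ = _
    rw [← ContinuousLinearMap.integral_comp_comm _ (i1 j)]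
    simp [mul_comm]
  rw [divergence]
  simp_rw [e1]
  rw [← integral_finsetSum _ fun j _ => i2 j]
  have h2 := hdiv _ hrs hrc
  simp_rw [fderiv_reflect hρ, integral_neg, neg_eq_zero] at h2
  rw [← h2]
  congr 1
  ext y
  rw [fderiv_apply_eq_sum, Fin.sum_univ_three]

/-- Approximation of a solenoidal field in `H¹` by smooth ones. -/
theorem exists_smooth_approx {V : E3 → E3} {G : E3 → E3 →L[ℝ] E3} (hV : MemH V)
    (hG : HasWeakGradient V G) (hG2 : MemLp G 2 volume) :
    ∃ φ : ℕ → E3 → E3, (∀ n, ContDiff ℝ ∞ (φ n)) ∧ (∀ n x, divergence (φ n) x = 0) ∧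
      (∀ n, MemLp (φ n) 2 volume ∧ ∫ x, ‖φ n x‖ ^ 2 ≤ ∫ x, ‖V x‖ ^ 2) ∧
      (∀ n, MemLp (fderiv ℝ (φ n)) 2 volume ∧
        ∫ x, ‖fderiv ℝ (φ n) x‖ ^ 2 ≤ ∫ x, ‖G x‖ ^ 2) ∧
      (∀ᵐ x, Tendsto (fun n => φ n x) atTop (𝓝 (V x))) ∧
      (∀ᵐ x, Tendsto (fun n => fderiv ℝ (φ n) x) atTop (𝓝 (G x))) := by
  -- The ratio of the two radii is kept equal to 2: shrinking bumps of bounded eccentricity give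
  -- almost everywhere convergence by Lebesgue differentiation.
  let b : ℕ → ContDiffBump (0 : E3) := fun n =>
    ⟨((n : ℝ) + 1)⁻¹, 2 * ((n : ℝ) + 1)⁻¹, by positivity, by
      have : 0 < ((n : ℝ) + 1)⁻¹ := by positivity
      linarith⟩
  let ρ : ℕ → E3 → ℝ := fun n => (b n).normed volume
  have hρ : ∀ n, ContDiff ℝ ∞ (ρ n) := fun n => (b n).contDiff_normed
  have hc : ∀ n, HasCompactSupport (ρ n) := fun n => (b n).hasCompactSupport_normed
  have h0 : ∀ n x, 0 ≤ ρ n x := fun n => (b n).nonneg_normed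
  have h1 : ∀ n, ∫ x, ρ n x = 1 := fun n => (b n).integral_normed
  have hr : Tendsto (fun n => (b n).rOut) atTop (𝓝 0) := by
    have := (tendsto_one_div_add_atTop_nhds_zero_nat (𝕜 := ℝ)).const_mul 2
    simpa [b] using this
  have hK : ∀ᶠ n in atTop, (b n).rOut ≤ 2 * (b n).rIn := Eventually.of_forall fun n => le_rfl
  have hfd : ∀ n, fderiv ℝ (mollify (ρ n) V) = mollify (ρ n) G := fun n =>
    funext fun x => fderiv_mollify_eq (hρ n) (hc n) hG x
  refine ⟨fun n => mollify (ρ n) V, fun n => contDiff_mollify (hρ n) (hc n) hG.1,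
    fun n x => divergence_mollify_eq_zero (hρ n) (hc n) hG.1 hV.2 x,
    fun n => memLp_mollify (hρ n) (hc n) (h0 n) (h1 n) hV.1, fun n => ?_, ?_, ?_⟩
  · rw [hfd]
    exact memLp_mollify (hρ n) (hc n) (h0 n) (h1 n) hG2
  · exact ContDiffBump.ae_convolution_tendsto_right_of_locallyIntegrable hr hK hG.1
  · simp_rw [hfd]
    exact ContDiffBump.ae_convolution_tendsto_right_of_locallyIntegrable hr hK hG.2.1

/-! ### Smooth evolutions tested with solenoidal fields -/

section Joint

variable {X : Type*} [NormedAddCommGroup X] [NormedSpace ℝ X]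

theorem isOpen_slab (T : ℝ) : IsOpen (Ioo 0 T ×ˢ (univ : Set E3)) := isOpen_Ioo.prod isOpen_univ

theorem contDiffAt_slab {T : ℝ} {v : ℝ → E3 → X}
    (hv : ContDiffOn ℝ ∞ (Function.uncurry v) (Ioo 0 T ×ˢ univ)) {t : ℝ} (ht : t ∈ Ioo 0 T)
    (x : E3) : ContDiffAt ℝ ∞ (Function.uncurry v) (t, x) :=
  hv.contDiffAt ((isOpen_slab T).mem_nhds ⟨ht, mem_univ _⟩)

theorem contDiff_slice {T : ℝ} {v : ℝ → E3 → X}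
    (hv : ContDiffOn ℝ ∞ (Function.uncurry v) (Ioo 0 T ×ˢ univ)) {t : ℝ} (ht : t ∈ Ioo 0 T) :
    ContDiff ℝ ∞ (v t) := by
  rw [contDiff_iff_contDiffAt]
  intro x
  exact (contDiffAt_slab hv ht x).comp x (contDiffAt_const.prodMk contDiffAt_id)

theorem contDiffOn_spatial_fderiv {T : ℝ} {v : ℝ → E3 → X}
    (hv : ContDiffOn ℝ ∞ (Function.uncurry v) (Ioo 0 T ×ˢ univ)) :
    ContDiffOn ℝ ∞ (Function.uncurry fun t => fderiv ℝ (v t)) (Ioo 0 T ×ˢ univ) := by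
  rintro ⟨t, x⟩ ⟨ht, -⟩
  refine ContDiffAt.contDiffWithinAt ?_
  have h1 : ContDiffAt ℝ ∞ (Function.uncurry fun (z : ℝ × E3) (y : E3) => v z.1 y)
      ((t, x), x) := by
    have h2 : ContDiffAt ℝ ∞ (fun q : (ℝ × E3) × E3 => (q.1.1, q.2)) ((t, x), x) := by fun_prop
    exact (contDiffAt_slab hv ht x).comp ((t, x), x) h2
  exact ContDiffAt.fderiv (x₀ := (t, x)) (g := Prod.snd) h1 contDiffAt_snd (by simp)

theorem hasDerivAt_time {T : ℝ} {v : ℝ → E3 → X}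
    (hv : ContDiffOn ℝ ∞ (Function.uncurry v) (Ioo 0 T ×ˢ univ)) {t : ℝ} (ht : t ∈ Ioo 0 T)
    (x : E3) : HasDerivAt (fun s => v s x) (fderiv ℝ (Function.uncurry v) (t, x) (1, 0)) t := by
  have h1 := ((contDiffAt_slab hv ht x).differentiableAt (by simp)).hasFDerivAt
  have h2 : HasDerivAt (fun s : ℝ => (s, x)) (1, 0) t :=
    (hasDerivAt_id t).prodMk (hasDerivAt_const t x)
  exact h1.comp_hasDerivAt t h2

theorem continuousOn_time_deriv {T : ℝ} {v : ℝ → E3 → X}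
    (hv : ContDiffOn ℝ ∞ (Function.uncurry v) (Ioo 0 T ×ˢ univ)) :
    ContinuousOn (fun z : ℝ × E3 => deriv (fun s => v s z.2) z.1) (Ioo 0 T ×ˢ univ) := by
  have h1 : ContinuousOn (fun z : ℝ × E3 => fderiv ℝ (Function.uncurry v) z (1, 0))
      (Ioo 0 T ×ˢ univ) :=
    (hv.continuousOn_fderiv_of_isOpen (isOpen_slab T) (by simp)).clm_apply continuousOn_const
  refine h1.congr fun z hz => ?_
  exact (hasDerivAt_time hv hz.1 z.2).deriv

end Joint

theorem InEnergyClass.memLp {S : ℝ} {v : ℝ → E3 → E3} {G : ℝ → E3 → E3 →L[ℝ] E3}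
    (h : InEnergyClass S v G) : MemLp (Function.uncurry v) 2 (slabMeasure S) := by
  obtain ⟨C, hC⟩ := h.bounded
  have := h.measurable
  rw [restrict_slab] at this
  exact memLp_slab_of_bounded this hC

theorem InEnergyClass.gradient_memLp_slab {S : ℝ} {v : ℝ → E3 → E3}
    {G : ℝ → E3 → E3 →L[ℝ] E3} (h : InEnergyClass S v G) :
    MemLp (Function.uncurry G) 2 (slabMeasure S) := by
  have := h.gradient_memLp
  rwa [restrict_slab] at this

theorem InEnergyClass.curl_memLp {S : ℝ} {v : ℝ → E3 → E3} {G : ℝ → E3 → E3 →L[ℝ] E3}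
    (h : InEnergyClass S v G) :
    MemLp (Function.uncurry fun t x => curlOf (G t x)) 2 (slabMeasure S) :=
  curlL.comp_memLp' h.gradient_memLp_slab

theorem integral_norm_curlOf_sq_le {G : E3 → E3 →L[ℝ] E3} (hG : MemLp G 2 volume) :
    ∫ x, ‖curlOf (G x)‖ ^ 2 ≤ ‖curlL‖ ^ 2 * ∫ x, ‖G x‖ ^ 2 := by
  have hc : MemLp (fun x => curlOf (G x)) 2 volume := curlL.comp_memLp' hG
  have i1 := (memLp_two_iff_integrable_sq_norm hc.aestronglyMeasurable).1 hc
  have i2 := (memLp_two_iff_integrable_sq_norm hG.aestronglyMeasurable).1 hG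
  rw [← integral_const_mul]
  refine integral_mono i1 (i2.const_mul _) fun x => ?_
  change ‖curlOf (G x)‖ ^ 2 ≤ ‖curlL‖ ^ 2 * ‖G x‖ ^ 2
  rw [← mul_pow]
  exact pow_le_pow_left₀ (norm_nonneg _) (norm_curlOf_le _) 2

/-- Smooth solutions of `∂ₜ w + H + ∇p = Δ w`, `div w = 0` on `(0,T) × ℝ³`. -/
structure IsSmoothEvolution (T : ℝ) (w H : ℝ → E3 → E3) (w₀ : E3 → E3) : Prop where
  smooth : IsSmoothField T w w₀
  initial_memLp : MemLp w₀ 2 volume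
  div : ∀ t ∈ Ioo 0 T, ∀ x, divergence (w t) x = 0
  forcing_continuousOn : ContinuousOn (Function.uncurry H) (Ioo 0 T ×ˢ univ)
  forcing_memLp : ∀ S, 0 < S → S < T → MemLp (Function.uncurry H) 2 (slabMeasure S)
  equation : ∃ p : ℝ → E3 → ℝ, (∀ t ∈ Ioo 0 T, ContDiff ℝ ∞ (p t)) ∧ ∀ t ∈ Ioo 0 T, ∀ x,
    deriv (fun s => w s x) t + H t x + gradient (p t) x = Laplacian.laplacian (w t) x

/-- The weak form of `∂ₜ w + H + ∇p = Δ w` for the spatial test field `φ` with curl `c`. -/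
def WeakTested (S : ℝ) (w H : ℝ → E3 → E3) (w₀ φ c : E3 → E3) : Prop :=
  ∀ θ, IsTimeTest S θ →
    ∫ t, (deriv θ t * (∫ x, ⟪φ x, w t x⟫_ℝ) -
      θ t * ((∫ x, ⟪φ x, H t x⟫_ℝ) + ∫ x, ⟪c x, curl (w t) x⟫_ℝ)) ∂(timeMeasure S) +
      θ 0 * ∫ x, ⟪φ x, w₀ x⟫_ℝ = 0

theorem memLp_const_slab {X : Type*} [NormedAddCommGroup X] {φ : E3 → X} (hφ : MemLp φ 2 volume)
    (S : ℝ) : MemLp (fun z : ℝ × E3 => φ z.2) 2 (slabMeasure S) := hφ.comp_snd _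

theorem integrable_pairing {S : ℝ} {φ : E3 → E3} {w : ℝ → E3 → E3} (hφ : MemLp φ 2 volume)
    (hw : MemLp (Function.uncurry w) 2 (slabMeasure S)) :
    Integrable (fun t => ∫ x, ⟪φ x, w t x⟫_ℝ) (timeMeasure S) :=
  (integrable_inner_of_memLp (memLp_const_slab hφ S) hw).integral_prod_left

/-- For almost every t the spatial pairing converges by weak convergence in L², and it is dominated
by C + ‖w(t)‖², which is integrable in time. -/
theorem tendsto_weighted_pairing {S C : ℝ} {ϑ : ℝ → ℝ} (hϑ : IsWeight S ϑ)
    {w : ℝ → E3 → E3} (hw : MemLp (Function.uncurry w) 2 (slabMeasure S))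
    {φ : ℕ → E3 → E3} {Φ : E3 → E3} (hφ : ∀ n, MemLp (φ n) 2 volume) (hΦ : MemLp Φ 2 volume)
    (hC : ∀ n, ∫ x, ‖φ n x‖ ^ 2 ≤ C)
    (hlim : ∀ᵐ x, Tendsto (fun n => φ n x) atTop (𝓝 (Φ x))) :
    Tendsto (fun n => ∫ t, ϑ t * (∫ x, ⟪φ n x, w t x⟫_ℝ) ∂(timeMeasure S)) atTop
      (𝓝 (∫ t, ϑ t * (∫ x, ⟪Φ x, w t x⟫_ℝ) ∂(timeMeasure S))) := by
  obtain ⟨K, hK0, hK⟩ := hϑ.bounded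
  have iw := integrable_integral_norm_sq hw
  refine tendsto_integral_of_dominated_convergence (fun t => K * (C + ∫ x, ‖w t x‖ ^ 2))
    (fun n => (hϑ.integrable_mul (integrable_pairing (hφ n) hw)).aestronglyMeasurable)
    (((integrable_const C).add iw).const_mul K) (fun n => ?_) ?_
  · filter_upwards [ae_restrict_mem measurableSet_Ioo, memLp_slice hw] with t ht hwt
    rw [norm_mul]
    gcongr
    · exact hK t ht
    · exact (abs_integral_inner_le (hφ n) hwt).trans (by linarith [hC n])
  · filter_upwards [memLp_slice hw] with t hwt
    refine Tendsto.const_mul _ ?_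
    have := tendsto_integral_inner_of_bounded (l := atTop) hwt hΦ (Eventually.of_forall hφ)
      (Eventually.of_forall hC) hlim
    simpa only [real_inner_comm] using this

/-- The tested identity is linear in the pair (φ, c) and each term is continuous under bounded
almost everywhere convergence. It is used twice: to remove the compact support of the test field,
then its smoothness. -/
theorem weakTested_of_tendsto {S C : ℝ} {w H : ℝ → E3 → E3} {w₀ : E3 → E3}
    (hw : MemLp (Function.uncurry w) 2 (slabMeasure S))
    (hH : MemLp (Function.uncurry H) 2 (slabMeasure S))
    (hcw : MemLp (Function.uncurry fun t x => curl (w t) x) 2 (slabMeasure S))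
    (hw₀ : MemLp w₀ 2 volume)
    {φ c : ℕ → E3 → E3} {Φ κ : E3 → E3} (hφ : ∀ n, MemLp (φ n) 2 volume)
    (hc : ∀ n, MemLp (c n) 2 volume) (hΦ : MemLp Φ 2 volume) (hκ : MemLp κ 2 volume)
    (hCφ : ∀ n, ∫ x, ‖φ n x‖ ^ 2 ≤ C) (hCc : ∀ n, ∫ x, ‖c n x‖ ^ 2 ≤ C)
    (hlimφ : ∀ᵐ x, Tendsto (fun n => φ n x) atTop (𝓝 (Φ x)))
    (hlimc : ∀ᵐ x, Tendsto (fun n => c n x) atTop (𝓝 (κ x)))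
    (h : ∀ n, WeakTested S w H w₀ (φ n) (c n)) : WeakTested S w H w₀ Φ κ := by
  intro θ hθ
  have split : ∀ {f k : E3 → E3}, MemLp f 2 volume → MemLp k 2 volume →
      ∫ t, (deriv θ t * (∫ x, ⟪f x, w t x⟫_ℝ) -
        θ t * ((∫ x, ⟪f x, H t x⟫_ℝ) + ∫ x, ⟪k x, curl (w t) x⟫_ℝ)) ∂(timeMeasure S) =
      ∫ t, deriv θ t * (∫ x, ⟪f x, w t x⟫_ℝ) ∂(timeMeasure S) -
      (∫ t, θ t * (∫ x, ⟪f x, H t x⟫_ℝ) ∂(timeMeasure S) +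
        ∫ t, θ t * (∫ x, ⟪k x, curl (w t) x⟫_ℝ) ∂(timeMeasure S)) := by
    intro f k hf hk
    have i1 := hθ.isWeight_deriv.integrable_mul (integrable_pairing hf hw)
    have i2 := hθ.isWeight.integrable_mul (integrable_pairing hf hH)
    have i3 := hθ.isWeight.integrable_mul (integrable_pairing hk hcw)
    have i23 : Integrable (fun t => θ t * (∫ x, ⟪f x, H t x⟫_ℝ) +
        θ t * (∫ x, ⟪k x, curl (w t) x⟫_ℝ)) (timeMeasure S) := i2.add i3
    rw [← integral_add i2 i3, ← integral_sub i1 i23]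
    simp only [mul_add]
  have T1 := tendsto_weighted_pairing hθ.isWeight_deriv hw hφ hΦ hCφ hlimφ
  have T2 := tendsto_weighted_pairing hθ.isWeight hH hφ hΦ hCφ hlimφ
  have T3 := tendsto_weighted_pairing hθ.isWeight hcw hc hκ hCc hlimc
  have T4 : Tendsto (fun n => ∫ x, ⟪φ n x, w₀ x⟫_ℝ) atTop (𝓝 (∫ x, ⟪Φ x, w₀ x⟫_ℝ)) := by
    have := tendsto_integral_inner_of_bounded (l := atTop) hw₀ hΦ (Eventually.of_forall hφ)
      (Eventually.of_forall hCφ) hlimφ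
    simpa only [real_inner_comm] using this
  have lim := (T1.sub (T2.add T3)).add (T4.const_mul (θ 0))
  rw [← split hΦ hκ] at lim
  refine tendsto_nhds_unique lim ?_
  refine tendsto_const_nhds.congr fun n => ?_
  rw [← split (hφ n) (hc n)]
  exact (h n θ hθ).symm

namespace IsSmoothEvolution

variable {T : ℝ} {w H : ℝ → E3 → E3} {w₀ : E3 → E3}

theorem memLp (h : IsSmoothEvolution T w H w₀) {S : ℝ} (hS : 0 < S) (hST : S < T) :
    MemLp (Function.uncurry w) 2 (slabMeasure S) := (h.smooth.energyClass S hS hST).memLp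

theorem curl_memLp (h : IsSmoothEvolution T w H w₀) {S : ℝ} (hS : 0 < S) (hST : S < T) :
    MemLp (Function.uncurry fun t x => curl (w t) x) 2 (slabMeasure S) :=
  (h.smooth.energyClass S hS hST).curl_memLp

/-- Compact support of φ permits differentiation under the integral, since ∂ₜw is continuous, hence
bounded, on compact subsets of the open slab. Inserting the equation, the pressure disappears and
-Δw = curl curl w sheds one curl onto φ. -/
theorem hasDerivAt_pairing (h : IsSmoothEvolution T w H w₀) {φ : E3 → E3}
    (hφ : ContDiff ℝ ∞ φ) (hc : HasCompactSupport φ) (hdiv : ∀ x, divergence φ x = 0)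
    {t : ℝ} (ht : t ∈ Ioo 0 T) :
    HasDerivAt (fun t => ∫ x, ⟪φ x, w t x⟫_ℝ)
      (-((∫ x, ⟪φ x, H t x⟫_ℝ) + ∫ x, ⟪curl φ x, curl (w t) x⟫_ℝ)) t := by
  have hw := h.smooth.contDiffOn
  have hwt : ContDiff ℝ ∞ (w t) := contDiff_slice hw ht
  obtain ⟨δ, hδ, hball⟩ := Metric.isOpen_iff.1 isOpen_Ioo t ht
  have hsub : Metric.closedBall t (δ / 2) ⊆ Ioo 0 T :=
    (Metric.closedBall_subset_ball (by linarith)).trans hball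
  obtain ⟨C, hC⟩ := ((isCompact_closedBall t (δ / 2)).prod hc).exists_bound_of_continuousOn
    ((continuousOn_time_deriv hw).mono (prod_mono hsub (subset_univ _)))
  have hcs : ∀ f : E3 → E3, Continuous f → Integrable (fun x => ⟪φ x, f x⟫_ℝ) := by
    intro f hf
    refine (hφ.continuous.inner hf).integrable_of_hasCompactSupport ?_
    refine hc.mono' (fun x hx => subset_tsupport _ fun h0 => hx ?_)
    simp [h0]
  have key := (hasDerivAt_integral_of_dominated_loc_of_deriv_le (μ := (volume : Measure E3))
    (F := fun t x => ⟪φ x, w t x⟫_ℝ) (F' := fun t x => ⟪φ x, deriv (fun s => w s x) t⟫_ℝ)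
    (x₀ := t) (bound := fun x => ‖φ x‖ * |C|) (Metric.closedBall_mem_nhds t (half_pos hδ))
    ?_ ?_ ?_ ?_ ?_ ?_).2
  · refine key.congr_deriv ?_
    obtain ⟨p, hp, heq⟩ := h.equation
    have hHt : Continuous (H t) := by
      have := h.forcing_continuousOn.comp (f := fun x : E3 => (t, x)) (s := univ)
        (by fun_prop) (fun x _ => ⟨ht, mem_univ _⟩)
      rw [← continuousOn_univ]; exact this
    have hgp : Continuous (gradient (p t)) :=
      (InnerProductSpace.toDual ℝ E3).symm.continuous.comp ((hp t ht).continuous_fderiv (by simp))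
    have e1 : ∀ x, ⟪φ x, deriv (fun s => w s x) t⟫_ℝ =
        - (⟪φ x, H t x⟫_ℝ + ⟪φ x, curl (curl (w t)) x⟫_ℝ + ⟪φ x, gradient (p t) x⟫_ℝ) := by
      intro x
      have h1 := heq t ht x
      rw [laplacian_eq_neg_curl_curl hwt (h.div t ht)] at h1
      have h2 : deriv (fun s => w s x) t =
          - (H t x + curl (curl (w t)) x + gradient (p t) x) := by
        rw [eq_neg_iff_add_eq_zero]
        have : deriv (fun s => w s x) t + (H t x + curl (curl (w t)) x + gradient (p t) x) =
          (deriv (fun s => w s x) t + H t x + gradient (p t) x) + curl (curl (w t)) x := by abel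
        rw [this, h1]; simp
      rw [h2, inner_neg_right, inner_add_right, inner_add_right]
    simp_rw [e1]
    have i1 := hcs _ hHt
    have i2 := hcs _ (contDiff_curl (contDiff_curl hwt)).continuous
    have i3 := hcs _ hgp
    have i12 : Integrable (fun x => ⟪φ x, H t x⟫_ℝ + ⟪φ x, curl (curl (w t)) x⟫_ℝ) := i1.add i2
    rw [integral_neg, integral_add i12 i3, integral_add i1 i2,
      integral_inner_gradient_eq_zero hφ hc hdiv (hp t ht), add_zero,
      integral_inner_curl_eq hφ hc (contDiff_curl hwt)]
  · filter_upwards [isOpen_Ioo.mem_nhds ht] with s hs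
    exact (hcs _ (contDiff_slice hw hs).continuous).aestronglyMeasurable
  · exact hcs _ hwt.continuous
  · have : Continuous (fun x => deriv (fun s => w s x) t) := by
      have := (continuousOn_time_deriv hw).comp (f := fun x : E3 => (t, x)) (s := univ)
        (by fun_prop) (fun x _ => ⟨ht, mem_univ _⟩)
      rw [← continuousOn_univ]; exact this
    exact (hcs _ this).aestronglyMeasurable
  · refine Eventually.of_forall fun x s hs => ?_
    refine (norm_inner_le_norm _ _).trans ?_
    by_cases hx : x ∈ tsupport φ
    · gcongr
      exact (hC (s, x) ⟨hs, hx⟩).trans (le_abs_self C)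
    · simp [image_eq_zero_of_notMem_tsupport hx]
  · exact (hφ.continuous.norm.mul continuous_const).integrable_of_hasCompactSupport
      (hc.norm.mul_right)
  · refine Eventually.of_forall fun x s hs => ?_
    have := hasDerivAt_time hw (hsub hs) x
    have h2 := (hasDerivAt_const s (φ x)).inner ℝ this
    rw [this.deriv]
    simpa using h2

theorem continuousOn_pairing (h : IsSmoothEvolution T w H w₀) {φ : E3 → E3}
    (hφ : Continuous φ) (hc : HasCompactSupport φ) :
    ContinuousOn (fun t => ∫ x, ⟪φ x, w t x⟫_ℝ) (Ico 0 T) := by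
  refine continuousOn_integral_of_compact_support (k := tsupport φ) hc ?_ ?_
  · exact ContinuousOn.inner (hφ.comp continuous_snd).continuousOn h.smooth.continuousOn
  · intro t x _ hx
    simp [image_eq_zero_of_notMem_tsupport hx]

/-- The fundamental theorem of calculus for θ(t)∫φ·w(t) on [0,S]. The pairing is differentiable only
for t > 0, but continuous up to t = 0, and its derivative is integrable by the L² bounds on H and
curl w. -/
theorem weakTested_of_hasCompactSupport (h : IsSmoothEvolution T w H w₀) {S : ℝ} (hS : 0 < S)
    (hST : S < T) {φ : E3 → E3} (hφ : ContDiff ℝ ∞ φ) (hc : HasCompactSupport φ)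
    (hdiv : ∀ x, divergence φ x = 0) : WeakTested S w H w₀ φ (curl φ) := by
  intro θ hθ
  have hcc : HasCompactSupport (curl φ) := (hc.fderiv ℝ).comp_left (g := curlL) (map_zero _)
  have hφ2 : MemLp φ 2 volume := hφ.continuous.memLp_of_hasCompactSupport hc
  have hcφ2 : MemLp (curl φ) 2 volume :=
    (contDiff_curl hφ).continuous.memLp_of_hasCompactSupport hcc
  set f : ℝ → ℝ := fun t => ∫ x, ⟪φ x, w t x⟫_ℝ with hf
  set N : ℝ → ℝ := fun t => (∫ x, ⟪φ x, H t x⟫_ℝ) + ∫ x, ⟪curl φ x, curl (w t) x⟫_ℝ with hN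
  have hNi : Integrable N (timeMeasure S) :=
    (integrable_pairing hφ2 (h.forcing_memLp S hS hST)).add
      (integrable_pairing hcφ2 (h.curl_memLp hS hST))
  have hfi : Integrable f (timeMeasure S) := integrable_pairing hφ2 (h.memLp hS hST)
  have hcont : ContinuousOn (fun t => θ t * f t) (Icc 0 S) :=
    hθ.contDiff.continuous.continuousOn.mul ((h.continuousOn_pairing hφ.continuous hc).mono
      fun t ht => ⟨ht.1, ht.2.trans_lt hST⟩)
  have hderiv : ∀ t ∈ Ioo 0 S, HasDerivAt (fun t => θ t * f t)
      (deriv θ t * f t - θ t * N t) t := by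
    intro t ht
    have h1 := (hθ.contDiff.differentiable (by simp) t).hasDerivAt
    have h2 := h.hasDerivAt_pairing hφ hc hdiv (t := t) ⟨ht.1, ht.2.trans hST⟩
    have h3 := h1.mul h2
    refine h3.congr_deriv ?_
    simp only [hN, hf]
    ring
  have hint : IntervalIntegrable (fun t => deriv θ t * f t - θ t * N t) volume 0 S := by
    rw [intervalIntegrable_iff_integrableOn_Ioo_of_le hS.le]
    exact (hθ.isWeight_deriv.integrable_mul hfi).sub (hθ.isWeight.integrable_mul hNi)
  have key := intervalIntegral.integral_eq_sub_of_hasDerivAt_of_le hS.le hcont hderiv hint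
  rw [intervalIntegral.integral_of_le hS.le, integral_Ioc_eq_integral_Ioo] at key
  have hθS : θ S = 0 :=
    image_eq_zero_of_notMem_tsupport fun h => lt_irrefl _ (show S < S from hθ.support h)
  have hf0 : f 0 = ∫ x, ⟪φ x, w₀ x⟫_ℝ := by
    simp only [hf, h.smooth.initial]
  rw [hθS, hf0] at key
  change (∫ t in Ioo 0 S, (deriv θ t * f t - θ t * N t)) + θ 0 * ∫ x, ⟪φ x, w₀ x⟫_ℝ = 0
  rw [key]
  ring

theorem weakTested_of_contDiff (h : IsSmoothEvolution T w H w₀) {S : ℝ} (hS : 0 < S)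
    (hST : S < T) {φ : E3 → E3} (hφ : ContDiff ℝ ∞ φ) (hdiv : ∀ x, divergence φ x = 0)
    (h2 : MemLp φ 2 volume) (hg : MemLp (fderiv ℝ φ) 2 volume) :
    WeakTested S w H w₀ φ (curl φ) := by
  obtain ⟨ψ, hψ⟩ := exists_solenoidalApprox hφ hdiv h2 hg
  obtain ⟨C₁, hC₁⟩ := hψ.norm_sq
  obtain ⟨C₂, hC₂⟩ := hψ.fderiv_norm_sq
  have hcc : ∀ n, HasCompactSupport (curl (ψ n)) := fun n =>
    ((hψ.compact n).fderiv ℝ).comp_left (g := curlL) (map_zero _)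
  have hfd2 : ∀ n, MemLp (fderiv ℝ (ψ n)) 2 volume := fun n =>
    ((hψ.contDiff n).continuous_fderiv (by simp)).memLp_of_hasCompactSupport
      ((hψ.compact n).fderiv ℝ)
  have hc2 : ∀ n, MemLp (curl (ψ n)) 2 volume := fun n =>
    (contDiff_curl (hψ.contDiff n)).continuous.memLp_of_hasCompactSupport (hcc n)
  refine weakTested_of_tendsto (C := max C₁ (‖curlL‖ ^ 2 * C₂)) (h.memLp hS hST)
    (h.forcing_memLp S hS hST) (h.curl_memLp hS hST) h.initial_memLp
    (fun n => (hψ.contDiff n).continuous.memLp_of_hasCompactSupport (hψ.compact n)) hc2 h2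
    (curlL.comp_memLp' hg) (fun n => (hC₁ n).trans (le_max_left _ _)) (fun n => ?_)
    (Eventually.of_forall fun x => ?_) (Eventually.of_forall fun x => ?_)
    fun n => h.weakTested_of_hasCompactSupport hS hST (hψ.contDiff n) (hψ.compact n) (hψ.div n)
  · refine le_trans ?_ (le_max_right _ _)
    exact (integral_norm_curlOf_sq_le (hfd2 n)).trans
      (mul_le_mul_of_nonneg_left (hC₂ n) (by positivity))
  · refine tendsto_const_nhds.congr' ?_
    filter_upwards [hψ.eventuallyEq x] with n hn using hn.eq_of_nhds.symm
  · refine tendsto_const_nhds.congr' ?_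
    filter_upwards [hψ.eventuallyEq x] with n hn
    rw [curl, curl, hn.fderiv_eq]

/-- A smooth evolution may be tested with every solenoidal field in `H¹`. -/
theorem weakTested (h : IsSmoothEvolution T w H w₀) {S : ℝ} (hS : 0 < S)
    (hST : S < T) {V : E3 → E3} {G : E3 → E3 →L[ℝ] E3} (hV : MemH V)
    (hG : HasWeakGradient V G) (hG2 : MemLp G 2 volume) :
    WeakTested S w H w₀ V (fun x => curlOf (G x)) := by
  obtain ⟨φ, hφ, hdiv, h2, hg, hlim, hlimg⟩ := exists_smooth_approx hV hG hG2
  have hc2 : ∀ n, MemLp (curl (φ n)) 2 volume := fun n => curlL.comp_memLp' (hg n).1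
  refine weakTested_of_tendsto
    (C := max (∫ x, ‖V x‖ ^ 2) (‖curlL‖ ^ 2 * ∫ x, ‖G x‖ ^ 2)) (h.memLp hS hST)
    (h.forcing_memLp S hS hST) (h.curl_memLp hS hST) h.initial_memLp
    (fun n => (h2 n).1) hc2 hV.1
    (curlL.comp_memLp' hG2) (fun n => (h2 n).2.trans (le_max_left _ _)) (fun n => ?_)
    hlim ?_
    fun n => h.weakTested_of_contDiff hS hST (hφ n) (hdiv n) (h2 n).1 (hg n).1
  · refine le_trans ?_ (le_max_right _ _)
    exact (integral_norm_curlOf_sq_le (hg n).1).trans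
      (mul_le_mul_of_nonneg_left (hg n).2 (by positivity))
  · filter_upwards [hlimg] with x hx
    exact (curlL.continuous.tendsto _).comp hx

end IsSmoothEvolution

/-! ### Weak evolutions tested with bounded solenoidal fields -/

/-- Matrix fields depending on the derivatives of order one and two of a vector field. -/
structure IsLocalOperator (A : (E3 → E3) → E3 → E3 →L[ℝ] E3) : Prop where
  congr : ∀ {φ ψ : E3 → E3} {x : E3}, φ =ᶠ[𝓝 x] ψ → A φ x = A ψ x
  continuousOn : ∀ {T : ℝ} {w : ℝ → E3 → E3},
    ContDiffOn ℝ ∞ (Function.uncurry w) (Ioo 0 T ×ˢ univ) →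
      ContinuousOn (Function.uncurry fun t => A (w t)) (Ioo 0 T ×ˢ univ)
  bound : ∃ K, 0 ≤ K ∧ ∀ {φ : E3 → E3}, ContDiff ℝ ∞ φ → ∀ x,
    ‖A φ x‖ ≤ K * (‖iteratedFDeriv ℝ 1 φ x‖ + ‖iteratedFDeriv ℝ 2 φ x‖)

/-- Joint continuity, applied to the field that is constant in time, at time 1/2. -/
theorem IsLocalOperator.continuous {A : (E3 → E3) → E3 → E3 →L[ℝ] E3} (hA : IsLocalOperator A)
    {φ : E3 → E3} (hφ : ContDiff ℝ ∞ φ) : Continuous (A φ) := by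
  have h := hA.continuousOn (T := 1) (w := fun _ => φ) (hφ.comp contDiff_snd).contDiffOn
  have h2 := h.comp (f := fun x : E3 => ((1 / 2 : ℝ), x)) (s := univ) (by fun_prop)
    (fun x _ => ⟨⟨by norm_num, by norm_num⟩, mem_univ _⟩)
  rw [← continuousOn_univ]
  exact h2

theorem norm_fderiv_eq_iteratedFDeriv_one (φ : E3 → E3) (x : E3) :
    ‖fderiv ℝ φ x‖ = ‖iteratedFDeriv ℝ 1 φ x‖ := (norm_iteratedFDeriv_one _).symm

theorem norm_fderiv_fderiv_eq (φ : E3 → E3) (x : E3) :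
    ‖fderiv ℝ (fderiv ℝ φ) x‖ = ‖iteratedFDeriv ℝ 2 φ x‖ := by
  rw [← norm_iteratedFDeriv_one, norm_iteratedFDeriv_fderiv]

theorem isLocalOperator_fderiv : IsLocalOperator (fun φ => fderiv ℝ φ) where
  congr h := h.fderiv_eq
  continuousOn hw := (contDiffOn_spatial_fderiv hw).continuousOn
  bound := ⟨1, zero_le_one, fun {φ} _ x => by
    rw [norm_fderiv_eq_iteratedFDeriv_one, one_mul]
    exact le_add_of_nonneg_right (norm_nonneg _)⟩

theorem isLocalOperator_neg_fderiv : IsLocalOperator (fun φ x => - fderiv ℝ φ x) where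
  congr h := by rw [h.fderiv_eq]
  continuousOn hw := (contDiffOn_spatial_fderiv hw).continuousOn.neg
  bound := ⟨1, zero_le_one, fun {φ} _ x => by
    rw [norm_neg, norm_fderiv_eq_iteratedFDeriv_one, one_mul]
    exact le_add_of_nonneg_right (norm_nonneg _)⟩

/-- The coordinate form on which the polynomial verifications below rely. -/
theorem cross_apply (a b : E3) (i : Fin 3) :
    cross a b i = ![a 1 * b 2 - a 2 * b 1, a 2 * b 0 - a 0 * b 2, a 0 * b 1 - a 1 * b 0] i := by
  simp [cross, crossProduct]

/-- The linear dependence of `b ∧ c` on `c`, as a linear map in `b`. -/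
def crossL : E3 →L[ℝ] E3 →L[ℝ] E3 :=
  LinearMap.toContinuousLinearMap
    { toFun := fun c => LinearMap.toContinuousLinearMap
        { toFun := fun b => cross b c
          map_add' := fun a b => by
            ext i; fin_cases i <;> simp [cross_apply] <;> ring
          map_smul' := fun r b => by
            ext i; fin_cases i <;> simp [cross_apply] <;> ring }
      map_add' := fun a b => by
        ext v i; fin_cases i <;> simp [cross_apply] <;> ring
      map_smul' := fun r b => by
        ext v i; fin_cases i <;> simp [cross_apply] <;> ring }

theorem crossL_apply (c b : E3) : crossL c b = cross b c := rfl

theorem inner_cross_eq (a b c : E3) : ⟪cross a b, c⟫_ℝ = ⟪a, crossL c b⟫_ℝ := by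
  simp only [crossL_apply, inner_eq_coord, cross_apply, Matrix.cons_val_zero, Matrix.cons_val_one,
    Matrix.cons_val]
  ring

theorem contDiffOn_curl {T : ℝ} {w : ℝ → E3 → E3}
    (hw : ContDiffOn ℝ ∞ (Function.uncurry w) (Ioo 0 T ×ˢ univ)) :
    ContDiffOn ℝ ∞ (Function.uncurry fun t => curl (w t)) (Ioo 0 T ×ˢ univ) :=
  curlL.contDiff.comp_contDiffOn (contDiffOn_spatial_fderiv hw)

theorem isLocalOperator_cross_curl : IsLocalOperator (fun φ x => crossL (curl φ x)) where
  congr h := by simp only [curl, h.fderiv_eq]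
  continuousOn hw := crossL.continuous.comp_continuousOn (contDiffOn_curl hw).continuousOn
  bound := ⟨‖crossL‖ * ‖curlL‖, by positivity, fun {φ} _ x => by
    refine (crossL.le_opNorm _).trans ?_
    rw [mul_assoc]
    refine mul_le_mul_of_nonneg_left ?_ (norm_nonneg _)
    refine (norm_curlOf_le _).trans ?_
    rw [norm_fderiv_eq_iteratedFDeriv_one]
    exact mul_le_mul_of_nonneg_left (le_add_of_nonneg_right (norm_nonneg _)) (by positivity)⟩

theorem norm_fderiv_curl_le {φ : E3 → E3} (hφ : ContDiff ℝ ∞ φ) (x : E3) :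
    ‖fderiv ℝ (curl φ) x‖ ≤ ‖curlL‖ * ‖iteratedFDeriv ℝ 2 φ x‖ := by
  refine ContinuousLinearMap.opNorm_le_bound _ (by positivity) fun v => ?_
  rw [fderiv_curl hφ, ← norm_fderiv_fderiv_eq, mul_assoc]
  refine (norm_curlOf_le _).trans ?_
  exact mul_le_mul_of_nonneg_left (ContinuousLinearMap.le_opNorm _ _) (by positivity)

theorem isLocalOperator_fderiv_curl : IsLocalOperator (fun φ => fderiv ℝ (curl φ)) where
  congr {φ ψ x} h := by
    refine Filter.EventuallyEq.fderiv_eq ?_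
    filter_upwards [h.eventuallyEq_nhds] with y hy
    simp only [curl, hy.fderiv_eq]
  continuousOn hw := (contDiffOn_spatial_fderiv (contDiffOn_curl hw)).continuousOn
  bound := ⟨‖curlL‖, by positivity, fun {φ} hφ x => by
    refine (norm_fderiv_curl_le hφ x).trans ?_
    exact mul_le_mul_of_nonneg_left (le_add_of_nonneg_left (norm_nonneg _)) (by positivity)⟩

/-- Fluxes that are quadratic in given fields and linear in the derivatives of the test field. -/
structure Flux where
  (left₁ right₁ left₂ right₂ : ℝ → E3 → E3)
  (op₁ op₂ : (E3 → E3) → E3 → E3 →L[ℝ] E3)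

namespace Flux

variable (F : Flux)

/-- The value of the flux at time `t` on the test field `φ`. -/
def eval (t : ℝ) (φ : E3 → E3) : ℝ :=
  (∫ x, ⟪F.left₁ t x, F.op₁ φ x (F.right₁ t x)⟫_ℝ) +
    ∫ x, ⟪F.left₂ t x, F.op₂ φ x (F.right₂ t x)⟫_ℝ

/-- Fluxes with square integrable fields on `(0,S) × ℝ³` and local operators. -/
structure IsRegular (S : ℝ) : Prop where
  left₁ : MemLp (Function.uncurry F.left₁) 2 (slabMeasure S)
  right₁ : MemLp (Function.uncurry F.right₁) 2 (slabMeasure S)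
  left₂ : MemLp (Function.uncurry F.left₂) 2 (slabMeasure S)
  right₂ : MemLp (Function.uncurry F.right₂) 2 (slabMeasure S)
  op₁ : IsLocalOperator F.op₁
  op₂ : IsLocalOperator F.op₂

end Flux

theorem integrable_inner_apply {α : Type*} [MeasurableSpace α] {μ : Measure α} {C : ℝ}
    {V V' : α → E3} {L : α → E3 →L[ℝ] E3} (hV : MemLp V 2 μ) (hV' : MemLp V' 2 μ)
    (hL : AEStronglyMeasurable L μ) (hC : ∀ᵐ x ∂μ, ‖L x‖ ≤ C) :
    Integrable (fun x => ⟪V x, L x (V' x)⟫_ℝ) μ := by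
  have i1 := (memLp_two_iff_integrable_sq_norm hV.aestronglyMeasurable).1 hV
  have i2 := (memLp_two_iff_integrable_sq_norm hV'.aestronglyMeasurable).1 hV'
  refine ((i1.add i2).const_mul C).mono'
    (hV.aestronglyMeasurable.inner (aestronglyMeasurable_clm_apply hL hV'.aestronglyMeasurable)) ?_
  filter_upwards [hC] with x hx
  exact abs_inner_apply_le _ _ _ hx

theorem integrable_flux_term {S C : ℝ} {V V' : ℝ → E3 → E3} {L : E3 → E3 →L[ℝ] E3}
    (hV : MemLp (Function.uncurry V) 2 (slabMeasure S))
    (hV' : MemLp (Function.uncurry V') 2 (slabMeasure S)) (hL : Continuous L)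
    (hC : ∀ x, ‖L x‖ ≤ C) :
    Integrable (fun t => ∫ x, ⟪V t x, L x (V' t x)⟫_ℝ) (timeMeasure S) := by
  have : Integrable (fun z : ℝ × E3 => ⟪V z.1 z.2, L z.2 (V' z.1 z.2)⟫_ℝ) (slabMeasure S) :=
    integrable_inner_apply hV hV' (hL.comp continuous_snd).aestronglyMeasurable
      (Eventually.of_forall fun z => hC z.2)
  exact this.integral_prod_left

/-- Quadratic terms in the rough fields are only in L¹, so weak convergence of the test fields is
not enough. The operators are uniformly bounded and eventually equal to their limit at every point,
and dominated convergence applies. -/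
theorem tendsto_flux_term {S C : ℝ} {V V' : ℝ → E3 → E3} {L : ℕ → E3 → E3 →L[ℝ] E3}
    {L' : E3 → E3 →L[ℝ] E3} {ϑ : ℝ → ℝ} (hϑ : IsWeight S ϑ)
    (hV : MemLp (Function.uncurry V) 2 (slabMeasure S))
    (hV' : MemLp (Function.uncurry V') 2 (slabMeasure S)) (hL : ∀ n, Continuous (L n))
    (hC : ∀ n x, ‖L n x‖ ≤ C) (hlim : ∀ x, ∀ᶠ n in atTop, L n x = L' x) :
    Tendsto (fun n => ∫ t, ϑ t * (∫ x, ⟪V t x, L n x (V' t x)⟫_ℝ) ∂(timeMeasure S)) atTop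
      (𝓝 (∫ t, ϑ t * (∫ x, ⟪V t x, L' x (V' t x)⟫_ℝ) ∂(timeMeasure S))) := by
  obtain ⟨K, hK0, hK⟩ := hϑ.bounded
  have iV := integrable_integral_norm_sq hV
  have iV' := integrable_integral_norm_sq hV'
  refine tendsto_integral_of_dominated_convergence
    (fun t => K * (C * ((∫ x, ‖V t x‖ ^ 2) + ∫ x, ‖V' t x‖ ^ 2)))
    (fun n => (hϑ.integrable_mul
      (integrable_flux_term hV hV' (hL n) (hC n))).aestronglyMeasurable)
    (((iV.add iV').const_mul C).const_mul K) (fun n => ?_) ?_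
  · filter_upwards [ae_restrict_mem measurableSet_Ioo, memLp_slice hV, memLp_slice hV']
      with t ht h1 h2
    have i1 := (memLp_two_iff_integrable_sq_norm h1.aestronglyMeasurable).1 h1
    have i2 := (memLp_two_iff_integrable_sq_norm h2.aestronglyMeasurable).1 h2
    rw [norm_mul]
    refine mul_le_mul (hK t ht) ?_ (norm_nonneg _) hK0
    rw [← integral_add i1 i2, ← integral_const_mul]
    refine norm_integral_le_of_norm_le ((i1.add i2).const_mul C) ?_
    exact Eventually.of_forall fun x => abs_inner_apply_le _ _ _ (hC n x)
  · filter_upwards [memLp_slice hV, memLp_slice hV'] with t h1 h2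
    have i1 := (memLp_two_iff_integrable_sq_norm h1.aestronglyMeasurable).1 h1
    have i2 := (memLp_two_iff_integrable_sq_norm h2.aestronglyMeasurable).1 h2
    refine Tendsto.const_mul _ ?_
    refine tendsto_integral_of_dominated_convergence
      (fun x => C * (‖V t x‖ ^ 2 + ‖V' t x‖ ^ 2))
      (fun n => (integrable_inner_apply h1 h2 (hL n).aestronglyMeasurable
        (Eventually.of_forall (hC n))).aestronglyMeasurable)
      ((i1.add i2).const_mul C)
      (fun n => Eventually.of_forall fun x => abs_inner_apply_le _ _ _ (hC n x)) ?_
    refine Eventually.of_forall fun x => tendsto_const_nhds.congr' ?_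
    filter_upwards [hlim x] with n hn
    rw [hn]

/-- Weak solutions on `(0,S)` of `∂ₜ v + div F = Δ v` up to a gradient, with `v(0) = v₀`. -/
structure IsWeakEvolution (S : ℝ) (v : ℝ → E3 → E3) (G : ℝ → E3 → E3 →L[ℝ] E3) (F : Flux)
    (v₀ : E3 → E3) : Prop where
  energyClass : InEnergyClass S v G
  initial_memLp : MemLp v₀ 2 volume
  flux : F.IsRegular S
  weak : ∀ φ : E3 → E3, ContDiff ℝ ∞ φ → HasCompactSupport φ → (∀ x, divergence φ x = 0) →
    ∀ θ, IsTimeTest S θ →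
      (∫ t in Ioi (0 : ℝ), ∫ x, (deriv θ t * ⟪v t x, φ x⟫_ℝ +
        θ t * ⟪F.left₁ t x, F.op₁ φ x (F.right₁ t x)⟫_ℝ +
        θ t * ⟪F.left₂ t x, F.op₂ φ x (F.right₂ t x)⟫_ℝ +
        θ t * ⟪v t x, Laplacian.laplacian φ x⟫_ℝ)) + θ 0 * ∫ x, ⟪v₀ x, φ x⟫_ℝ = 0

/-- The weak form of the equation for the spatial test field `φ`. -/
def FluxTested (S : ℝ) (v : ℝ → E3 → E3) (G : ℝ → E3 → E3 →L[ℝ] E3) (F : Flux)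
    (v₀ φ : E3 → E3) : Prop :=
  ∀ θ, IsTimeTest S θ →
    ∫ t, (deriv θ t * (∫ x, ⟪v t x, φ x⟫_ℝ) +
      θ t * (F.eval t φ - ∫ x, ⟪curlOf (G t x), curl φ x⟫_ℝ)) ∂(timeMeasure S) +
      θ 0 * ∫ x, ⟪v₀ x, φ x⟫_ℝ = 0

namespace IsWeakEvolution

variable {S : ℝ} {v : ℝ → E3 → E3} {G : ℝ → E3 → E3 →L[ℝ] E3} {F : Flux} {v₀ : E3 → E3}

theorem exists_bound_of_hasCompactSupport {A : (E3 → E3) → E3 → E3 →L[ℝ] E3}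
    (hA : IsLocalOperator A) {φ : E3 → E3} (hφ : ContDiff ℝ ∞ φ) (hc : HasCompactSupport φ) :
    ∃ C, ∀ x, ‖A φ x‖ ≤ C := by
  obtain ⟨K, hK, hb⟩ := hA.bound
  obtain ⟨C₁, h1⟩ := (hc.iteratedFDeriv (𝕜 := ℝ) 1).exists_bound_of_continuous
    (hφ.continuous_iteratedFDeriv (by exact_mod_cast le_top))
  obtain ⟨C₂, h2⟩ := (hc.iteratedFDeriv (𝕜 := ℝ) 2).exists_bound_of_continuous
    (hφ.continuous_iteratedFDeriv ENat.LEInfty.out)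
  exact ⟨K * (C₁ + C₂), fun x => (hb hφ x).trans
    (mul_le_mul_of_nonneg_left (add_le_add (h1 x) (h2 x)) hK)⟩

/-- The time integral reduces to (0,S), as θ and θ' vanish from S on; for almost every t the four
terms are separately integrable in space and the Laplacian is rewritten with curls. -/
theorem fluxTested_of_hasCompactSupport (h : IsWeakEvolution S v G F v₀) {φ : E3 → E3}
    (hφ : ContDiff ℝ ∞ φ) (hc : HasCompactSupport φ) (hdiv : ∀ x, divergence φ x = 0) :
    FluxTested S v G F v₀ φ := by
  intro θ hθ
  have key := h.weak φ hφ hc hdiv θ hθ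
  refine Eq.trans ?_ key
  congr 1
  have hsub : ∫ t in Ioi (0 : ℝ), ∫ x, (deriv θ t * ⟪v t x, φ x⟫_ℝ +
        θ t * ⟪F.left₁ t x, F.op₁ φ x (F.right₁ t x)⟫_ℝ +
        θ t * ⟪F.left₂ t x, F.op₂ φ x (F.right₂ t x)⟫_ℝ +
        θ t * ⟪v t x, Laplacian.laplacian φ x⟫_ℝ) =
      ∫ t in Ioo 0 S, ∫ x, (deriv θ t * ⟪v t x, φ x⟫_ℝ +
        θ t * ⟪F.left₁ t x, F.op₁ φ x (F.right₁ t x)⟫_ℝ +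
        θ t * ⟪F.left₂ t x, F.op₂ φ x (F.right₂ t x)⟫_ℝ +
        θ t * ⟪v t x, Laplacian.laplacian φ x⟫_ℝ) := by
    refine setIntegral_eq_of_subset_of_forall_sdiff_eq_zero measurableSet_Ioi
      (fun t ht => ht.1) ?_
    rintro t ⟨ht0, ht⟩
    have htS : S ≤ t := by
      by_contra hlt
      exact ht ⟨ht0, not_le.1 hlt⟩
    have hns : t ∉ tsupport θ := fun hm => absurd (hθ.support hm) (not_lt.2 htS)
    have h0 : θ t = 0 := image_eq_zero_of_notMem_tsupport hns
    have h1 : deriv θ t = 0 := image_eq_zero_of_notMem_tsupport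
      fun hm => hns (tsupport_deriv_subset hm)
    simp [h0, h1]
  rw [hsub]
  refine integral_congr_ae ?_
  obtain ⟨C₁, hC₁⟩ := exists_bound_of_hasCompactSupport h.flux.op₁ hφ hc
  obtain ⟨C₂, hC₂⟩ := exists_bound_of_hasCompactSupport h.flux.op₂ hφ hc
  have hΔ : Continuous (Laplacian.laplacian φ) := by
    have : Laplacian.laplacian φ = fun x => - curl (curl φ) x :=
      funext fun x => laplacian_eq_neg_curl_curl hφ hdiv x
    rw [this]
    exact (contDiff_curl (contDiff_curl hφ)).continuous.neg
  have hΔc : HasCompactSupport (Laplacian.laplacian φ) := by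
    have : Laplacian.laplacian φ = fun x => - curl (curl φ) x :=
      funext fun x => laplacian_eq_neg_curl_curl hφ hdiv x
    rw [this]
    have h1 : HasCompactSupport (curl φ) := (hc.fderiv ℝ).comp_left (g := curlL) (map_zero _)
    have h2 : HasCompactSupport (curl (curl φ)) :=
      (h1.fderiv ℝ).comp_left (g := curlL) (map_zero _)
    exact h2.comp_left (g := fun y => - y) neg_zero
  filter_upwards [h.energyClass.mem_H, h.energyClass.weakGradient, memLp_slice h.flux.left₁,
    memLp_slice h.flux.right₁, memLp_slice h.flux.left₂, memLp_slice h.flux.right₂]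
    with t hH hG l1 r1 l2 r2
  have i1 : Integrable (fun x => deriv θ t * ⟪v t x, φ x⟫_ℝ) :=
    (integrable_inner_of_memLp hH.1 (hφ.continuous.memLp_of_hasCompactSupport hc)).const_mul _
  have i2 : Integrable (fun x => θ t * ⟪F.left₁ t x, F.op₁ φ x (F.right₁ t x)⟫_ℝ) :=
    (integrable_inner_apply l1 r1 (h.flux.op₁.continuous hφ).aestronglyMeasurable
      (Eventually.of_forall hC₁)).const_mul _
  have i3 : Integrable (fun x => θ t * ⟪F.left₂ t x, F.op₂ φ x (F.right₂ t x)⟫_ℝ) :=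
    (integrable_inner_apply l2 r2 (h.flux.op₂.continuous hφ).aestronglyMeasurable
      (Eventually.of_forall hC₂)).const_mul _
  have i4 : Integrable (fun x => θ t * ⟪v t x, Laplacian.laplacian φ x⟫_ℝ) :=
    (integrable_inner_of_memLp hH.1 (hΔ.memLp_of_hasCompactSupport hΔc)).const_mul _
  have i12 : Integrable (fun x => deriv θ t * ⟪v t x, φ x⟫_ℝ +
      θ t * ⟪F.left₁ t x, F.op₁ φ x (F.right₁ t x)⟫_ℝ) := i1.add i2
  have i123 : Integrable (fun x => deriv θ t * ⟪v t x, φ x⟫_ℝ +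
      θ t * ⟪F.left₁ t x, F.op₁ φ x (F.right₁ t x)⟫_ℝ +
      θ t * ⟪F.left₂ t x, F.op₂ φ x (F.right₂ t x)⟫_ℝ) := i12.add i3
  rw [integral_add i123 i4, integral_add i12 i3, integral_add i1 i2, integral_const_mul,
    integral_const_mul, integral_const_mul, integral_const_mul,
    integral_inner_laplacian_eq hG hH.2 hφ hc, Flux.eval]
  ring

/-- A weak evolution may be tested with smooth solenoidal fields in `H¹` having bounded derivatives
up to order two. -/
theorem fluxTested (h : IsWeakEvolution S v G F v₀) {φ : E3 → E3}
    (hφ : ContDiff ℝ ∞ φ) (hdiv : ∀ x, divergence φ x = 0) (h2 : MemLp φ 2 volume)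
    (hg : MemLp (fderiv ℝ φ) 2 volume)
    (hb : ∀ k ≤ 2, ∃ C, ∀ x, ‖iteratedFDeriv ℝ k φ x‖ ≤ C) : FluxTested S v G F v₀ φ := by
  obtain ⟨ψ, hψ⟩ := exists_solenoidalApprox hφ hdiv h2 hg
  obtain ⟨C, hC⟩ := hψ.norm_sq
  obtain ⟨C', hC'⟩ := hψ.fderiv_norm_sq
  obtain ⟨M₁, hM₁⟩ := hψ.bounded 1 fun i hi => hb i (hi.trans one_le_two)
  obtain ⟨M₂, hM₂⟩ := hψ.bounded 2 hb
  have opb : ∀ {A : (E3 → E3) → E3 → E3 →L[ℝ] E3}, IsLocalOperator A →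
      ∃ K, (∀ n x, ‖A (ψ n) x‖ ≤ K) ∧ ∀ x, ‖A φ x‖ ≤ K := by
    intro A hA
    obtain ⟨K, hK, hKb⟩ := hA.bound
    have hn : ∀ n x, ‖A (ψ n) x‖ ≤ K * (M₁ + M₂) := fun n x => (hKb (hψ.contDiff n) x).trans
      (mul_le_mul_of_nonneg_left (add_le_add (hM₁ n x) (hM₂ n x)) hK)
    refine ⟨K * (M₁ + M₂), hn, fun x => ?_⟩
    -- The limit inherits the bound by locality: near x the field φ coincides with some ψ n.
    obtain ⟨n, hn'⟩ := (hψ.eventuallyEq x).exists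
    rw [← hA.congr hn']
    exact hn n x
  have oplim : ∀ {A : (E3 → E3) → E3 → E3 →L[ℝ] E3}, IsLocalOperator A →
      ∀ x, ∀ᶠ n in atTop, A (ψ n) x = A φ x := by
    intro A hA x
    filter_upwards [hψ.eventuallyEq x] with n hn using hA.congr hn
  obtain ⟨K₁, hK₁, hK₁'⟩ := opb h.flux.op₁
  obtain ⟨K₂, hK₂, hK₂'⟩ := opb h.flux.op₂
  have hψ2 : ∀ n, MemLp (ψ n) 2 volume := fun n =>
    (hψ.contDiff n).continuous.memLp_of_hasCompactSupport (hψ.compact n)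
  have hfd2 : ∀ n, MemLp (fderiv ℝ (ψ n)) 2 volume := fun n =>
    ((hψ.contDiff n).continuous_fderiv (by simp)).memLp_of_hasCompactSupport
      ((hψ.compact n).fderiv ℝ)
  have hc2 : ∀ n, MemLp (curl (ψ n)) 2 volume := fun n => curlL.comp_memLp' (hfd2 n)
  have hcφ : MemLp (curl φ) 2 volume := curlL.comp_memLp' hg
  have hCc : ∀ n, ∫ x, ‖curl (ψ n) x‖ ^ 2 ≤ ‖curlL‖ ^ 2 * C' := by
    intro n
    exact (integral_norm_curlOf_sq_le (hfd2 n)).trans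
      (mul_le_mul_of_nonneg_left (hC' n) (by positivity))
  have hlim : ∀ᵐ x, Tendsto (fun n => ψ n x) atTop (𝓝 (φ x)) := by
    refine Eventually.of_forall fun x => tendsto_const_nhds.congr' ?_
    filter_upwards [hψ.eventuallyEq x] with n hn using hn.eq_of_nhds.symm
  have hlimc : ∀ᵐ x, Tendsto (fun n => curl (ψ n) x) atTop (𝓝 (curl φ x)) := by
    refine Eventually.of_forall fun x => tendsto_const_nhds.congr' ?_
    filter_upwards [hψ.eventuallyEq x] with n hn
    rw [curl, curl, hn.fderiv_eq]
  have hv := h.energyClass.memLp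
  have hcv := h.energyClass.curl_memLp
  intro θ hθ
  have split : ∀ {f : E3 → E3}, ContDiff ℝ ∞ f → MemLp f 2 volume → MemLp (curl f) 2 volume →
      (∀ x, ‖F.op₁ f x‖ ≤ K₁) → (∀ x, ‖F.op₂ f x‖ ≤ K₂) →
      ∫ t, (deriv θ t * (∫ x, ⟪v t x, f x⟫_ℝ) +
        θ t * (F.eval t f - ∫ x, ⟪curlOf (G t x), curl f x⟫_ℝ)) ∂(timeMeasure S) =
      ∫ t, deriv θ t * (∫ x, ⟪f x, v t x⟫_ℝ) ∂(timeMeasure S) +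
      (∫ t, θ t * (∫ x, ⟪F.left₁ t x, F.op₁ f x (F.right₁ t x)⟫_ℝ) ∂(timeMeasure S) +
       ∫ t, θ t * (∫ x, ⟪F.left₂ t x, F.op₂ f x (F.right₂ t x)⟫_ℝ) ∂(timeMeasure S)) -
        ∫ t, θ t * (∫ x, ⟪curl f x, curlOf (G t x)⟫_ℝ) ∂(timeMeasure S) := by
    intro f hf hf2 hcf b1 b2
    have i1 := hθ.isWeight_deriv.integrable_mul (integrable_pairing hf2 hv)
    have i2 := hθ.isWeight.integrable_mul
      (integrable_flux_term h.flux.left₁ h.flux.right₁ (h.flux.op₁.continuous hf) b1)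
    have i3 := hθ.isWeight.integrable_mul
      (integrable_flux_term h.flux.left₂ h.flux.right₂ (h.flux.op₂.continuous hf) b2)
    have i4 := hθ.isWeight.integrable_mul (integrable_pairing hcf hcv)
    have i23 : Integrable (fun t => θ t * (∫ x, ⟪F.left₁ t x, F.op₁ f x (F.right₁ t x)⟫_ℝ) +
        θ t * (∫ x, ⟪F.left₂ t x, F.op₂ f x (F.right₂ t x)⟫_ℝ)) (timeMeasure S) := i2.add i3
    have i123 : Integrable (fun t => deriv θ t * (∫ x, ⟪f x, v t x⟫_ℝ) +
        (θ t * (∫ x, ⟪F.left₁ t x, F.op₁ f x (F.right₁ t x)⟫_ℝ) +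
        θ t * (∫ x, ⟪F.left₂ t x, F.op₂ f x (F.right₂ t x)⟫_ℝ))) (timeMeasure S) := i1.add i23
    rw [← integral_add i2 i3, ← integral_add i1 i23, ← integral_sub i123 i4]
    refine integral_congr_ae (Eventually.of_forall fun t => ?_)
    simp only [Flux.eval, real_inner_comm (f _), real_inner_comm (curl f _)]
    ring
  have T1 := tendsto_weighted_pairing hθ.isWeight_deriv hv hψ2 h2 hC hlim
  have T2 := tendsto_flux_term hθ.isWeight h.flux.left₁ h.flux.right₁
    (fun n => h.flux.op₁.continuous (hψ.contDiff n)) hK₁ (oplim h.flux.op₁)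
  have T3 := tendsto_flux_term hθ.isWeight h.flux.left₂ h.flux.right₂
    (fun n => h.flux.op₂.continuous (hψ.contDiff n)) hK₂ (oplim h.flux.op₂)
  have T4 := tendsto_weighted_pairing hθ.isWeight hcv hc2 hcφ hCc hlimc
  have T5 := tendsto_integral_inner_of_bounded (l := atTop) h.initial_memLp h2
    (Eventually.of_forall hψ2) (Eventually.of_forall hC) hlim
  have lim := ((T1.add (T2.add T3)).sub T4).add (T5.const_mul (θ 0))
  rw [← split hφ h2 hcφ hK₁' hK₂'] at lim
  refine tendsto_nhds_unique lim ?_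
  refine tendsto_const_nhds.congr fun n => ?_
  rw [← split (hψ.contDiff n) (hψ2 n) (hc2 n) (hK₁ n) (hK₂ n)]
  exact (h.fluxTested_of_hasCompactSupport (hψ.contDiff n) (hψ.compact n) (hψ.div n) θ hθ).symm

end IsWeakEvolution

/-! ### The product rule in time -/

/-- The energy class bounds the L² norm at almost every time only. Such times are dense, w is
continuous, and Fatou's lemma carries the bound over to every time. -/
theorem IsSmoothField.exists_memLp_bound {T : ℝ} {w : ℝ → E3 → E3} {w₀ : E3 → E3}
    (h : IsSmoothField T w w₀) {S : ℝ} (hS : 0 < S) (hST : S < T) :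
    ∃ C : ℝ, ∀ s ∈ Ioo 0 S, MemLp (w s) 2 volume ∧ ∫ x, ‖w s x‖ ^ 2 ≤ C := by
  obtain ⟨C, hC⟩ := (h.energyClass S hS hST).bounded
  rw [ae_restrict_iff' measurableSet_Ioo] at hC
  have hcont : ∀ s ∈ Ioo 0 S, Continuous (w s) := fun s hs =>
    (contDiff_slice h.contDiffOn ⟨hs.1, hs.2.trans hST⟩).continuous
  have key : ∀ s ∈ Ioo 0 S, eLpNorm (w s) 2 volume ≤ C := by
    intro s hs
    have hcl := (Measure.dense_of_ae hC).open_subset_closure_inter isOpen_Ioo hs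
    obtain ⟨r, hr, hrs⟩ := mem_closure_iff_seq_limit.1 hcl
    have hlim : ∀ᵐ x, Tendsto (fun n => w (r n) x) atTop (𝓝 (w s x)) := by
      refine Eventually.of_forall fun x => ?_
      have h1 := (contDiffAt_slab h.contDiffOn (t := s) ⟨hs.1, hs.2.trans hST⟩ x).continuousAt
      exact h1.tendsto.comp (hrs.prodMk_nhds tendsto_const_nhds)
    refine (Lp.eLpNorm_lim_le_liminf_eLpNorm
      (fun n => (hcont _ (hr n).1).aestronglyMeasurable) _ hlim).trans ?_
    refine (liminf_le_liminf (v := fun _ => (C : ENNReal))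
      (Eventually.of_forall fun n => (hr n).2 (hr n).1)).trans ?_
    simp
  refine ⟨(C : ℝ) ^ 2, fun s hs => ?_⟩
  have hm : MemLp (w s) 2 volume :=
    ⟨(hcont s hs).aestronglyMeasurable, (key s hs).trans_lt ENNReal.coe_lt_top⟩
  exact ⟨hm, integral_norm_sq_le_of_eLpNorm_le hm (key s hs)⟩

/-- Continuity up to t = 0 is only pointwise; together with the uniform L² bound it gives weak
convergence to the initial field. -/
theorem IsSmoothField.tendsto_initial {T : ℝ} {w : ℝ → E3 → E3} {w₀ : E3 → E3}
    (h : IsSmoothField T w w₀) (hw₀ : MemLp w₀ 2 volume) {V : E3 → E3} (hV : MemLp V 2 volume)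
    (hT : 0 < T) :
    Tendsto (fun s => ∫ x, ⟪V x, w s x⟫_ℝ) (𝓝[>] 0) (𝓝 (∫ x, ⟪V x, w₀ x⟫_ℝ)) := by
  obtain ⟨C, hC⟩ := h.exists_memLp_bound (half_pos hT) (half_lt_self hT)
  have hev : ∀ᶠ s in 𝓝[>] (0 : ℝ), s ∈ Ioo 0 (T / 2) := Ioo_mem_nhdsGT (half_pos hT)
  refine tendsto_integral_inner_of_bounded hV hw₀ (hev.mono fun s hs => (hC s hs).1)
    (hev.mono fun s hs => (hC s hs).2) (Eventually.of_forall fun x => ?_)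
  have h1 : ContinuousWithinAt (Function.uncurry w) (Ico 0 T ×ˢ univ) (0, x) :=
    h.continuousOn _ ⟨⟨le_rfl, hT⟩, mem_univ _⟩
  have h2 : Tendsto (fun s : ℝ => (s, x)) (𝓝[>] 0) (𝓝[Ico 0 T ×ˢ univ] (0, x)) := by
    refine tendsto_nhdsWithin_iff.2 ⟨?_, ?_⟩
    · exact (tendsto_id.mono_left nhdsWithin_le_nhds).prodMk_nhds tendsto_const_nhds
    · filter_upwards [hev] with s hs
      exact ⟨⟨hs.1.le, by linarith [hs.2]⟩, mem_univ _⟩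
  have h3 := h1.tendsto.comp h2
  rw [← h.initial x]
  exact h3

/-- The product rule for `∫ v · w`, where `w` is a smooth evolution and `v` satisfies a weak
equation when tested with `w(s)`. -/
theorem cross_identity {S T : ℝ} (hS : 0 < S) (hST : S < T) {v : ℝ → E3 → E3}
    {G : ℝ → E3 → E3 →L[ℝ] E3} {v₀ : E3 → E3} (hv : InEnergyClass S v G)
    (hv₀ : MemLp v₀ 2 volume) {w H : ℝ → E3 → E3} {w₀ : E3 → E3}
    (hw : IsSmoothEvolution T w H w₀) {a : ℝ → ℝ → ℝ} (ha : DiagCont S a)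
    (h1 : ∀ᵐ s ∂(timeMeasure S), ∀ θ, IsTimeTest S θ →
      ∫ t, (deriv θ t * (∫ x, ⟪v t x, w s x⟫_ℝ) + θ t * a t s) ∂(timeMeasure S) +
        θ 0 * ∫ x, ⟪v₀ x, w s x⟫_ℝ = 0) :
    Integrable (fun r => a r r - ((∫ x, ⟪v r x, H r x⟫_ℝ) +
        ∫ x, ⟪curlOf (G r x), curl (w r) x⟫_ℝ)) (timeMeasure S) ∧
    ∀ᵐ t ∂(timeMeasure S), ∫ x, ⟪v t x, w t x⟫_ℝ = (∫ x, ⟪v₀ x, w₀ x⟫_ℝ) +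
      ∫ r in Ioc 0 t, (a r r - ((∫ x, ⟪v r x, H r x⟫_ℝ) +
        ∫ x, ⟪curlOf (G r x), curl (w r) x⟫_ℝ)) := by
  have hsub : Ioo 0 S ×ˢ (univ : Set E3) ⊆ Ioo 0 T ×ˢ univ :=
    prod_mono (Ioo_subset_Ioo_right hST.le) subset_rfl
  have hg : DiagCont S (fun t s => ∫ x, ⟪v t x, w s x⟫_ℝ) :=
    diagCont_inner hv.memLp (hw.memLp hS hST) (hw.smooth.contDiffOn.continuousOn.mono hsub)
  have hb : DiagCont S (fun t s => -((∫ x, ⟪v t x, H s x⟫_ℝ) +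
      ∫ x, ⟪curlOf (G t x), curl (w s) x⟫_ℝ)) :=
    ((diagCont_inner hv.memLp (hw.forcing_memLp S hS hST)
      (hw.forcing_continuousOn.mono hsub)).add
      (diagCont_inner hv.curl_memLp (hw.curl_memLp hS hST)
        ((contDiffOn_curl hw.smooth.contDiffOn).continuousOn.mono hsub))).neg
  have h2 : ∀ᵐ t ∂(timeMeasure S), ∀ ζ : ℝ → ℝ, ContDiff ℝ ∞ ζ → HasCompactSupport ζ →
      tsupport ζ ⊆ Ioo 0 S → ∫ s, (deriv ζ s * (∫ x, ⟪v t x, w s x⟫_ℝ) +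
        ζ s * (-((∫ x, ⟪v t x, H s x⟫_ℝ) + ∫ x, ⟪curlOf (G t x), curl (w s) x⟫_ℝ)))
        ∂(timeMeasure S) = 0 := by
    filter_upwards [hv.mem_H, hv.weakGradient, memLp_slice hv.gradient_memLp_slab]
      with t hH hG hG2 ζ hζ hc hs
    -- For almost every t the field v(t) is solenoidal and in H¹, hence an admissible test field.
    -- The test function ζ vanishes at 0, so no initial term appears.
    have key := hw.weakTested hS hST hH hG hG2 ζ ⟨hζ, hc, hs.trans fun t ht => ht.2⟩
    have h0 : ζ 0 = 0 := image_eq_zero_of_notMem_tsupport fun hm => lt_irrefl _ (hs hm).1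
    rw [h0, zero_mul, add_zero] at key
    rw [← key]
    refine integral_congr_ae (Eventually.of_forall fun s => ?_)
    simp only
    ring
  have hd := diagonal_identity hS hg ha hb (integrable_pairing hv₀ (hw.memLp hS hST)) h1 h2
    (hw.smooth.tendsto_initial hw.initial_memLp hv₀ (hS.trans hST))
  have hN := (ha.add hb).diag_integrable
  have := ae_eq_primitive hg.diag_integrable hN hd
  simp only [← sub_eq_add_neg] at hN this
  exact ⟨hN, this⟩

/-- Each of the two equations contributes one copy of the dissipation ∫ curl v · curl w, whence the
factor 2. The bounds on first and second derivatives of w make w(s) an admissible test field for v.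
-/
theorem IsWeakEvolution.cross_identity {S T : ℝ} (hS : 0 < S) (hST : S < T) {v : ℝ → E3 → E3}
    {G : ℝ → E3 → E3 →L[ℝ] E3} {F : Flux} {v₀ : E3 → E3} (hv : IsWeakEvolution S v G F v₀)
    {w H : ℝ → E3 → E3} {w₀ : E3 → E3} (hw : IsSmoothEvolution T w H w₀) :
    Integrable (fun r => F.eval r (w r) - (∫ x, ⟪v r x, H r x⟫_ℝ) -
        2 * ∫ x, ⟪curlOf (G r x), curl (w r) x⟫_ℝ) (timeMeasure S) ∧
    ∀ᵐ t ∂(timeMeasure S), ∫ x, ⟪v t x, w t x⟫_ℝ = (∫ x, ⟪v₀ x, w₀ x⟫_ℝ) +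
      ∫ r in Ioc 0 t, (F.eval r (w r) - (∫ x, ⟪v r x, H r x⟫_ℝ) -
        2 * ∫ x, ⟪curlOf (G r x), curl (w r) x⟫_ℝ) := by
  have hsub : Ioo 0 S ×ˢ (univ : Set E3) ⊆ Ioo 0 T ×ˢ univ :=
    prod_mono (Ioo_subset_Ioo_right hST.le) subset_rfl
  have hsm : ∀ s ∈ Ioo 0 S, ContDiff ℝ ∞ (w s) := fun s hs =>
    contDiff_slice hw.smooth.contDiffOn ⟨hs.1, hs.2.trans hST⟩
  obtain ⟨M₁, hM₁⟩ := hw.smooth.bounded S hS hST 1 one_le_two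
  obtain ⟨M₂, hM₂⟩ := hw.smooth.bounded S hS hST 2 le_rfl
  have opb : ∀ {A : (E3 → E3) → E3 → E3 →L[ℝ] E3}, IsLocalOperator A →
      ∃ C, ∀ t ∈ Ioo 0 S, ∀ x, ‖A (w t) x‖ ≤ C := by
    intro A hA
    obtain ⟨K, hK, hb⟩ := hA.bound
    exact ⟨K * (M₁ + M₂), fun t ht x => (hb (hsm t ht) x).trans
      (mul_le_mul_of_nonneg_left (add_le_add (hM₁ t ht x) (hM₂ t ht x)) hK)⟩
  obtain ⟨C₁, hC₁⟩ := opb hv.flux.op₁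
  obtain ⟨C₂, hC₂⟩ := opb hv.flux.op₂
  have ha : DiagCont S (fun t s => F.eval t (w s) - ∫ x, ⟪curlOf (G t x), curl (w s) x⟫_ℝ) :=
    ((diagCont_inner_apply hv.flux.left₁ hv.flux.right₁
        ((hv.flux.op₁.continuousOn hw.smooth.contDiffOn).mono hsub) hC₁).add
      (diagCont_inner_apply hv.flux.left₂ hv.flux.right₂
        ((hv.flux.op₂.continuousOn hw.smooth.contDiffOn).mono hsub) hC₂)).sub
      (diagCont_inner hv.energyClass.curl_memLp (hw.curl_memLp hS hST)
        ((contDiffOn_curl hw.smooth.contDiffOn).continuousOn.mono hsub))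
  have hwE := hw.smooth.energyClass S hS hST
  have h1 : ∀ᵐ s ∂(timeMeasure S), FluxTested S v G F v₀ (w s) := by
    filter_upwards [ae_restrict_mem measurableSet_Ioo, hwE.mem_H,
      memLp_slice hwE.gradient_memLp_slab] with s hs hH hg
    refine hv.fluxTested (hsm s hs) (hw.div s ⟨hs.1, hs.2.trans hST⟩) hH.1 hg fun k hk => ?_
    obtain ⟨C, hC⟩ := hw.smooth.bounded S hS hST k hk
    exact ⟨C, hC s hs⟩
  have heq : ∀ r, F.eval r (w r) - (∫ x, ⟪v r x, H r x⟫_ℝ) -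
      2 * ∫ x, ⟪curlOf (G r x), curl (w r) x⟫_ℝ =
      F.eval r (w r) - (∫ x, ⟪curlOf (G r x), curl (w r) x⟫_ℝ) -
        ((∫ x, ⟪v r x, H r x⟫_ℝ) + ∫ x, ⟪curlOf (G r x), curl (w r) x⟫_ℝ) := fun r => by ring
  simp only [heq]
  exact HallMHD.cross_identity hS hST hv.energyClass hv.initial_memLp hw ha h1

/-- The same product rule with v = w: the equation of w tested with w(s) serves as the equation in
t. The detour is needed because ∂ₜw is not assumed square integrable. -/
theorem IsSmoothEvolution.energy_identity {S T : ℝ} (hS : 0 < S) (hST : S < T)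
    {w H : ℝ → E3 → E3} {w₀ : E3 → E3} (hw : IsSmoothEvolution T w H w₀) :
    Integrable (fun r => -2 * (∫ x, ⟪w r x, H r x⟫_ℝ) -
        2 * ∫ x, ⟪curl (w r) x, curl (w r) x⟫_ℝ) (timeMeasure S) ∧
    ∀ᵐ t ∂(timeMeasure S), ∫ x, ⟪w t x, w t x⟫_ℝ = (∫ x, ⟪w₀ x, w₀ x⟫_ℝ) +
      ∫ r in Ioc 0 t, (-2 * (∫ x, ⟪w r x, H r x⟫_ℝ) -
        2 * ∫ x, ⟪curl (w r) x, curl (w r) x⟫_ℝ) := by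
  have hsub : Ioo 0 S ×ˢ (univ : Set E3) ⊆ Ioo 0 T ×ˢ univ :=
    prod_mono (Ioo_subset_Ioo_right hST.le) subset_rfl
  have hwE := hw.smooth.energyClass S hS hST
  have ha : DiagCont S (fun t s => -((∫ x, ⟪H t x, w s x⟫_ℝ) +
      ∫ x, ⟪curl (w t) x, curl (w s) x⟫_ℝ)) :=
    ((diagCont_inner (hw.forcing_memLp S hS hST) (hw.memLp hS hST)
      (hw.smooth.contDiffOn.continuousOn.mono hsub)).add
      (diagCont_inner (hw.curl_memLp hS hST) (hw.curl_memLp hS hST)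
        ((contDiffOn_curl hw.smooth.contDiffOn).continuousOn.mono hsub))).neg
  have h1 : ∀ᵐ s ∂(timeMeasure S), ∀ θ, IsTimeTest S θ →
      ∫ t, (deriv θ t * (∫ x, ⟪w t x, w s x⟫_ℝ) + θ t * (-((∫ x, ⟪H t x, w s x⟫_ℝ) +
        ∫ x, ⟪curl (w t) x, curl (w s) x⟫_ℝ))) ∂(timeMeasure S) +
        θ 0 * ∫ x, ⟪w₀ x, w s x⟫_ℝ = 0 := by
    filter_upwards [hwE.mem_H, hwE.weakGradient, memLp_slice hwE.gradient_memLp_slab]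
      with s hH hG hG2 θ hθ
    have key := hw.weakTested hS hST hH hG hG2 θ hθ
    refine Eq.trans ?_ key
    simp only [real_inner_comm (w s _)]
    congr 1
    refine integral_congr_ae (Eventually.of_forall fun t => ?_)
    simp only [curl, real_inner_comm (curlOf (fderiv ℝ (w s) _))]
    ring
  have heq : ∀ r, -2 * (∫ x, ⟪w r x, H r x⟫_ℝ) - 2 * ∫ x, ⟪curl (w r) x, curl (w r) x⟫_ℝ =
      -((∫ x, ⟪H r x, w r x⟫_ℝ) + ∫ x, ⟪curl (w r) x, curl (w r) x⟫_ℝ) -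
        ((∫ x, ⟪w r x, H r x⟫_ℝ) + ∫ x, ⟪curlOf (fderiv ℝ (w r) x), curl (w r) x⟫_ℝ) := by
    intro r
    simp only [real_inner_comm (w r _), curl]
    ring
  simp only [heq]
  exact cross_identity hS hST hwE hw.initial_memLp hw ha h1

/-! ### Vector calculus identities -/

theorem divTensor_eq {a b : E3 → E3} (ha : ContDiff ℝ ∞ a) (hb : ContDiff ℝ ∞ b)
    (hdiv : ∀ x, divergence b x = 0) (x : E3) : divTensor a b x = fderiv ℝ a x (b x) := by
  have h1 : ∀ j, fderiv ℝ (fun y => (b y) j • a y) x (e j) =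
      b x j • fderiv ℝ a x (e j) + (fderiv ℝ b x (e j)) j • a x := by
    intro j
    rw [fderiv_fun_smul ((contDiff_coord hb j).differentiable (by simp) x)
      (ha.differentiable (by simp) x)]
    simp [fderiv_coord hb]
  rw [divTensor, Finset.sum_congr rfl fun j _ => h1 j, Finset.sum_add_distrib, ← Finset.sum_smul]
  have h2 : ∑ j, (fderiv ℝ b x (e j)) j = 0 := hdiv x
  rw [h2, zero_smul, add_zero, map_eq_sum_e (fderiv ℝ a x) (b x), Fin.sum_univ_three]

/-- The pointwise form of curl (u ∧ B) = (B·∇)u - (u·∇)B; the remaining terms u div B - B div u are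
the two traces. -/
theorem curlOf_cross (L M : E3 →L[ℝ] E3) (u B : E3) (hL : divL L = 0) (hM : divL M = 0)
    {K : E3 →L[ℝ] E3} (hK : ∀ v, K v = cross (L v) B + cross u (M v)) :
    curlOf K = L B - M u := by
  rw [divL_apply, Fin.sum_univ_three] at hL hM
  rw [map_eq_sum_e L B, map_eq_sum_e M u]
  ext i
  fin_cases i <;> simp [curlOf_apply, hK, cross_apply]
  · linear_combination (-B 0) * hL + u 0 * hM
  · linear_combination (-B 1) * hL + u 1 * hM
  · linear_combination (-B 2) * hL + u 2 * hM

theorem curl_cross {u B : E3 → E3} (hu : ContDiff ℝ ∞ u) (hB : ContDiff ℝ ∞ B)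
    (du : ∀ x, divergence u x = 0) (dB : ∀ x, divergence B x = 0) (x : E3) :
    curl (fun y => cross (u y) (B y)) x = fderiv ℝ u x (B x) - fderiv ℝ B x (u x) := by
  have h : HasFDerivAt (fun y => crossL (B y) (u y)) _ x :=
    ((crossL.hasFDerivAt.comp x (hB.differentiable (by simp) x).hasFDerivAt)).clm_apply
      (hu.differentiable (by simp) x).hasFDerivAt
  refine curlOf_cross _ _ _ _ (by rw [← divergence_eq]; exact du x)
    (by rw [← divergence_eq]; exact dB x) fun v => ?_
  have h2 := h.fderiv
  simp only [crossL_apply] at h2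
  rw [h2]
  simp [crossL_apply]

/-- For every 3 × 3 matrix M with curl J, the curl of M² is (tr M) J - M J. This is the algebra of
vortex stretching. -/
theorem curlOf_comp_self (M : E3 →L[ℝ] E3) (hM : divL M = 0) :
    curlOf (M.comp M) = - M (curlOf M) := by
  rw [divL_apply, Fin.sum_univ_three] at hM
  rw [map_eq_sum_e M (curlOf M)]
  ext i
  fin_cases i <;> simp [curlOf_apply]
  · rw [map_eq_sum_e M (M (e 1)), map_eq_sum_e M (M (e 2))]
    simp
    linear_combination ((M (e 1)) 2 - (M (e 2)) 1) * hM
  · rw [map_eq_sum_e M (M (e 2)), map_eq_sum_e M (M (e 0))]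
    simp
    linear_combination ((M (e 2)) 0 - (M (e 0)) 2) * hM
  · rw [map_eq_sum_e M (M (e 0)), map_eq_sum_e M (M (e 1))]
    simp
    linear_combination ((M (e 0)) 1 - (M (e 1)) 0) * hM

/-- Differentiating (B·∇)B gives a second-order term, whose curl is (B·∇) curl B, and the square of
the Jacobian matrix, whose curl is -(curl B·∇)B. -/
theorem curl_divTensor_self {B : E3 → E3} (hB : ContDiff ℝ ∞ B)
    (dB : ∀ x, divergence B x = 0) (x : E3) :
    curl (divTensor B B) x = fderiv ℝ (curl B) x (B x) - fderiv ℝ B x (curl B x) := by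
  have h0 : divTensor B B = fun y => fderiv ℝ B y (B y) := funext (divTensor_eq hB hB dB)
  have h1 := ((contDiff_fderiv hB).differentiable (by simp) x).hasFDerivAt.clm_apply
    (hB.differentiable (by simp) x).hasFDerivAt
  have h2 : fderiv ℝ (divTensor B B) x =
      fderiv ℝ (fderiv ℝ B) x (B x) + (fderiv ℝ B x).comp (fderiv ℝ B x) := by
    rw [h0, h1.fderiv]
    ext1 v
    simp only [add_apply, ContinuousLinearMap.flip_apply, ContinuousLinearMap.comp_apply]
    rw [fderiv_fderiv_symm hB, add_comm]
  rw [fderiv_curl hB, curl, h2, ← curlL_apply, map_add, curlL_apply, curlL_apply,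
    curlOf_comp_self _ (by rw [← divergence_eq]; exact dB x), curl, sub_eq_add_neg]

theorem divergence_curl {B : E3 → E3} (hB : ContDiff ℝ ∞ B) (x : E3) :
    divergence (curl B) x = 0 := by
  rw [divergence, Fin.sum_univ_three]
  simp only [fderiv_curl hB, curlOf_apply]
  simp
  rw [fderiv_fderiv_symm hB x (e 1) (e 0), fderiv_fderiv_symm hB x (e 2) (e 0),
    fderiv_fderiv_symm hB x (e 2) (e 1)]
  ring

/-- The pointwise algebra behind the relative energy inequality: `L`, `M`, `N` stand for the
gradients of `u`, `B` and `curl B`. -/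
theorem relative_energy_algebra (L M N : E3 →L[ℝ] E3) (u B u' B' J : E3) (hJ : J = curlOf M) :
    (-⟪u, L u - M B⟫_ℝ - ⟪B, -(L B - M u) + (N B - M J)⟫_ℝ) -
      (⟪u', L u'⟫_ℝ - ⟪B', L B'⟫_ℝ + ⟪u', crossL J B'⟫_ℝ + ⟪B', N B'⟫_ℝ
        - ⟪u', L u - M B⟫_ℝ - ⟪B', -(L B - M u) + (N B - M J)⟫_ℝ) =
    -(⟪u' - u, L (u' - u)⟫_ℝ - ⟪B' - B, L (B' - B)⟫_ℝ + ⟪u' - u, crossL J (B' - B)⟫_ℝ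
        + ⟪B' - B, N (B' - B)⟫_ℝ)
      - ⟪u, L u'⟫_ℝ - ⟪B, M u'⟫_ℝ + ⟪L B', B⟫_ℝ + ⟪u, M B'⟫_ℝ
      - ⟪M B', J⟫_ℝ - ⟪B, N B'⟫_ℝ + ⟪B, M J⟫_ℝ := by
  -- The entries of J are those of the antisymmetric part of M. Through them the mixed terms
  -- containing J become terms in M, and the identity is polynomial in the entries.
  have hJ0 : J 0 = (M (e 1)) 2 - (M (e 2)) 1 := by rw [hJ, curlOf_apply]; rfl
  have hJ1 : J 1 = (M (e 2)) 0 - (M (e 0)) 2 := by rw [hJ, curlOf_apply]; rfl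
  have hJ2 : J 2 = (M (e 0)) 1 - (M (e 1)) 0 := by rw [hJ, curlOf_apply]; rfl
  simp only [map_sub, crossL_apply]
  rw [map_eq_sum_e L u, map_eq_sum_e L B, map_eq_sum_e L u', map_eq_sum_e L B',
    map_eq_sum_e M u, map_eq_sum_e M B, map_eq_sum_e M u', map_eq_sum_e M B',
    map_eq_sum_e N B, map_eq_sum_e N B', map_eq_sum_e M J]
  simp only [inner_eq_coord, cross_apply, PiLp.add_apply, PiLp.sub_apply, PiLp.neg_apply,
    PiLp.smul_apply, smul_eq_mul, Matrix.cons_val_zero, Matrix.cons_val_one, Matrix.cons_val]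
  rw [hJ0, hJ1, hJ2]
  ring

/-! ### Solenoidal fields are orthogonal to gradients -/

theorem weakDivFree_of_contDiff {v : E3 → E3} (hv : ContDiff ℝ ∞ v)
    (hdiv : ∀ x, divergence v x = 0) : WeakDivFree v := by
  intro ψ hψ hc
  have hi : ∀ j, Integrable (fun x => fderiv ℝ ψ x (e j) * v x j) := fun j =>
    integrable_of_hasCompactSupport_left ((hψ.continuous_fderiv (by simp)).clm_apply
      continuous_const) (contDiff_coord hv j).continuous (hc.fderiv_apply ℝ (e j))
  have hi' : ∀ j, Integrable (fun x => ψ x * fderiv ℝ (fun y => v y j) x (e j)) := fun j =>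
    integrable_of_hasCompactSupport_left hψ.continuous
      (((contDiff_coord hv j).continuous_fderiv (by simp)).clm_apply continuous_const) hc
  have h1 : ∀ j, ∫ x, fderiv ℝ ψ x (e j) * v x j =
      - ∫ x, ψ x * fderiv ℝ (fun y => v y j) x (e j) := by
    intro j
    rw [integral_mul_fderiv_of_hasCompactSupport hψ hc (contDiff_coord hv j), neg_neg]
  calc ∫ x, fderiv ℝ ψ x (v x) = ∫ x, ∑ j, fderiv ℝ ψ x (e j) * v x j := by
        refine integral_congr_ae (Eventually.of_forall fun x => ?_)
        simp only
        rw [fderiv_apply_eq_sum, Fin.sum_univ_three]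
        ring
    _ = - ∫ x, ∑ j, ψ x * fderiv ℝ (fun y => v y j) x (e j) := by
        rw [integral_finsetSum _ fun j _ => hi j, integral_finsetSum _ fun j _ => hi' j,
          ← Finset.sum_neg_distrib]
        exact Finset.sum_congr rfl fun j _ => h1 j
    _ = 0 := by
        have : ∀ x, ∑ j, ψ x * fderiv ℝ (fun y => v y j) x (e j) = 0 := by
          intro x
          rw [← Finset.mul_sum]
          have h2 : ∑ j, fderiv ℝ (fun y => v y j) x (e j) = 0 := by
            simp only [fderiv_coord hv]
            exact hdiv x
          rw [h2, mul_zero]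
        simp [this]

/-- The standard cutoff function. -/
def cutoff (x : E3) : ℝ := profile (‖x‖ ^ 2)

theorem contDiff_cutoff : ContDiff ℝ ∞ cutoff := contDiff_profile.comp (contDiff_norm_sq ℝ)

theorem cutoff_eventuallyEq {x : E3} (h : ‖x‖ < 1) : cutoff =ᶠ[𝓝 x] fun _ => 1 := by
  filter_upwards [(isOpen_lt continuous_norm continuous_const).mem_nhds h] with y hy
  exact profile_of_lt_one (by nlinarith [norm_nonneg y, show ‖y‖ < 1 from hy])

theorem hasCompactSupport_cutoff : HasCompactSupport cutoff := by
  refine HasCompactSupport.intro (isCompact_closedBall (0 : E3) 2) fun x hx => ?_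
  refine profile_of_two_lt ?_
  rw [Metric.mem_closedBall, dist_zero_right, not_le] at hx
  nlinarith

/-- The product of π with a cut-off χ is a test function for the weak divergence. The error π v·∇χ
is dominated by a multiple of |π||v| and tends pointwise to 0 as the cut-off widens. -/
theorem integral_fderiv_apply_eq_zero {v : E3 → E3} (hv : MemH v) {π : E3 → ℝ}
    (hπ : ContDiff ℝ ∞ π) (h2 : MemLp π 2 volume) (hg : MemLp (fderiv ℝ π) 2 volume) :
    Integrable (fun x => fderiv ℝ π x (v x)) ∧ ∫ x, fderiv ℝ π x (v x) = 0 := by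
  have i1 : Integrable (fun x => ‖fderiv ℝ π x‖ * ‖v x‖) := hg.norm.integrable_mul hv.1.norm
  have i2 : Integrable (fun x => ‖π x‖ * ‖v x‖) := h2.norm.integrable_mul hv.1.norm
  have hm : AEStronglyMeasurable (fun x => fderiv ℝ π x (v x)) volume :=
    aestronglyMeasurable_clm_apply hg.aestronglyMeasurable hv.1.aestronglyMeasurable
  have hi : Integrable (fun x => fderiv ℝ π x (v x)) :=
    i1.mono' hm (Eventually.of_forall fun x => ContinuousLinearMap.le_opNorm _ _)
  refine ⟨hi, ?_⟩
  obtain ⟨C₀, hC₀⟩ := hasCompactSupport_cutoff.exists_bound_of_continuous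
    contDiff_cutoff.continuous
  obtain ⟨C₁, hC₁⟩ := (hasCompactSupport_cutoff.fderiv ℝ).exists_bound_of_continuous
    (contDiff_cutoff.continuous_fderiv (by simp))
  have hC₁0 : 0 ≤ C₁ := (norm_nonneg _).trans (hC₁ 0)
  have hε : ∀ n : ℕ, (0 : ℝ) < 1 / ((n : ℝ) + 1) := fun n => by positivity
  have hε1 : ∀ n : ℕ, 1 / ((n : ℝ) + 1) ≤ 1 := fun n => by
    rw [div_le_one (by positivity)]; linarith [(n.cast_nonneg : (0 : ℝ) ≤ n)]
  set χ : ℕ → E3 → ℝ := fun n x => cutoff ((1 / ((n : ℝ) + 1)) • x) with hχ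
  have hsc : ∀ n, ContDiff ℝ ∞ (χ n) := fun n => contDiff_cutoff.comp (contDiff_const_smul _)
  have hcc : ∀ n, HasCompactSupport (χ n) := fun n =>
    hasCompactSupport_cutoff.comp_smul (hε n).ne'
  have hfd : ∀ n x, fderiv ℝ (χ n) x =
      (1 / ((n : ℝ) + 1)) • fderiv ℝ cutoff ((1 / ((n : ℝ) + 1)) • x) := fun n x =>
    fderiv_comp_smul _
  have hev : ∀ x : E3, ∀ᶠ n : ℕ in atTop, ‖(1 / ((n : ℝ) + 1)) • x‖ < 1 := by
    intro x
    have : Tendsto (fun n : ℕ => (1 / ((n : ℝ) + 1)) • x) atTop (𝓝 ((0 : ℝ) • x)) :=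
      tendsto_one_div_add_atTop_nhds_zero_nat.smul_const x
    rw [zero_smul] at this
    have h3 := this.norm
    rw [norm_zero] at h3
    exact h3.eventually_lt_const zero_lt_one
  have hzero : ∀ n, ∫ x, (χ n x * fderiv ℝ π x (v x) + π x * fderiv ℝ (χ n) x (v x)) = 0 := by
    intro n
    have := hv.2 (fun x => χ n x * π x) ((hsc n).mul hπ) ((hcc n).mul_right)
    rw [← this]
    refine integral_congr_ae (Eventually.of_forall fun x => ?_)
    simp only
    rw [fderiv_fun_mul ((hsc n).differentiable (by simp) x) (hπ.differentiable (by simp) x)]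
    simp
  have hlim : Tendsto (fun n => ∫ x, (χ n x * fderiv ℝ π x (v x) +
      π x * fderiv ℝ (χ n) x (v x))) atTop (𝓝 (∫ x, fderiv ℝ π x (v x))) := by
    refine tendsto_integral_of_dominated_convergence
      (fun x => C₀ * (‖fderiv ℝ π x‖ * ‖v x‖) + C₁ * (‖π x‖ * ‖v x‖)) (fun n => ?_)
      ((i1.const_mul C₀).add (i2.const_mul C₁)) (fun n => ?_) ?_
    · exact ((hsc n).continuous.aestronglyMeasurable.mul hm).add
        (h2.aestronglyMeasurable.mul (aestronglyMeasurable_clm_apply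
          ((hsc n).continuous_fderiv (by simp)).aestronglyMeasurable hv.1.aestronglyMeasurable))
    · refine Eventually.of_forall fun x => (norm_add_le _ _).trans ?_
      rw [norm_mul, norm_mul]
      refine add_le_add ?_ ?_
      · exact mul_le_mul (hC₀ _) (ContinuousLinearMap.le_opNorm _ _) (norm_nonneg _)
          ((norm_nonneg _).trans (hC₀ 0))
      · have h4 : ‖fderiv ℝ (χ n) x‖ ≤ C₁ := by
          rw [hfd, norm_smul, Real.norm_of_nonneg (hε n).le]
          exact (mul_le_of_le_one_left (norm_nonneg _) (hε1 n)).trans (hC₁ _)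
        have h5 := (fderiv ℝ (χ n) x).le_of_opNorm_le h4 (v x)
        calc ‖π x‖ * ‖fderiv ℝ (χ n) x (v x)‖ ≤ ‖π x‖ * (C₁ * ‖v x‖) :=
              mul_le_mul_of_nonneg_left h5 (norm_nonneg _)
          _ = _ := by ring
    · refine Eventually.of_forall fun x => tendsto_const_nhds.congr' ?_
      filter_upwards [hev x] with n hn
      have h6 := cutoff_eventuallyEq hn
      have h7 : χ n x = 1 := h6.eq_of_nhds
      have h8 : fderiv ℝ (χ n) x = 0 := by
        rw [hfd, h6.fderiv_eq, fderiv_const_apply, smul_zero]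
      rw [h7, h8]
      simp
  refine tendsto_nhds_unique hlim ?_
  simp only [hzero]
  exact tendsto_const_nhds

/-- This is the orthogonality of v to gradients for the function a·b, whose square integrability,
with that of its gradient, follows from the L² and uniform bounds. -/
theorem integral_fderiv_inner_eq_zero {a b v : E3 → E3} {C : ℝ} (hv : MemH v)
    (ha : ContDiff ℝ ∞ a) (hb : ContDiff ℝ ∞ b) (ha2 : MemLp a 2 volume) (hb2 : MemLp b 2 volume)
    (hC : ∀ x, ‖a x‖ ≤ C) (hCa : ∀ x, ‖fderiv ℝ a x‖ ≤ C) (hCb : ∀ x, ‖fderiv ℝ b x‖ ≤ C) :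
    Integrable (fun x => ⟪a x, fderiv ℝ b x (v x)⟫_ℝ + ⟪fderiv ℝ a x (v x), b x⟫_ℝ) ∧
      ∫ x, (⟪a x, fderiv ℝ b x (v x)⟫_ℝ + ⟪fderiv ℝ a x (v x), b x⟫_ℝ) = 0 := by
  have hC0 : 0 ≤ C := (norm_nonneg _).trans (hC 0)
  have hπ : ContDiff ℝ ∞ (fun x => ⟪a x, b x⟫_ℝ) := ha.inner ℝ hb
  have hf : ∀ x y, fderiv ℝ (fun x => ⟪a x, b x⟫_ℝ) x y =
      ⟪a x, fderiv ℝ b x y⟫_ℝ + ⟪fderiv ℝ a x y, b x⟫_ℝ := fun x y =>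
    fderiv_inner_apply ℝ (ha.differentiable (by simp) x) (hb.differentiable (by simp) x) y
  have h2 : MemLp (fun x => ⟪a x, b x⟫_ℝ) 2 volume := by
    refine (hb2.norm.const_mul C).of_le hπ.continuous.aestronglyMeasurable
      (Eventually.of_forall fun x => ?_)
    rw [norm_mul, Real.norm_of_nonneg hC0, norm_norm]
    exact (norm_inner_le_norm _ _).trans (mul_le_mul_of_nonneg_right (hC x) (norm_nonneg _))
  have hg : MemLp (fderiv ℝ (fun x => ⟪a x, b x⟫_ℝ)) 2 volume := by
    refine ((ha2.norm.add hb2.norm).const_mul C).of_le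
      (hπ.continuous_fderiv (by simp)).aestronglyMeasurable (Eventually.of_forall fun x => ?_)
    refine ContinuousLinearMap.opNorm_le_bound _ (norm_nonneg _) fun y => ?_
    rw [hf, norm_mul, Real.norm_of_nonneg hC0, Pi.add_apply,
      Real.norm_of_nonneg (by positivity : 0 ≤ ‖a x‖ + ‖b x‖)]
    refine (norm_add_le _ _).trans ?_
    have h3 := (norm_inner_le_norm (𝕜 := ℝ) (a x) (fderiv ℝ b x y)).trans
      (mul_le_mul_of_nonneg_left ((fderiv ℝ b x).le_of_opNorm_le (hCb x) y) (norm_nonneg _))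
    have h4 := (norm_inner_le_norm (𝕜 := ℝ) (fderiv ℝ a x y) (b x)).trans
      (mul_le_mul_of_nonneg_right ((fderiv ℝ a x).le_of_opNorm_le (hCa x) y) (norm_nonneg _))
    calc _ ≤ _ := add_le_add h3 h4
      _ = _ := by ring
  have key := integral_fderiv_apply_eq_zero hv hπ h2 hg
  simpa only [hf] using key

/-! ### The two equations as evolutions -/

/-- The nonlinear term of the momentum equation for smooth solenoidal fields. -/
def momentumForcing (u B : E3 → E3) (x : E3) : E3 := fderiv ℝ u x (u x) - fderiv ℝ B x (B x)

/-- The nonlinear term of the induction equation for smooth solenoidal fields. -/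
def inductionForcing (u B : E3 → E3) (x : E3) : E3 :=
  -(fderiv ℝ u x (B x) - fderiv ℝ B x (u x)) +
    (fderiv ℝ (curl B) x (B x) - fderiv ℝ B x (curl B x))

theorem memLp_slab_clm_apply {S C : ℝ} {L : ℝ → E3 → E3 →L[ℝ] E3} {v : ℝ → E3 → E3}
    (hL : ContinuousOn (Function.uncurry L) (Ioo 0 S ×ˢ univ))
    (hC : ∀ t ∈ Ioo 0 S, ∀ x, ‖L t x‖ ≤ C)
    (hv : MemLp (Function.uncurry v) 2 (slabMeasure S)) :
    MemLp (Function.uncurry fun t x => L t x (v t x)) 2 (slabMeasure S) := by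
  have : SecondCountableTopologyEither (ℝ × E3) (E3 →L[ℝ] E3) :=
    secondCountableTopologyEither_of_left _ _
  refine hv.of_le_mul (c := C) (aestronglyMeasurable_clm_apply
    (aestronglyMeasurable_slab hL) hv.aestronglyMeasurable) ?_
  filter_upwards [ae_slab_mem S] with z hz
  exact (L z.1 z.2).le_of_opNorm_le (hC z.1 hz z.2) _

theorem IsSmoothField.exists_fderiv_bound {T : ℝ} {w : ℝ → E3 → E3} {w₀ : E3 → E3}
    (h : IsSmoothField T w w₀) {S : ℝ} (hS : 0 < S) (hST : S < T) :
    ∃ C, ∀ t ∈ Ioo 0 S, ∀ x, ‖w t x‖ ≤ C ∧ ‖fderiv ℝ (w t) x‖ ≤ C ∧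
      ‖fderiv ℝ (curl (w t)) x‖ ≤ C := by
  obtain ⟨C₀, h0⟩ := h.bounded S hS hST 0 (by norm_num)
  obtain ⟨C₁, h1⟩ := h.bounded S hS hST 1 one_le_two
  obtain ⟨C₂, h2⟩ := h.bounded S hS hST 2 le_rfl
  refine ⟨max C₀ (max C₁ (‖curlL‖ * C₂)), fun t ht x => ⟨?_, ?_, ?_⟩⟩
  · have := h0 t ht x
    rw [norm_iteratedFDeriv_zero] at this
    exact this.trans (le_max_left _ _)
  · rw [norm_fderiv_eq_iteratedFDeriv_one]
    exact (h1 t ht x).trans ((le_max_left _ _).trans (le_max_right _ _))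
  · refine (norm_fderiv_curl_le (contDiff_slice h.contDiffOn ⟨ht.1, ht.2.trans hST⟩) x).trans ?_
    refine le_trans ?_ ((le_max_right _ _).trans (le_max_right _ _))
    exact mul_le_mul_of_nonneg_left (h2 t ht x) (by positivity)

namespace IsSmoothSolution

variable {T : ℝ} {u B : ℝ → E3 → E3} {u₀ B₀ : E3 → E3}

theorem momentum_evolution (h : IsSmoothSolution T u B u₀ B₀) (hu₀ : MemLp u₀ 2 volume) :
    IsSmoothEvolution T u (fun t => momentumForcing (u t) (B t)) u₀ where
  smooth := h.smooth_u
  initial_memLp := hu₀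
  div := h.div_u
  forcing_continuousOn :=
    ((contDiffOn_spatial_fderiv h.smooth_u.contDiffOn).continuousOn.clm_apply
      h.smooth_u.contDiffOn.continuousOn).sub
    ((contDiffOn_spatial_fderiv h.smooth_B.contDiffOn).continuousOn.clm_apply
      h.smooth_B.contDiffOn.continuousOn)
  forcing_memLp S hS hST := by
    have hsub : Ioo 0 S ×ˢ (univ : Set E3) ⊆ Ioo 0 T ×ˢ univ :=
      prod_mono (Ioo_subset_Ioo_right hST.le) subset_rfl
    obtain ⟨Cu, hu⟩ := h.smooth_u.exists_fderiv_bound hS hST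
    obtain ⟨CB, hB⟩ := h.smooth_B.exists_fderiv_bound hS hST
    exact (memLp_slab_clm_apply
        ((contDiffOn_spatial_fderiv h.smooth_u.contDiffOn).continuousOn.mono hsub)
        (fun t ht x => (hu t ht x).2.1) (h.smooth_u.energyClass S hS hST).memLp).sub
      (memLp_slab_clm_apply
        ((contDiffOn_spatial_fderiv h.smooth_B.contDiffOn).continuousOn.mono hsub)
        (fun t ht x => (hB t ht x).2.1) (h.smooth_B.energyClass S hS hST).memLp)
  equation := by
    obtain ⟨p, hp, heq⟩ := h.momentum
    refine ⟨p, fun t ht => contDiff_slice hp ht, fun t ht x => ?_⟩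
    have hu := contDiff_slice h.smooth_u.contDiffOn ht
    have hB := contDiff_slice h.smooth_B.contDiffOn ht
    rw [← heq t ht x, divTensor_eq hu hu (h.div_u t ht), divTensor_eq hB hB (h.div_B t ht)]
    rfl

theorem induction_evolution (h : IsSmoothSolution T u B u₀ B₀) (hB₀ : MemLp B₀ 2 volume) :
    IsSmoothEvolution T B (fun t => inductionForcing (u t) (B t)) B₀ where
  smooth := h.smooth_B
  initial_memLp := hB₀
  div := h.div_B
  forcing_continuousOn :=
    have cu := h.smooth_u.contDiffOn.continuousOn
    have cB := h.smooth_B.contDiffOn.continuousOn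
    have cL := (contDiffOn_spatial_fderiv h.smooth_u.contDiffOn).continuousOn
    have cM := (contDiffOn_spatial_fderiv h.smooth_B.contDiffOn).continuousOn
    have cJ := (contDiffOn_curl h.smooth_B.contDiffOn).continuousOn
    have cN := (contDiffOn_spatial_fderiv (contDiffOn_curl h.smooth_B.contDiffOn)).continuousOn
    ((cL.clm_apply cB).sub (cM.clm_apply cu)).neg.add ((cN.clm_apply cB).sub (cM.clm_apply cJ))
  forcing_memLp S hS hST := by
    have hsub : Ioo 0 S ×ˢ (univ : Set E3) ⊆ Ioo 0 T ×ˢ univ :=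
      prod_mono (Ioo_subset_Ioo_right hST.le) subset_rfl
    obtain ⟨Cu, hu⟩ := h.smooth_u.exists_fderiv_bound hS hST
    obtain ⟨CB, hB⟩ := h.smooth_B.exists_fderiv_bound hS hST
    have mu := (h.smooth_u.energyClass S hS hST).memLp
    have mB := (h.smooth_B.energyClass S hS hST).memLp
    have mJ := (h.smooth_B.energyClass S hS hST).curl_memLp
    have cL := (contDiffOn_spatial_fderiv h.smooth_u.contDiffOn).continuousOn.mono hsub
    have cM := (contDiffOn_spatial_fderiv h.smooth_B.contDiffOn).continuousOn.mono hsub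
    have cN := (contDiffOn_spatial_fderiv
      (contDiffOn_curl h.smooth_B.contDiffOn)).continuousOn.mono hsub
    have m1 := memLp_slab_clm_apply cL (fun t ht x => (hu t ht x).2.1) mB
    have m2 := memLp_slab_clm_apply cM (fun t ht x => (hB t ht x).2.1) mu
    have m3 := memLp_slab_clm_apply cN (fun t ht x => (hB t ht x).2.2) mB
    have m4 := memLp_slab_clm_apply cM (fun t ht x => (hB t ht x).2.1) mJ
    exact (m1.sub m2).neg.add (m3.sub m4)
  equation := by
    -- The induction equation has no pressure.
    refine ⟨fun _ _ => 0, fun t _ => contDiff_const, fun t ht x => ?_⟩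
    have hu := contDiff_slice h.smooth_u.contDiffOn ht
    have hB := contDiff_slice h.smooth_B.contDiffOn ht
    have hg : gradient (fun _ : E3 => (0 : ℝ)) x = 0 := by simp [gradient]
    rw [hg, ← h.induction_eq t ht x, curl_cross hu hB (h.div_u t ht) (h.div_B t ht),
      curl_divTensor_self hB (h.div_B t ht), inductionForcing]
    abel

end IsSmoothSolution

/-- Separated test fields suffice, since the doubling of times only ever freezes one spatial field.
-/
theorem isTestField_smul {S : ℝ} {θ : ℝ → ℝ} (hθ : IsTimeTest S θ) {φ : E3 → E3}
    (hφ : ContDiff ℝ ∞ φ) (hc : HasCompactSupport φ) : IsTestField (fun t x => θ t • φ x) := by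
  refine ⟨(hθ.contDiff.comp contDiff_fst).smul (hφ.comp contDiff_snd), ?_⟩
  refine HasCompactSupport.intro (hθ.compact.isCompact.prod hc.isCompact) ?_
  rintro ⟨t, x⟩ hz
  change θ t • φ x = 0
  by_cases ht : t ∈ tsupport θ
  · have hx : x ∉ tsupport φ := fun hx => hz ⟨ht, hx⟩
    rw [image_eq_zero_of_notMem_tsupport hx, smul_zero]
  · rw [image_eq_zero_of_notMem_tsupport ht, zero_smul]

theorem fderiv_fun_smul_const {φ : E3 → E3} (hφ : ContDiff ℝ ∞ φ) (c : ℝ) (x : E3) :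
    fderiv ℝ (fun y => c • φ y) x = c • fderiv ℝ φ x :=
  fderiv_fun_const_smul (hφ.differentiable (by simp) x) c

theorem curl_smul {φ : E3 → E3} (hφ : ContDiff ℝ ∞ φ) (c : ℝ) :
    curl (fun y => c • φ y) = fun x => c • curl φ x := by
  funext x
  rw [curl, fderiv_fun_smul_const hφ, ← curlL_apply, map_smul]
  rfl

theorem divergence_smul {φ : E3 → E3} (hφ : ContDiff ℝ ∞ φ) (c : ℝ) (x : E3) :
    divergence (fun y => c • φ y) x = c * divergence φ x := by
  rw [divergence_eq, fderiv_fun_smul_const hφ, map_smul, divergence_eq, smul_eq_mul]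

theorem laplacian_fun_smul {φ : E3 → E3} (hφ : ContDiff ℝ ∞ φ) (c : ℝ) (x : E3) :
    Laplacian.laplacian (fun y => c • φ y) x = c • Laplacian.laplacian φ x :=
  InnerProductSpace.laplacian_smul c (hφ.contDiffAt.of_le ENat.LEInfty.out)

theorem deriv_fun_smul_const {S : ℝ} {θ : ℝ → ℝ} (hθ : IsTimeTest S θ) (y : E3) (t : ℝ) :
    deriv (fun s => θ s • y) t = deriv θ t • y :=
  deriv_smul_const (hθ.contDiff.differentiable (by simp) t) y

/-- The flux of the momentum equation. -/
def momentumFlux (u B : ℝ → E3 → E3) : Flux where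
  left₁ := u
  right₁ := u
  left₂ := B
  right₂ := B
  op₁ φ x := fderiv ℝ φ x
  op₂ φ x := - fderiv ℝ φ x

/-- The flux of the induction equation. -/
def inductionFlux (u B : ℝ → E3 → E3) : Flux where
  left₁ := u
  right₁ := B
  left₂ := B
  right₂ := B
  op₁ φ x := crossL (curl φ x)
  op₂ φ x := fderiv ℝ (curl φ) x

theorem WeakMomentum.isWeakEvolution {S : ℝ} {u B : ℝ → E3 → E3} {u₀ : E3 → E3}
    {Gu GB : ℝ → E3 → E3 →L[ℝ] E3} (h : WeakMomentum u B u₀) (hu : InEnergyClass S u Gu)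
    (hB : InEnergyClass S B GB) (hu₀ : MemLp u₀ 2 volume) :
    IsWeakEvolution S u Gu (momentumFlux u B) u₀ where
  energyClass := hu
  initial_memLp := hu₀
  flux := ⟨hu.memLp, hu.memLp, hB.memLp, hB.memLp, isLocalOperator_fderiv,
    isLocalOperator_neg_fderiv⟩
  weak φ hφ hc hdiv θ hθ := by
    have key := h (fun t x => θ t • φ x) (isTestField_smul hθ hφ hc)
      (fun t x => by rw [divergence_smul hφ, hdiv, mul_zero])
    simp only [fderiv_fun_smul_const hφ, laplacian_fun_smul hφ, deriv_fun_smul_const hθ,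
      inner_smul_right, smul_apply] at key
    simp only [momentumFlux, neg_apply, inner_neg_right, mul_neg, ← sub_eq_add_neg]
    rw [← integral_const_mul]
    exact key

theorem WeakInduction.isWeakEvolution {S : ℝ} {u B : ℝ → E3 → E3} {B₀ : E3 → E3}
    {Gu GB : ℝ → E3 → E3 →L[ℝ] E3} (h : WeakInduction u B B₀) (hu : InEnergyClass S u Gu)
    (hB : InEnergyClass S B GB) (hB₀ : MemLp B₀ 2 volume) :
    IsWeakEvolution S B GB (inductionFlux u B) B₀ where
  energyClass := hB
  initial_memLp := hB₀
  flux := ⟨hu.memLp, hB.memLp, hB.memLp, hB.memLp, isLocalOperator_cross_curl,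
    isLocalOperator_fderiv_curl⟩
  weak φ hφ hc _ θ hθ := by
    have key := h (fun t x => θ t • φ x) (isTestField_smul hθ hφ hc)
    simp only [curl_smul hφ, fderiv_fun_smul_const (contDiff_curl hφ), laplacian_fun_smul hφ,
      deriv_fun_smul_const hθ, inner_smul_right, smul_apply, inner_cross_eq] at key
    simp only [inductionFlux]
    rw [← integral_const_mul]
    simpa only [map_smul, smul_apply, inner_smul_right] using key

/-! ### The relative energy inequality -/

/-- An integral form of Gronwall's lemma for functions bounded by their own primitive. -/
theorem ae_eq_zero_of_le_primitive {S K : ℝ} (hK : 0 ≤ K) {E : ℝ → ℝ}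
    (hE : Integrable E (timeMeasure S)) (h0 : ∀ t, 0 ≤ E t)
    (h : ∀ᵐ t ∂(timeMeasure S), E t ≤ K * ∫ r in Ioc 0 t, E r) :
    ∀ᵐ t ∂(timeMeasure S), E t = 0 := by
  have hsub : ∀ {t : ℝ}, t ∈ Ioo 0 S → Ioc 0 t ⊆ Ioo 0 S := fun ht r hr =>
    ⟨hr.1, hr.2.trans_lt ht.2⟩
  set M : ℝ := K * ∫ r in Ioo 0 S, E r with hM
  have key : ∀ n : ℕ, ∀ᵐ t ∂(timeMeasure S), E t ≤ M * ((K * t) ^ n / n.factorial) := by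
    -- Each substitution of the current bound into the integral inequality gains a factor Kt/(n +
    -- 1). Iteration works although E is only integrable and the inequality holds only almost
    -- everywhere.
    intro n
    induction n with
    | zero =>
      filter_upwards [h, ae_restrict_mem measurableSet_Ioo] with t ht hts
      simp only [pow_zero, Nat.factorial_zero, Nat.cast_one, div_one, mul_one]
      refine ht.trans (mul_le_mul_of_nonneg_left ?_ hK)
      exact setIntegral_mono_set hE (Eventually.of_forall h0) (hsub hts).eventuallyLE
    | succ n ih =>
      filter_upwards [h, ae_restrict_mem measurableSet_Ioo] with t ht hts
      have ih' : ∀ᵐ r ∂(volume.restrict (Ioc 0 t)), E r ≤ M * ((K * r) ^ n / n.factorial) :=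
        ae_restrict_of_ae_restrict_of_subset (hsub hts) ih
      have hc : Continuous fun r : ℝ => M * ((K * r) ^ n / n.factorial) := by fun_prop
      have hle : ∫ r in Ioc 0 t, E r ≤ ∫ r in Ioc 0 t, M * ((K * r) ^ n / n.factorial) :=
        integral_mono_ae (hE.mono_measure (Measure.restrict_mono (hsub hts) le_rfl))
          (hc.integrableOn_Ioc) ih'
      have hcalc : ∫ r in Ioc 0 t, M * ((K * r) ^ n / n.factorial) =
          M * (K ^ n / n.factorial * (t ^ (n + 1) / (n + 1))) := by
        have e1 : ∀ r : ℝ, M * ((K * r) ^ n / n.factorial) =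
            M * (K ^ n / n.factorial) * r ^ n := fun r => by rw [mul_pow]; ring
        simp only [e1]
        rw [← intervalIntegral.integral_of_le hts.1.le, intervalIntegral.integral_const_mul,
          integral_pow]
        simp
        ring
      refine ht.trans ((mul_le_mul_of_nonneg_left (hle.trans_eq hcalc) hK).trans_eq ?_)
      have hn : (n.factorial : ℝ) ≠ 0 := by positivity
      have hn1 : (n : ℝ) + 1 ≠ 0 := by positivity
      rw [Nat.factorial_succ]
      push_cast
      field_simp
      ring
  filter_upwards [ae_all_iff.2 key] with t ht
  refine le_antisymm ?_ (h0 t)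
  have hlim : Tendsto (fun n : ℕ => M * ((K * t) ^ n / n.factorial)) atTop (𝓝 (M * 0)) :=
    (FloorSemiring.tendsto_pow_div_factorial_atTop (K * t)).const_mul M
  rw [mul_zero] at hlim
  exact ge_of_tendsto' hlim ht

theorem integral_inner_self_eq (v : E3 → E3) : ∫ x, ⟪v x, v x⟫_ℝ = ∫ x, ‖v x‖ ^ 2 := by
  simp only [real_inner_self_eq_norm_sq]

theorem integral_norm_sub_sq {v w : E3 → E3} (hv : MemLp v 2 volume) (hw : MemLp w 2 volume) :
    ∫ x, ‖v x - w x‖ ^ 2 =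
      (∫ x, ‖v x‖ ^ 2) - 2 * (∫ x, ⟪v x, w x⟫_ℝ) + ∫ x, ‖w x‖ ^ 2 := by
  have i1 := (memLp_two_iff_integrable_sq_norm hv.aestronglyMeasurable).1 hv
  have i2 := (memLp_two_iff_integrable_sq_norm hw.aestronglyMeasurable).1 hw
  have i3 : Integrable (fun x => 2 * ⟪v x, w x⟫_ℝ) := (integrable_inner_of_memLp hv hw).const_mul 2
  have i13 : Integrable (fun x => ‖v x‖ ^ 2 - 2 * ⟪v x, w x⟫_ℝ) := i1.sub i3
  rw [← integral_const_mul, ← integral_sub i1 i3, ← integral_add i13 i2]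
  simp only [norm_sub_sq_real]

/-- The flux terms of the relative energy are controlled by the relative energy itself. -/
theorem relative_flux_le {u B u' B' : E3 → E3} {C : ℝ} (hu : ContDiff ℝ ∞ u)
    (hB : ContDiff ℝ ∞ B) (hu2 : MemLp u 2 volume) (hB2 : MemLp B 2 volume)
    (hJ2 : MemLp (curl B) 2 volume) (hu' : MemH u') (hB' : MemH B')
    (hHu : MemLp (momentumForcing u B) 2 volume) (hHB : MemLp (inductionForcing u B) 2 volume)
    (bu : ∀ x, ‖u x‖ ≤ C) (bB : ∀ x, ‖B x‖ ≤ C) (bL : ∀ x, ‖fderiv ℝ u x‖ ≤ C)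
    (bM : ∀ x, ‖fderiv ℝ B x‖ ≤ C) (bN : ∀ x, ‖fderiv ℝ (curl B) x‖ ≤ C) :
    (-(∫ x, ⟪u x, momentumForcing u B x⟫_ℝ) - ∫ x, ⟪B x, inductionForcing u B x⟫_ℝ) -
      (((∫ x, ⟪u' x, fderiv ℝ u x (u' x)⟫_ℝ) + ∫ x, ⟪B' x, (- fderiv ℝ u x) (B' x)⟫_ℝ) +
        ((∫ x, ⟪u' x, crossL (curl B x) (B' x)⟫_ℝ) +
          ∫ x, ⟪B' x, fderiv ℝ (curl B) x (B' x)⟫_ℝ) -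
        (∫ x, ⟪u' x, momentumForcing u B x⟫_ℝ) - ∫ x, ⟪B' x, inductionForcing u B x⟫_ℝ) ≤
      (4 * C + ‖crossL‖ * (‖curlL‖ * C)) * ∫ x, (‖u' x - u x‖ ^ 2 + ‖B' x - B x‖ ^ 2) := by
  have hC0 : 0 ≤ C := (norm_nonneg _).trans (bu 0)
  have bX : ∀ x, ‖crossL (curl B x)‖ ≤ ‖crossL‖ * (‖curlL‖ * C) := fun x =>
    (crossL.le_opNorm _).trans (mul_le_mul_of_nonneg_left ((norm_curlOf_le _).trans
      (mul_le_mul_of_nonneg_left (bM x) (by positivity))) (by positivity))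
  have cL := (hu.continuous_fderiv (by simp)).aestronglyMeasurable (μ := volume)
  have cN := ((contDiff_curl hB).continuous_fderiv (by simp)).aestronglyMeasurable (μ := volume)
  have cX := (crossL.continuous.comp (contDiff_curl hB).continuous).aestronglyMeasurable
    (μ := volume)
  have hJ : MemH (curl B) :=
    ⟨hJ2, weakDivFree_of_contDiff (contDiff_curl hB) (divergence_curl hB)⟩
  have add : ∀ {f g : E3 → ℝ} {a b : ℝ}, (Integrable f ∧ ∫ x, f x = a) →
      (Integrable g ∧ ∫ x, g x = b) →
      Integrable (fun x => f x + g x) ∧ ∫ x, (f x + g x) = a + b := fun hf hg =>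
    ⟨hf.1.add hg.1, by rw [integral_add hf.1 hg.1, hf.2, hg.2]⟩
  have sub : ∀ {f g : E3 → ℝ} {a b : ℝ}, (Integrable f ∧ ∫ x, f x = a) →
      (Integrable g ∧ ∫ x, g x = b) →
      Integrable (fun x => f x - g x) ∧ ∫ x, (f x - g x) = a - b := fun hf hg =>
    ⟨hf.1.sub hg.1, by rw [integral_sub hf.1 hg.1, hf.2, hg.2]⟩
  have smul : ∀ (c : ℝ) {f : E3 → ℝ} {a : ℝ}, (Integrable f ∧ ∫ x, f x = a) →
      Integrable (fun x => c * f x) ∧ ∫ x, c * f x = c * a := fun c f a hf =>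
    ⟨hf.1.const_mul c, by rw [integral_const_mul, hf.2]⟩
  have neg : ∀ {f : E3 → ℝ} {a : ℝ}, (Integrable f ∧ ∫ x, f x = a) →
      Integrable (fun x => - f x) ∧ ∫ x, - f x = - a := fun hf =>
    ⟨hf.1.neg, by rw [integral_neg, hf.2]⟩
  have i1 := integrable_inner_of_memLp hu2 hHu
  have i2 := integrable_inner_of_memLp hB2 hHB
  have i3 := integrable_inner_apply hu'.1 hu'.1 cL (Eventually.of_forall bL)
  have i4 : Integrable (fun x => ⟪B' x, (- fderiv ℝ u x) (B' x)⟫_ℝ) :=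
    integrable_inner_apply hB'.1 hB'.1 cL.neg
      (Eventually.of_forall fun x => (norm_neg (fderiv ℝ u x)).trans_le (bL x))
  have i5 : Integrable (fun x => ⟪u' x, crossL (curl B x) (B' x)⟫_ℝ) :=
    integrable_inner_apply hu'.1 hB'.1 cX (Eventually.of_forall bX)
  have i6 := integrable_inner_apply hB'.1 hB'.1 cN (Eventually.of_forall bN)
  have i7 := integrable_inner_of_memLp hu'.1 hHu
  have i8 := integrable_inner_of_memLp hB'.1 hHB
  have lhs := sub (sub (neg ⟨i1, rfl⟩) ⟨i2, rfl⟩)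
    (sub (sub (add (add ⟨i3, rfl⟩ ⟨i4, rfl⟩) (add ⟨i5, rfl⟩ ⟨i6, rfl⟩)) ⟨i7, rfl⟩) ⟨i8, rfl⟩)
  -- The terms of `relative_energy_algebra` outside the quadratic form are -½u'·∇(|u|² + |B|²) +
  -- B'·∇(u·B) - B'·∇(B·J) + ½J·∇|B|² with J = curl B. All have integral zero, as u', B' and J are
  -- solenoidal.
  have d1 := integral_fderiv_inner_eq_zero hu' hu hu hu2 hu2 bu bL bL
  have d2 := integral_fderiv_inner_eq_zero hu' hB hB hB2 hB2 bB bM bM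
  have d3 := integral_fderiv_inner_eq_zero hB' hu hB hu2 hB2 bu bL bM
  have d4 := integral_fderiv_inner_eq_zero hB' hB (contDiff_curl hB) hB2 hJ2 bB bM bN
  have d5 := integral_fderiv_inner_eq_zero hJ hB hB hB2 hB2 bB bM bM
  have d := add (sub (add (smul (-(1 / 2)) (add d1 d2)) d3) d4) (smul (1 / 2) d5)
  have hw := hu'.1.sub hu2
  have hb := hB'.1.sub hB2
  have iw : Integrable (fun x => ‖u' x - u x‖ ^ 2) :=
    (memLp_two_iff_integrable_sq_norm hw.aestronglyMeasurable).1 hw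
  have ib : Integrable (fun x => ‖B' x - B x‖ ^ 2) :=
    (memLp_two_iff_integrable_sq_norm hb.aestronglyMeasurable).1 hb
  have iwb : Integrable (fun x => ‖u' x - u x‖ ^ 2 + ‖B' x - B x‖ ^ 2) := iw.add ib
  have rhs := add (smul (4 * C + ‖crossL‖ * (‖curlL‖ * C)) ⟨iwb, rfl⟩) d
  rw [← lhs.2]
  refine (integral_mono lhs.1 rhs.1 fun x => ?_).trans_eq ?_
  · have halg := relative_energy_algebra (fderiv ℝ u x) (fderiv ℝ B x) (fderiv ℝ (curl B) x)
      (u x) (B x) (u' x) (B' x) (curl B x) rfl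
    -- The bounds q2 and q4 each contribute 2C|B' - B|², q1 contributes 2C|u' - u|², and q3 supplies
    -- the constant with `crossL`. The slack q5 raises 2C to the common 4C.
    have q1 := (abs_le.1 (abs_inner_apply_le (u' x - u x) (u' x - u x) _ (bL x))).1
    have q2 := (abs_le.1 (abs_inner_apply_le (B' x - B x) (B' x - B x) _ (bL x))).2
    have q3 := (abs_le.1 (abs_inner_apply_le (u' x - u x) (B' x - B x) _ (bX x))).1
    have q4 := (abs_le.1 (abs_inner_apply_le (B' x - B x) (B' x - B x) _ (bN x))).1
    have q5 : 0 ≤ C * ‖u' x - u x‖ ^ 2 := by positivity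
    simp only [momentumForcing, inductionForcing, neg_apply, inner_neg_right] at halg ⊢
    rw [real_inner_comm (u x) (fderiv ℝ u x (u' x)), real_inner_comm (B x) (fderiv ℝ B x (u' x)),
      real_inner_comm (B x) (fderiv ℝ B x (curl B x))]
    linarith
  · rw [rhs.2]
    simp

/-! ### Weak-strong uniqueness -/

theorem integrable_add_norm_sq {S : ℝ} {v w : ℝ → E3 → E3}
    (hv : MemLp (Function.uncurry v) 2 (slabMeasure S))
    (hw : MemLp (Function.uncurry w) 2 (slabMeasure S)) :
    Integrable (fun z : ℝ × E3 => ‖v z.1 z.2‖ ^ 2 + ‖w z.1 z.2‖ ^ 2) (slabMeasure S) :=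
  ((memLp_two_iff_integrable_sq_norm hv.aestronglyMeasurable).1 hv).add
    ((memLp_two_iff_integrable_sq_norm hw.aestronglyMeasurable).1 hw)

theorem integral_add_norm_sq {v w : E3 → E3} (hv : MemLp v 2 volume) (hw : MemLp w 2 volume) :
    ∫ x, (‖v x‖ ^ 2 + ‖w x‖ ^ 2) = (∫ x, ‖v x‖ ^ 2) + ∫ x, ‖w x‖ ^ 2 :=
  integral_add ((memLp_two_iff_integrable_sq_norm hv.aestronglyMeasurable).1 hv)
    ((memLp_two_iff_integrable_sq_norm hw.aestronglyMeasurable).1 hw)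

/-- On (0,S) with S < T all bounds on the smooth solution are uniform, and the relative energy
satisfies a closed Gronwall inequality. -/
theorem ae_eq_of_lt {u₀ B₀ : E3 → E3} (hu₀ : MemLp u₀ 2 volume) (hB₀ : MemLp B₀ 2 volume)
    {u₂ B₂ : ℝ → E3 → E3} (h₂ : IsGlobalWeakSolution u₂ B₂ u₀ B₀) {T : ℝ}
    {u₁ B₁ : ℝ → E3 → E3} (h₁ : IsSmoothSolution T u₁ B₁ u₀ B₀) {S : ℝ} (hS : 0 < S)
    (hST : S < T) :
    ∀ᵐ z ∂(slabMeasure S), u₂ z.1 z.2 = u₁ z.1 z.2 ∧ B₂ z.1 z.2 = B₁ z.1 z.2 := by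
  obtain ⟨Gu, GB, hclass, hmom, hind, henergy⟩ := h₂
  obtain ⟨cu, cB⟩ := hclass S hS
  have eu := h₁.smooth_u.energyClass S hS hST
  have eB := h₁.smooth_B.energyClass S hS hST
  have evu := h₁.momentum_evolution hu₀
  have evB := h₁.induction_evolution hB₀
  obtain ⟨iXu, Xu⟩ := (hmom.isWeakEvolution cu cB hu₀).cross_identity hS hST evu
  obtain ⟨iXB, XB⟩ := (hind.isWeakEvolution cu cB hB₀).cross_identity hS hST evB
  obtain ⟨iYu, Yu⟩ := evu.energy_identity hS hST
  obtain ⟨iYB, YB⟩ := evB.energy_identity hS hST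
  obtain ⟨C₁, hC₁⟩ := h₁.smooth_u.exists_fderiv_bound hS hST
  obtain ⟨C₂, hC₂⟩ := h₁.smooth_B.exists_fderiv_bound hS hST
  set C := max C₁ C₂ with hC
  set K := 4 * C + ‖crossL‖ * (‖curlL‖ * C) with hK
  have hC0 : 0 ≤ C := ((norm_nonneg _).trans
    (hC₁ (S / 2) ⟨by linarith, by linarith⟩ 0).1).trans (le_max_left _ _)
  set E : ℝ → ℝ := fun r => ∫ x, (‖u₂ r x - u₁ r x‖ ^ 2 + ‖B₂ r x - B₁ r x‖ ^ 2) with hE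
  have iz : Integrable (fun z : ℝ × E3 =>
      ‖u₂ z.1 z.2 - u₁ z.1 z.2‖ ^ 2 + ‖B₂ z.1 z.2 - B₁ z.1 z.2‖ ^ 2) (slabMeasure S) :=
    integrable_add_norm_sq (v := fun t x => u₂ t x - u₁ t x) (w := fun t x => B₂ t x - B₁ t x)
      (cu.memLp.sub eu.memLp) (cB.memLp.sub eB.memLp)
  have iE : Integrable E (timeMeasure S) := iz.integral_prod_left
  have iD : Integrable (fun r => dissipation (Gu r) (GB r)) (timeMeasure S) :=
    (integrable_add_norm_sq cu.curl_memLp cB.curl_memLp).integral_prod_left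
  have E0 : ∀ t, 0 ≤ E t := fun t => integral_nonneg fun x => by positivity
  -- The integrand of the energy balance: twice the negative of the weak dissipation, plus the
  -- smooth energy identities, minus twice the cross identities. The curl terms complete the squares
  -- -2|curl (u₂ - u₁)|² and -2|curl (B₂ - B₁)|²; the rest is twice `relative_flux_le`.
  have flux : ∀ᵐ r ∂(timeMeasure S),
      -2 * dissipation (Gu r) (GB r) +
        (-2 * (∫ x, ⟪u₁ r x, momentumForcing (u₁ r) (B₁ r) x⟫_ℝ) -
          2 * ∫ x, ⟪curl (u₁ r) x, curl (u₁ r) x⟫_ℝ) +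
        (-2 * (∫ x, ⟪B₁ r x, inductionForcing (u₁ r) (B₁ r) x⟫_ℝ) -
          2 * ∫ x, ⟪curl (B₁ r) x, curl (B₁ r) x⟫_ℝ) -
        2 * ((momentumFlux u₂ B₂).eval r (u₁ r) -
          (∫ x, ⟪u₂ r x, momentumForcing (u₁ r) (B₁ r) x⟫_ℝ) -
          2 * ∫ x, ⟪curlOf (Gu r x), curl (u₁ r) x⟫_ℝ) -
        2 * ((inductionFlux u₂ B₂).eval r (B₁ r) -
          (∫ x, ⟪B₂ r x, inductionForcing (u₁ r) (B₁ r) x⟫_ℝ) -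
          2 * ∫ x, ⟪curlOf (GB r x), curl (B₁ r) x⟫_ℝ) ≤ 2 * K * E r := by
    filter_upwards [ae_restrict_mem measurableSet_Ioo, cu.mem_H, cB.mem_H, eu.mem_H, eB.mem_H,
      memLp_slice cu.curl_memLp, memLp_slice cB.curl_memLp, memLp_slice eu.curl_memLp,
      memLp_slice eB.curl_memLp, memLp_slice (evu.forcing_memLp S hS hST),
      memLp_slice (evB.forcing_memLp S hS hST)]
      with r hr hu₂ hB₂ hu₁ hB₁ hcu hcB hcu₁ hcB₁ hHu hHB
    have hrT : r ∈ Ioo 0 T := ⟨hr.1, hr.2.trans hST⟩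
    have key := relative_flux_le (C := C) (contDiff_slice h₁.smooth_u.contDiffOn hrT)
      (contDiff_slice h₁.smooth_B.contDiffOn hrT) hu₁.1 hB₁.1 hcB₁ hu₂ hB₂ hHu hHB
      (fun x => (hC₁ r hr x).1.trans (le_max_left _ _))
      (fun x => (hC₂ r hr x).1.trans (le_max_right _ _))
      (fun x => (hC₁ r hr x).2.1.trans (le_max_left _ _))
      (fun x => (hC₂ r hr x).2.1.trans (le_max_right _ _))
      (fun x => (hC₂ r hr x).2.2.trans (le_max_right _ _))
    have q1 := integral_norm_sub_sq hcu hcu₁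
    have q2 := integral_norm_sub_sq hcB hcB₁
    have p1 : 0 ≤ ∫ x, ‖curlOf (Gu r x) - curlOf (fderiv ℝ (u₁ r) x)‖ ^ 2 :=
      integral_nonneg fun x => by positivity
    have p2 : 0 ≤ ∫ x, ‖curlOf (GB r x) - curlOf (fderiv ℝ (B₁ r) x)‖ ^ 2 :=
      integral_nonneg fun x => by positivity
    have hD : dissipation (Gu r) (GB r) =
        (∫ x, ‖curlOf (Gu r x)‖ ^ 2) + ∫ x, ‖curlOf (GB r x)‖ ^ 2 :=
      integral_add_norm_sq hcu hcB
    rw [hD, integral_inner_self_eq, integral_inner_self_eq]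
    simp only [Flux.eval, momentumFlux, inductionFlux]
    simp only [curl] at key q1 q2 ⊢
    linarith
  have hle : ∀ᵐ t ∂(timeMeasure S), E t ≤ 2 * K * ∫ r in Ioc 0 t, E r := by
    have hen : ∀ᵐ t ∂(timeMeasure S), energy (u₂ t) (B₂ t) +
        ∫ r in Ioc 0 t, dissipation (Gu r) (GB r) ≤ energy u₀ B₀ :=
      ae_restrict_of_ae_restrict_of_subset Ioo_subset_Ioi_self henergy
    filter_upwards [ae_restrict_mem measurableSet_Ioo, cu.mem_H, cB.mem_H, eu.mem_H, eB.mem_H,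
      hen, Xu, XB, Yu, YB] with t ht hu₂ hB₂ hu₁ hB₁ hen xu xB yu yB
    have hsub : Ioc 0 t ⊆ Ioo 0 S := fun r hr => ⟨hr.1, hr.2.trans_lt ht.2⟩
    have hres : ∀ {f : ℝ → ℝ}, Integrable f (timeMeasure S) →
        Integrable f (volume.restrict (Ioc 0 t)) := fun hf =>
      hf.mono_measure (Measure.restrict_mono hsub le_rfl)
    have hmono := integral_mono_ae
      ((((((hres iD).const_mul (-2)).add (hres iYu)).add (hres iYB)).sub
        ((hres iXu).const_mul 2)).sub ((hres iXB).const_mul 2))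
      ((hres iE).const_mul (2 * K)) (ae_restrict_of_ae_restrict_of_subset hsub flux)
    rw [integral_sub' (((((hres iD).const_mul (-2)).add (hres iYu)).add (hres iYB)).sub
        ((hres iXu).const_mul 2)) ((hres iXB).const_mul 2),
      integral_sub' ((((hres iD).const_mul (-2)).add (hres iYu)).add (hres iYB))
        ((hres iXu).const_mul 2),
      integral_add' (((hres iD).const_mul (-2)).add (hres iYu)) (hres iYB),
      integral_add' ((hres iD).const_mul (-2)) (hres iYu), integral_const_mul,
      integral_const_mul, integral_const_mul, integral_const_mul] at hmono
    -- On expanding the squares the initial energies enter with coefficients 1, -2 and 1 and cancel.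
    have hEt : E t = (∫ x, ‖u₂ t x - u₁ t x‖ ^ 2) + ∫ x, ‖B₂ t x - B₁ t x‖ ^ 2 :=
      integral_add_norm_sq (v := fun x => u₂ t x - u₁ t x) (w := fun x => B₂ t x - B₁ t x)
        (hu₂.1.sub hu₁.1) (hB₂.1.sub hB₁.1)
    rw [integral_norm_sub_sq hu₂.1 hu₁.1, integral_norm_sub_sq hB₂.1 hB₁.1] at hEt
    rw [energy, energy, integral_add_norm_sq hu₂.1 hB₂.1, integral_add_norm_sq hu₀ hB₀] at hen
    rw [integral_inner_self_eq] at xu xB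
    rw [integral_inner_self_eq, integral_inner_self_eq] at yu yB
    linarith
  have hzero := ae_eq_zero_of_le_primitive (by positivity) iE E0 hle
  have hint : ∫ z, (‖u₂ z.1 z.2 - u₁ z.1 z.2‖ ^ 2 + ‖B₂ z.1 z.2 - B₁ z.1 z.2‖ ^ 2)
      ∂(slabMeasure S) = 0 := by
    rw [slabMeasure, integral_prod _ iz]
    exact integral_eq_zero_of_ae hzero
  rw [integral_eq_zero_iff_of_nonneg (fun z => by positivity) iz] at hint
  filter_upwards [hint] with z hz
  have hz' : ‖u₂ z.1 z.2 - u₁ z.1 z.2‖ ^ 2 + ‖B₂ z.1 z.2 - B₁ z.1 z.2‖ ^ 2 = 0 := hz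
  have h1 : ‖u₂ z.1 z.2 - u₁ z.1 z.2‖ ^ 2 = 0 := by
    nlinarith [sq_nonneg ‖u₂ z.1 z.2 - u₁ z.1 z.2‖, sq_nonneg ‖B₂ z.1 z.2 - B₁ z.1 z.2‖]
  have h2 : ‖B₂ z.1 z.2 - B₁ z.1 z.2‖ ^ 2 = 0 := by linarith
  exact ⟨sub_eq_zero.1 (norm_eq_zero.1 (pow_eq_zero_iff two_ne_zero |>.1 h1)),
    sub_eq_zero.1 (norm_eq_zero.1 (pow_eq_zero_iff two_ne_zero |>.1 h2))⟩

end HallMHD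

end

theorem theorem2p4 (u₀ B₀ : HallMHD.E3 → HallMHD.E3)
    (hu₀ : HallMHD.MemH u₀) (hB₀ : HallMHD.MemH B₀)
    (hu₀_smooth : ContDiff ℝ ∞ u₀) (hB₀_smooth : ContDiff ℝ ∞ B₀)
    (u₂ B₂ : ℝ → HallMHD.E3 → HallMHD.E3)
    (h₂ : HallMHD.IsGlobalWeakSolution u₂ B₂ u₀ B₀)
    (T : ℝ) (hT : 0 < T)
    (u₁ B₁ : ℝ → HallMHD.E3 → HallMHD.E3)
    (h₁ : HallMHD.IsSmoothSolution T u₁ B₁ u₀ B₀) :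
    ∀ᵐ z : ℝ × HallMHD.E3 ∂(volume.restrict (Ioo 0 T ×ˢ univ)),
      u₂ z.1 z.2 = u₁ z.1 z.2 ∧ B₂ z.1 z.2 = B₁ z.1 z.2 := by
  -- The smooth solution is controlled only on (0,S) with S < T, so (0,T) is exhausted by countably
  -- many such intervals.
  obtain ⟨s, -, hs, hlim⟩ := exists_seq_strictMono_tendsto' hT
  have hcover : Ioo 0 T ×ˢ (univ : Set HallMHD.E3) = ⋃ n, Ioo 0 (s n) ×ˢ univ := by
    ext ⟨t, x⟩
    simp only [mem_prod, mem_univ, and_true, mem_iUnion]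
    refine ⟨fun ht => ?_, fun ⟨n, hn⟩ => ⟨hn.1, hn.2.trans (hs n).2⟩⟩
    obtain ⟨n, hn⟩ := (hlim.eventually_const_lt ht.2).exists
    exact ⟨n, ht.1, hn⟩
  rw [hcover, ae_restrict_iUnion_iff]
  intro n
  rw [HallMHD.restrict_slab]
  exact HallMHD.ae_eq_of_lt hu₀.1 hB₀.1 h₂ h₁ (hs n).1 (hs n).2
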